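/- A presentation of matroids is a rule by which certain binary strings $w$ encode matroids $\mathcal M_w$ on ground sets $\{0,\dots,n_w-1\}$. It is succinct if there is a polynomial-time algorithm that, given a code $w$ and the indicator vector in $\{0,1\}^{n_w}$ of a subset $A$ of the ground set, computes the rank $\mathrm{rk}_{\mathcal M_w}(A)$ (polynomial time means time polynomial in the length of the input). For a matroid $\mathcal M$ of rank $r$ on a finite ground set $X$, a subset $R\subseteq X$ and an integer $a$, let $\mathrm B(\mathcal M,R,a)$ be the number of bases $A$ of $\mathcal M$ with $|A\cap R|=a$. Let $\mathrm P(\mathcal M,R,a)=\mathrm B(\mathcal M,R,a)\binom{r}{a}^{-1}$ for $0\le a\le r$, and $\mathrm P(\mathcal M,R,a)=0$ for $a<0$ and for $a>r$. For a given presentation, $\mathrm{EBULC}_0$ is the following decision problem. An instance is a triple $(\mathcal M,R,a)$, where $\mathcal M$ is a presented matroid with ground set $X$, given by its code, $R\subseteq X$ is given by its indicator vector, and $0\le a\le \mathrm{rk}(\mathcal M)$ is an integer given in binary; the question is whether $$\mathrm P(\mathcal M,R,a)^2=\mathrm P(\mathcal M,R,a+1)\,\mathrm P(\mathcal M,R,a-1).$$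 Corollary. For every succinct presentation of matroids, $\mathrm{EBULC}_0\in\mathsf{coNP}$. That is, there is a language in $\mathsf{coNP}$ which contains an instance $(\mathcal M,R,a)$ if and only if equality holds for it. Moreover, if the set of (encodings of) all instances is itself in $\mathsf{coNP}$ (for example, if it is decidable in polynomial time), then the set of all instances for which equality holds is a language in $\mathsf{coNP}$. -/

import Mathlib

open Computability Turing

/-! ### Polynomial time, NP and coNP

Polynomial-time computability is Mathlib's `Turing.TM2ComputableInPolyTime`: a multi-stack Turing
machine with finitely many stacks, labels and internal states, whose number of steps is bounded by
a polynomial in the length of the encoded input. -/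

/-- The function `f` is computable in polynomial time with respect to the given encodings. -/
def PolyTimeComputable {α β Γ₁ Γ₂ : Type} (ea : Encoding α Γ₁) (eb : Encoding β Γ₂)
    (f : α → β) : Prop :=
  Nonempty (TM2ComputableInPolyTime ea.encode eb.encode f)

/-- A language is in NP: there are a polynomial `p` and a polynomial-time verifier `V` such that
`x` is in the language iff some binary certificate `c` of length at most `p(|x|)` is accepted. -/
def Language.InNP {Γ : Type} [Fintype Γ] (L : Language Γ) : Prop :=
  ∃ (p : Polynomial ℕ) (V : List Γ × List Bool → Bool),
    PolyTimeComputable (encodingProd (encodingList Γ) (encodingList Bool)) encodingBoolBool V ∧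
    ∀ x : List Γ, x ∈ L ↔ ∃ c : List Bool, c.length ≤ p.eval x.length ∧ V (x, c) = true

/-- A language is in coNP: its complement is in NP. -/
def Language.InCoNP {Γ : Type} [Fintype Γ] (L : Language Γ) : Prop :=
  Language.InNP Lᶜ

/-! ### The Stanley–Yan inequality for `k = 0` -/

namespace Matroid

/-- The rank of a matroid as a natural number. -/
noncomputable def natRank {α : Type} (M : Matroid α) : ℕ := M.eRank.toNat

/-- The number `B(M, R, a)` of bases `A` of `M` with `|A ∩ R| = a`. -/
noncomputable def syB {α : Type} (M : Matroid α) (R : Set α) (a : ℤ) : ℕ :=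
  {A : Set α | M.IsBase A ∧ ((A ∩ R).ncard : ℤ) = a}.ncard

/-- `P(M, R, a) = B(M, R, a) / (r choose a)` with `r` the rank of `M`. For `a < 0` and for `a > r`
we have `B(M, R, a) = 0`, and the value is `0`. -/
noncomputable def syP {α : Type} (M : Matroid α) (R : Set α) (a : ℤ) : ℚ :=
  (M.syB R a : ℚ) / (M.natRank.choose a.toNat : ℚ)

/-- Equality in the Stanley–Yan inequality for `k = 0`. -/
def SYEquality {α : Type} (M : Matroid α) (R : Set α) (a : ℕ) : Prop :=
  M.syP R a ^ 2 = M.syP R ((a : ℤ) + 1) * M.syP R ((a : ℤ) - 1)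

end Matroid

/-! ### Succinct presentations -/

/-- A presentation of matroids: some binary strings (`codes`) each encode a matroid, whose ground
set has `size w` elements, labelled `0, …, size w - 1`. The values of `size` and `matroid` at
strings outside `codes` are irrelevant. -/
structure MatroidPresentation where
  codes : Set (List Bool)
  size : List Bool → ℕ
  matroid : (w : List Bool) → Matroid (Fin (size w))
  ground_eq : ∀ w ∈ codes, (matroid w).E = Set.univ

namespace MatroidPresentation

/-- The presentation is succinct: the rank of a subset of the ground set is computable in polynomial
time from the code of the matroid and the indicator vector of the subset. (Ranks are written in
binary.) -/
def Succinct (𝓟 : MatroidPresentation) : Prop :=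
  ∃ f : List Bool × List Bool → ℕ,
    PolyTimeComputable (encodingProd (encodingList Bool) (encodingList Bool)) encodingNatBool f ∧
    ∀ w ∈ 𝓟.codes, ∀ A : Fin (𝓟.size w) → Bool,
      f (w, List.ofFn A) = ((𝓟.matroid w).eRk {i | A i = true}).toNat

/-- The string that encodes the instance `(M, R, a)`: the code `w` of the matroid `M`, the indicator
vector of `R`, and the binary expansion of `a`. -/
def encodeInstance (w R : List Bool) (a : ℕ) : List (Bool ⊕ (Bool ⊕ Bool)) :=
  (encodingProd (encodingList Bool) (encodingProd (encodingList Bool) encodingNatBool)).encode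
    (w, R, a)

/-- The set of all instances `(M, R, a)`, where `M` is a presented matroid, `R` is a subset of its
ground set and `0 ≤ a ≤ rk M`. -/
def instances (𝓟 : MatroidPresentation) : Language (Bool ⊕ (Bool ⊕ Bool)) :=
  {x | ∃ w ∈ 𝓟.codes, ∃ (R : Fin (𝓟.size w) → Bool) (a : ℕ),
    a ≤ (𝓟.matroid w).natRank ∧ x = encodeInstance w (List.ofFn R) a}

/-- The decision problem `EBULC_0`: the set of those instances `(M, R, a)` for which
`P(M, R, a)² = P(M, R, a + 1) P(M, R, a - 1)`. -/
def EBULC₀ (𝓟 : MatroidPresentation) : Language (Bool ⊕ (Bool ⊕ Bool)) :=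
  {x | ∃ w ∈ 𝓟.codes, ∃ (R : Fin (𝓟.size w) → Bool) (a : ℕ),
    a ≤ (𝓟.matroid w).natRank ∧ x = encodeInstance w (List.ofFn R) a ∧
      (𝓟.matroid w).SYEquality {i | R i = true} a}

end MatroidPresentation

/-! Let r be the rank and S the complement of R. Polarizing the generating polynomial of the bases
gives a symmetric multilinear form, `countForm`. Its value at i copies of 1_R and r - i copies of
1_S is i! (r-i)! B(M,R,i) = r! P(M,R,i). For 0 < a < r, fix a - 1 copies of 1_R and r - a - 1 copies
of 1_S. What remains is a bilinear form Q for which Q(1_R,1_R), Q(1_R,1_S), Q(1_S,1_S) are r! times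
P(a+1), P(a), P(a-1). The problem thus asks when a reverse Cauchy–Schwarz inequality for Q is an
equality.

The inequality itself (`hyperbolic`) is proved by induction on the number of fixed vectors. With
none, the nonloops of the contraction by an independent set fall into lines (parallel classes), and
the form is the square of the total minus the sum of the squares of the line sums. In the step, the
inequalities for the contractions by single elements add up to a Bochner inequality, which excludes
eigenvalues strictly between 0 and 1 of the normalized form. The eigenvalue 1 is simple by a Perron
argument, so the form is nonpositive on the orthogonal complement of a positive vector.

Equality with P(a) > 0 puts a combination z = α 1_R - β 1_S with α, β > 0 into the kernel of Q
(`exists_inKernel`). The kernel property passes to contractions (`InKernel.insert_of_mem`), down to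
the independent sets A of size r - 2 with a - 1 elements in R. There it says that every line through
A satisfies α |line ∩ R| = β |line ∩ S|. Conversely, such relations on all lines add up to the
kernel property of Q. Hence, for 0 < a < r, equality holds exactly if any two such lines have
proportional intersections with R and S (`equality_iff`). If P(a) = 0, both sides hold: equality by
the inequality, proportionality by basis exchange.

A failure for 0 < a < r is therefore witnessed by two sets A and one line through each, with an
inequality between products of cardinalities. All of this is expressed by comparisons of ranks
(`LineCertificate`, `not_syEquality_iff`). For a = 0 and a = r the failure is a single rank
condition. Succinctness makes every rank available in polynomial time, so failure is in NP.

The machine model offers only multi-stack Turing machines, so the verifier is assembled from program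
fragments with proved running times that may call the rank machine (`Frag`). The generic verifier of
`hasLinearCertificates_accepts` handles all three kinds of failure, and
`HasLinearCertificates.inNP_or` forms their union, to which the non-instances are added for the
second claim. -/

set_option linter.unusedSectionVars false

/-! ### Structured programs for multi-stack machines with oracle calls -/

namespace StackProg

open Function StateTransition

/-! ### Reaching a configuration within a time bound -/

/-- The transition function `f` leads from `a` to `b` in at most `t` steps. -/
def ReachIn {α : Type*} (f : α → Option α) (a b : α) (t : ℕ) : Prop :=
  Nonempty (EvalsToInTime f a (some b) t)

namespace ReachIn

variable {α : Type*} {f : α → Option α} {a b c : α} {t t₁ t₂ : ℕ}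

theorem trans (h₁ : ReachIn f a b t₁) (h₂ : ReachIn f b c t₂) : ReachIn f a c (t₁ + t₂) := by
  obtain ⟨h₁⟩ := h₁
  obtain ⟨h₂⟩ := h₂
  rw [add_comm]
  exact ⟨EvalsToInTime.trans f _ _ _ _ _ h₁ h₂⟩

theorem mono (h : ReachIn f a b t₁) (ht : t₁ ≤ t₂) : ReachIn f a b t₂ := by
  obtain ⟨h⟩ := h
  exact ⟨⟨h.toEvalsTo, h.steps_le_m.trans ht⟩⟩

theorem single (h : f a = some b) : ReachIn f a b 1 := ⟨⟨⟨1, h⟩, le_rfl⟩⟩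

theorem head (h : f a = some b) (h₂ : ReachIn f b c t) : ReachIn f a c (t + 1) := by
  rw [add_comm]
  exact (single h).trans h₂

/-- Transport of a computation along a simulation that is exact in every step. -/
theorem map {β : Type*} {g : β → Option β} (φ : α → β)
    (h : ∀ x y, f x = some y → g (φ x) = some (φ y)) (hab : ReachIn f a b t) :
    ReachIn g (φ a) (φ b) t := by
  obtain ⟨⟨⟨n, hn⟩, hle⟩⟩ := hab
  refine ⟨⟨⟨n, ?_⟩, hle⟩⟩
  have none_iter : ∀ n : ℕ, (flip bind f)^[n] (none : Option α) = none := by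
    intro n
    induction n with
    | zero => rfl
    | succ n ih => rw [iterate_succ_apply]; exact ih
  clear hle
  induction n generalizing a with
  | zero =>
    have hn' : a = b := Option.some_injective _ hn
    rw [hn']; rfl
  | succ n ih =>
    have hn' : (flip bind f)^[n] (f a) = some b := hn
    cases hfa : f a with
    | none => rw [hfa, none_iter] at hn'; cases hn'
    | some y =>
      rw [hfa] at hn'
      have := ih hn'
      change (flip bind g)^[n] (g (φ a)) = some (φ b)
      rw [h _ _ hfa]
      exact this

end ReachIn

/-! ### Program fragments

A program works on finitely many visible stacks `k : K` with alphabets `Γ k`, and may call the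
oracle machines `tm i`, whose stacks are private. -/

variable {ι : Type} [DecidableEq ι] (tm : ι → FinTM2) {K : Type} [DecidableEq K] (Γ : K → Type)

/-- The index type of all stacks, visible and private. -/
abbrev FullK (tm : ι → FinTM2) (K : Type) : Type := K ⊕ (Σ i, (tm i).K)

/-- The alphabets of all stacks, visible and private. -/
abbrev FullΓ : FullK tm K → Type
  | .inl k => Γ k
  | .inr p => (tm p.1).Γ p.2

/-- The internal states: those of the oracles, and a register for a symbol just popped. -/
abbrev FullState : Type := (∀ i, (tm i).σ) × Option (Σ k, Γ k)

/-- The contents of all stacks. -/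
abbrev FullStore : Type := ∀ k : FullK tm K, List (FullΓ tm Γ k)

/-- The contents of the visible stacks. -/
abbrev Store {K : Type} (Γ : K → Type) : Type := ∀ k : K, List (Γ k)

/-- The contents of the private stacks. -/
abbrev Priv : Type := ∀ i, ∀ k, List ((tm i).Γ k)

variable {tm Γ}

/-- The joint contents of visible and private stacks. -/
def full (s : Store Γ) (P : Priv tm) : FullStore tm Γ
  | .inl k => s k
  | .inr p => P p.1 p.2

@[simp] theorem full_inl (s : Store Γ) (P : Priv tm) (k : K) : full s P (.inl k) = s k := rfl

@[simp] theorem full_inr (s : Store Γ) (P : Priv tm) (i : ι) (k : (tm i).K) :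
    full s P (.inr ⟨i, k⟩) = P i k := rfl

theorem update_full_inl (s : Store Γ) (P : Priv tm) (k : K) (l : List (Γ k)) :
    update (full s P) (.inl k) l = full (update s k l) P := by
  funext x
  rcases x with x | ⟨i, x⟩
  · by_cases h : x = k
    · subst h; simp
    · rw [update_of_ne (by simpa using h)]
      simp [update_of_ne h]
  · rw [update_of_ne (by simp)]
    rfl

theorem update_full_inr (s : Store Γ) (P : Priv tm) (i : ι) (S : ∀ k, List ((tm i).Γ k))
    (k : (tm i).K) (l : List ((tm i).Γ k)) :
    update (full s (update P i S)) (.inr ⟨i, k⟩) l = full s (update P i (update S k l)) := by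
  funext x
  rcases x with x | ⟨j, x⟩
  · rw [update_of_ne (by simp)]; rfl
  · by_cases h : j = i
    · subst h
      by_cases h : x = k
      · subst h; simp
      · rw [update_of_ne (by simpa using h)]
        simp [update_of_ne h]
    · rw [update_of_ne (by simp only [ne_eq, Sum.inr.injEq, Sigma.mk.injEq]; tauto)]
      simp [update_of_ne h]

/-- All private stacks are empty. -/
def noPriv : Priv tm := fun _ _ => []

/-- All oracles are in their initial states. -/
def initVar (tm : ι → FinTM2) : ∀ i, (tm i).σ := fun i => (tm i).initialState

variable (tm Γ)

/-- A program fragment with one entry and one exit. -/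
structure Frag where
  Λ : Type
  [fin : Fintype Λ]
  entry : Λ
  code : ∀ {Λ' : Type}, (Λ → Λ') → Λ' → Λ → TM2.Stmt (FullΓ tm Γ) Λ' (FullState tm Γ)

variable {tm Γ}

/-- Executing the fragment `p` leads from the contents `S` to the contents `S'` of all stacks
within time `t`. The oracles are in their initial states before and after. -/
def Frag.RunsF (p : Frag tm Γ) (S S' : FullStore tm Γ) (t : ℕ) : Prop :=
  ∀ (Λ' : Type) (M : Λ' → TM2.Stmt (FullΓ tm Γ) Λ' (FullState tm Γ)) (e : p.Λ → Λ') (x : Λ'),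
    (∀ l, M (e l) = p.code e x l) → ∀ r, ∃ r',
      ReachIn (TM2.step M) ⟨some (e p.entry), (initVar tm, r), S⟩
        ⟨some x, (initVar tm, r'), S'⟩ t

/-- Executing the fragment `p` leads from the contents `s` to the contents `s'` of the visible
stacks within time `t`. -/
def Frag.Runs (p : Frag tm Γ) (s s' : Store Γ) (t : ℕ) : Prop :=
  p.RunsF (full s noPriv) (full s' noPriv) t

namespace Frag

theorem RunsF.mono {p : Frag tm Γ} {S S' : FullStore tm Γ} {t t' : ℕ} (h : p.RunsF S S' t)
    (ht : t ≤ t') : p.RunsF S S' t' := by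
  intro Λ' M e x hM r
  obtain ⟨r', h⟩ := h Λ' M e x hM r
  exact ⟨r', h.mono ht⟩

theorem Runs.mono {p : Frag tm Γ} {s s' : Store Γ} {t t' : ℕ} (h : p.Runs s s' t)
    (ht : t ≤ t') : p.Runs s s' t' := RunsF.mono h ht

/-- The fragment that does nothing. -/
def skip : Frag tm Γ where
  Λ := Unit
  entry := ()
  code _ x _ := .goto fun _ => x

theorem runs_skip (s : Store Γ) : (skip : Frag tm Γ).Runs s s 1 := by
  intro Λ' M e x hM r
  refine ⟨r, ReachIn.single ?_⟩
  change some (TM2.stepAux (M (e ())) _ _) = _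
  rw [show M (e ()) = _ from hM ()]
  rfl

/-- Push a symbol onto one of all stacks. -/
def pushF (k : FullK tm K) (a : FullΓ tm Γ k) : Frag tm Γ where
  Λ := Unit
  entry := ()
  code _ x _ := .push k (fun _ => a) (.goto fun _ => x)

theorem runsF_pushF (k : FullK tm K) (a : FullΓ tm Γ k) (S : FullStore tm Γ) :
    (pushF k a).RunsF S (update S k (a :: S k)) 1 := by
  intro Λ' M e x hM r
  refine ⟨r, ReachIn.single ?_⟩
  change some (TM2.stepAux (M (e ())) _ _) = _
  rw [show M (e ()) = _ from hM ()]
  rfl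

/-- Push a symbol onto a visible stack. -/
def push (k : K) (a : Γ k) : Frag tm Γ := pushF (.inl k) a

theorem runs_push (k : K) (a : Γ k) (s : Store Γ) :
    (push k a : Frag tm Γ).Runs s (update s k (a :: s k)) 1 := by
  have := runsF_pushF (tm := tm) (.inl k) a (full s noPriv)
  rwa [update_full_inl] at this

/-- Execute two fragments one after the other. -/
def seq (p q : Frag tm Γ) : Frag tm Γ where
  Λ := p.Λ ⊕ q.Λ
  fin := letI := p.fin; letI := q.fin; inferInstance
  entry := .inl p.entry
  code e x
    | .inl l => p.code (e ∘ .inl) (e (.inr q.entry)) l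
    | .inr l => q.code (e ∘ .inr) x l

/-- A fragment is given for every embedding of its labels and every exit label, and `RunsF`
quantifies over all ambient programs. Composition is therefore mere instantiation, with the entry of
`q` as the exit of `p`. -/
theorem RunsF.seq {p q : Frag tm Γ} {S S' S'' : FullStore tm Γ} {t t' : ℕ}
    (h : p.RunsF S S' t) (h' : q.RunsF S' S'' t') : (p.seq q).RunsF S S'' (t + t') := by
  intro Λ' M e x hM r
  obtain ⟨r₁, h₁⟩ := h Λ' M (e ∘ .inl) (e (.inr q.entry)) (fun l => hM (.inl l)) r
  obtain ⟨r₂, h₂⟩ := h' Λ' M (e ∘ .inr) x (fun l => hM (.inr l)) r₁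
  exact ⟨r₂, h₁.trans h₂⟩

theorem Runs.seq {p q : Frag tm Γ} {s s' s'' : Store Γ} {t t' : ℕ}
    (h : p.Runs s s' t) (h' : q.Runs s' s'' t') : (p.seq q).Runs s s'' (t + t') :=
  RunsF.seq h h'

/-- Read the register as a symbol of the stack `k`. -/
def readReg (k : K) : Option (Σ k, Γ k) → Option (Γ k)
  | none => none
  | some ⟨k', a⟩ => if h : k' = k then some (h ▸ a) else none

@[simp] theorem readReg_none (k : K) : readReg (Γ := Γ) k none = none := rfl

@[simp] theorem readReg_some (k : K) (a : Γ k) : readReg k (some ⟨k, a⟩) = some a := by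
  simp [readReg]

/-- Pop a symbol from a visible stack and branch on the result. -/
def pop [∀ k, Fintype (Γ k)] (k : K) (q : Option (Γ k) → Frag tm Γ) : Frag tm Γ where
  Λ := Option (Σ o, (q o).Λ)
  fin := letI := fun o => (q o).fin; inferInstance
  entry := none
  code e x
    | none => .pop (.inl k) (fun v o => (v.1, o.map (Sigma.mk k)))
        (.goto fun v => e (some ⟨readReg k v.2, (q _).entry⟩))
    | some ⟨o, l⟩ => (q o).code (fun l => e (some ⟨o, l⟩)) x l

theorem Runs.pop [∀ k, Fintype (Γ k)] {k : K} {q : Option (Γ k) → Frag tm Γ} {s s' : Store Γ}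
    {t : ℕ} (h : (q (s k).head?).Runs (update s k (s k).tail) s' t) :
    (Frag.pop k q).Runs s s' (t + 1) := by
  intro Λ' M e x hM r
  have hstep : TM2.step M ⟨some (e (Frag.pop k q).entry), (initVar tm, r), full s noPriv⟩ =
      some ⟨some (e (some ⟨(s k).head?, (q _).entry⟩)),
        (initVar tm, (s k).head?.map (Sigma.mk k)), full (update s k (s k).tail) noPriv⟩ := by
    rw [TM2.step, hM]
    have hr : readReg k ((s k).head?.map (Sigma.mk k)) = (s k).head? := by
      cases (s k).head? <;> simp
    simp only [Frag.pop, TM2.stepAux, full_inl, ← update_full_inl]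
    rw [hr]
  obtain ⟨r', h⟩ := h Λ' M (fun l => e (some ⟨_, l⟩)) x (fun l => hM (some ⟨_, l⟩))
    ((s k).head?.map (Sigma.mk k))
  exact ⟨r', ReachIn.head hstep h⟩

/-- Pop symbols from one of all stacks until it is empty, translate each of them by `g`, and
execute a fragment that depends on the result. -/
def loopF [∀ k, Fintype (Γ k)] (kk : FullK tm K) (k : K) (g : FullΓ tm Γ kk → Γ k)
    (body : Γ k → Frag tm Γ) : Frag tm Γ where
  Λ := Option (Σ a, (body a).Λ)
  fin := letI := fun o => (body o).fin; inferInstance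
  entry := none
  code e x
    | none => .pop kk (fun v o => (v.1, o.map fun a => ⟨k, g a⟩))
        (.goto fun v => (readReg k v.2).elim x fun a => e (some ⟨a, (body a).entry⟩))
    | some ⟨a, l⟩ => (body a).code (fun l => e (some ⟨a, l⟩)) (e none) l

theorem runsF_loopF_nil [∀ k, Fintype (Γ k)] {kk : FullK tm K} {k : K}
    {g : FullΓ tm Γ kk → Γ k} {body : Γ k → Frag tm Γ} {S : FullStore tm Γ}
    (hS : S kk = []) : (loopF kk k g body).RunsF S S 1 := by
  intro Λ' M e x hM r
  refine ⟨none, ReachIn.single ?_⟩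
  rw [TM2.step, hM]
  have : update S kk [] = S := by rw [← hS]; simp
  simp [loopF, hS, this]

theorem runsF_loopF_cons [∀ k, Fintype (Γ k)] {kk : FullK tm K} {k : K}
    {g : FullΓ tm Γ kk → Γ k} {body : Γ k → Frag tm Γ} {S S' S'' : FullStore tm Γ}
    {a : FullΓ tm Γ kk} {l : List (FullΓ tm Γ kk)} {t t' : ℕ}
    (hS : S kk = a :: l) (h : (body (g a)).RunsF (update S kk l) S' t)
    (h' : (loopF kk k g body).RunsF S' S'' t') :
    (loopF kk k g body).RunsF S S'' (t + t' + 1) := by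
  intro Λ' M e x hM r
  have hstep : TM2.step M ⟨some (e (loopF kk k g body).entry), (initVar tm, r), S⟩ =
      some ⟨some (e (some ⟨g a, (body _).entry⟩)),
        (initVar tm, some ⟨k, g a⟩), update S kk l⟩ := by
    rw [TM2.step, hM]
    simp [loopF, hS]
  obtain ⟨r₁, h₁⟩ := h Λ' M (fun l => e (some ⟨_, l⟩)) (e none) (fun l => hM (some ⟨_, l⟩))
    (some ⟨k, g a⟩)
  obtain ⟨r₂, h₂⟩ := h' Λ' M e x hM r₁
  exact ⟨r₂, ReachIn.head hstep (h₁.trans h₂)⟩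

/-- Pop symbols from a visible stack until it is empty, and execute a fragment for each of them. -/
def loop [∀ k, Fintype (Γ k)] (k : K) (body : Γ k → Frag tm Γ) : Frag tm Γ :=
  loopF (.inl k) k id body

theorem runs_loop_nil [∀ k, Fintype (Γ k)] {k : K} {body : Γ k → Frag tm Γ} {s : Store Γ}
    (hs : s k = []) : (loop k body).Runs s s 1 := runsF_loopF_nil hs

theorem runs_loop_cons [∀ k, Fintype (Γ k)] {k : K} {body : Γ k → Frag tm Γ}
    {s s' s'' : Store Γ} {a : Γ k} {l : List (Γ k)} {t t' : ℕ}
    (hs : s k = a :: l) (h : (body a).Runs (update s k l) s' t)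
    (h' : (loop k body).Runs s' s'' t') : (loop k body).Runs s s'' (t + t' + 1) := by
  have h₁ : (body a).RunsF (update (full s noPriv) (.inl k) l) (full s' noPriv) t := by
    rw [update_full_inl]
    exact h
  exact runsF_loopF_cons (tm := tm) (kk := .inl k) (g := id) (S := full s noPriv) (a := a) (l := l)
    hs h₁ h'

/-! ### Oracle calls -/

/-- The translation of the statements of an oracle. -/
def liftStmt (i : ι) {Λ' : Type} (lab : (tm i).Λ → Λ') (x : Λ') :
    TM2.Stmt (tm i).Γ (tm i).Λ (tm i).σ → TM2.Stmt (FullΓ tm Γ) Λ' (FullState tm Γ)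
  | .push k f q => .push (.inr ⟨i, k⟩) (fun v => f (v.1 i)) (liftStmt i lab x q)
  | .peek k f q => .peek (.inr ⟨i, k⟩) (fun v o => (update v.1 i (f (v.1 i) o), v.2))
      (liftStmt i lab x q)
  | .pop k f q => .pop (.inr ⟨i, k⟩) (fun v o => (update v.1 i (f (v.1 i) o), v.2))
      (liftStmt i lab x q)
  | .load f q => .load (fun v => (update v.1 i (f (v.1 i)), v.2)) (liftStmt i lab x q)
  | .branch f q q' => .branch (fun v => f (v.1 i)) (liftStmt i lab x q) (liftStmt i lab x q')
  | .goto f => .goto fun v => lab (f (v.1 i))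
  | .halt => .goto fun _ => x

/-- The translation of the configurations of an oracle. -/
def liftCfg (i : ι) {Λ' : Type} (lab : (tm i).Λ → Λ') (x : Λ') (r : Option (Σ k, Γ k))
    (s : Store Γ) (P : Priv tm) (c : (tm i).Cfg) : TM2.Cfg (FullΓ tm Γ) Λ' (FullState tm Γ) :=
  ⟨some (c.l.elim x lab), (update (initVar tm) i c.var, r), full s (update P i c.stk)⟩

/-- The simulation is exact, step by step: the translation touches only the state and the private
stacks of oracle `i`, and halting becomes a jump to the exit. -/
theorem stepAux_liftStmt (i : ι) {Λ' : Type} (lab : (tm i).Λ → Λ') (x : Λ')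
    (r : Option (Σ k, Γ k)) (s : Store Γ) (P : Priv tm)
    (q : TM2.Stmt (tm i).Γ (tm i).Λ (tm i).σ) (v : (tm i).σ) (S : ∀ k, List ((tm i).Γ k)) :
    TM2.stepAux (liftStmt i lab x q) (update (initVar tm) i v, r) (full s (update P i S)) =
      liftCfg i lab x r s P (TM2.stepAux q v S) := by
  induction q generalizing v S with
  | push k f q ih => simp [liftStmt, TM2.stepAux, update_full_inr, ih]
  | peek k f q ih => simp [liftStmt, TM2.stepAux, ih]
  | pop k f q ih => simp [liftStmt, TM2.stepAux, update_full_inr, ih]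
  | load f q ih => simp [liftStmt, TM2.stepAux, ih]
  | branch f q q' ih ih' =>
    simp only [liftStmt, TM2.stepAux, update_self]
    cases f v <;> simp [ih, ih']
  | goto f => simp [liftStmt, TM2.stepAux, liftCfg]
  | halt => simp [liftStmt, TM2.stepAux, liftCfg]

/-- Run an oracle. -/
def oracle (i : ι) : Frag tm Γ where
  Λ := (tm i).Λ
  fin := (tm i).ΛFin
  entry := (tm i).main
  code e x l := liftStmt i e x ((tm i).m l)

/-- The configuration of the private stacks in which only the stack `k` of oracle `i` may be
nonempty. -/
def privAt (i : ι) (k : (tm i).K) (l : List ((tm i).Γ k)) : Priv tm :=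
  update noPriv i (update (fun _ => []) k l)

theorem privAt_nil (i : ι) (k : (tm i).K) : privAt i k [] = (noPriv : Priv tm) := by
  funext j k'
  by_cases h : j = i
  · subst h
    by_cases h : k' = k
    · subst h; simp [privAt, noPriv]
    · simp [privAt, noPriv]
  · simp [privAt, noPriv, update_of_ne h]

theorem initList_stk (M : FinTM2) (l : List (M.Γ M.k₀)) :
    (initList M l).stk = update (fun _ => []) M.k₀ l := by
  funext k
  by_cases h : k = M.k₀
  · subst h; simp [initList]
  · simp [initList, h]

theorem haltList_stk (M : FinTM2) (l : List (M.Γ M.k₁)) :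
    (haltList M l).stk = update (fun _ => []) M.k₁ l := by
  funext k
  by_cases h : k = M.k₁
  · subst h; simp [haltList]
  · simp [haltList, h]

/-- By the convention for outputs, a machine ends in its initial internal state with all stacks but
the output stack empty. Once the output is removed, the oracle is ready for another call without any
cleanup. -/
theorem runsF_oracle {i : ι} {s : Store Γ} {l : List ((tm i).Γ (tm i).k₀)}
    {l' : List ((tm i).Γ (tm i).k₁)} {t : ℕ} (h : Nonempty (TM2OutputsInTime (tm i) l (some l') t)) :
    (oracle i : Frag tm Γ).RunsF (full s (privAt i _ l)) (full s (privAt i _ l')) t := by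
  intro Λ' M e x hM r
  refine ⟨r, ?_⟩
  have h' : ReachIn (tm i).step (initList (tm i) l) (haltList (tm i) l') t := h
  have key := h'.map (g := TM2.step M) (liftCfg i e x r s noPriv) ?_
  · have hv : update (initVar tm) i (tm i).initialState = initVar tm := by
      rw [← show initVar tm i = (tm i).initialState from rfl, update_eq_self]
    simp only [liftCfg, initList_stk, haltList_stk] at key
    simp only [initList, haltList, hv] at key
    exact key
  · rintro ⟨_ | l₀, v, S⟩ y hy
    · cases hy
    · simp only [FinTM2.step, TM2.step] at hy
      have hy' := Option.some_injective _ hy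
      rw [← hy']
      change some (TM2.stepAux (M (e l₀)) _ _) = _
      rw [show M (e l₀) = _ from hM l₀]
      exact congrArg some (stepAux_liftStmt i e x r s noPriv _ v S)

theorem update_privAt (s : Store Γ) (i : ι) (k : (tm i).K) (l l' : List ((tm i).Γ k)) :
    update (full s (privAt i k l)) (.inr ⟨i, k⟩) l' = full s (privAt i k l') := by
  rw [privAt, update_full_inr, update_idem, ← privAt]

@[simp] theorem privAt_self (i : ι) (k : (tm i).K) (l : List ((tm i).Γ k)) :
    privAt i k l i k = l := by
  simp [privAt]

variable [∀ k, Fintype (Γ k)]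

/-- Move a visible stack to the input stack of an oracle. -/
def send (i : ι) (k : K) (g : Γ k → (tm i).Γ (tm i).k₀) : Frag tm Γ :=
  loop k fun a => pushF (.inr ⟨i, (tm i).k₀⟩) (g a)

theorem runsF_send (i : ι) (k : K) (g : Γ k → (tm i).Γ (tm i).k₀) (s : Store Γ)
    (l : List (Γ k)) (l' : List ((tm i).Γ (tm i).k₀)) :
    (send i k g).RunsF (full (update s k l) (privAt i _ l'))
      (full (update s k []) (privAt i _ (l.reverse.map g ++ l'))) (2 * l.length + 1) := by
  induction l generalizing l' with
  | nil => exact runsF_loopF_nil (by simp)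
  | cons a l ih =>
    have ih' := ih (g a :: l')
    rw [show l.reverse.map g ++ g a :: l' = (a :: l).reverse.map g ++ l' by simp] at ih'
    refine RunsF.mono (runsF_loopF_cons (a := a) (l := l) (by simp) ?_ ih')
      (t := 1 + (2 * l.length + 1) + 1) (by simp; omega)
    have := runsF_pushF (.inr ⟨i, (tm i).k₀⟩) (g a) (full (update s k l) (privAt i _ l'))
    rw [update_privAt] at this
    rw [update_full_inl, update_idem]
    simpa using this

/-- Move the output stack of an oracle to a visible stack. -/
def receive (i : ι) (k : K) (g : (tm i).Γ (tm i).k₁ → Γ k) : Frag tm Γ :=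
  loopF (.inr ⟨i, (tm i).k₁⟩) k g (push k)

theorem runsF_receive (i : ι) (k : K) (g : (tm i).Γ (tm i).k₁ → Γ k) (s : Store Γ)
    (l : List ((tm i).Γ (tm i).k₁)) :
    (receive i k g).RunsF (full s (privAt i _ l))
      (full (update s k (l.reverse.map g ++ s k)) noPriv) (2 * l.length + 1) := by
  induction l generalizing s with
  | nil =>
    simp only [List.reverse_nil, List.map_nil, List.nil_append, update_eq_self, privAt_nil]
    exact runsF_loopF_nil rfl
  | cons a l ih =>
    have ih' := ih (update s k (g a :: s k))
    rw [update_idem, update_self, show l.reverse.map g ++ g a :: s k =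
      (a :: l).reverse.map g ++ s k by simp] at ih'
    refine RunsF.mono (runsF_loopF_cons (a := a) (l := l) (by simp) ?_ ih')
      (t := 1 + (2 * l.length + 1) + 1) (by simp; omega)
    have := runsF_pushF (tm := tm) (.inl k) (g a) (full s (privAt i (tm i).k₁ l))
    rw [update_full_inl] at this
    rw [update_privAt]
    exact this

end Frag
end StackProg

/-! ### Output bounds, compilation of fragments to machines, and transfers between stacks -/

namespace StackProg

open Function StateTransition

theorem eval_nat_mono (p : Polynomial ℕ) {m n : ℕ} (h : m ≤ n) : p.eval m ≤ p.eval n := by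
  rw [Polynomial.eval_eq_sum, Polynomial.eval_eq_sum]
  exact Finset.sum_le_sum fun i _ => Nat.mul_le_mul_left _ (Nat.pow_le_pow_left h i)

/-! ### Output length of a machine -/

/-- The largest number of symbols that a statement can push. -/
def pushCount {K : Type*} {Γ : K → Type*} {Λ σ : Type*} : TM2.Stmt Γ Λ σ → ℕ
  | .push _ _ q => pushCount q + 1
  | .peek _ _ q => pushCount q
  | .pop _ _ q => pushCount q
  | .load _ q => pushCount q
  | .branch _ q q' => max (pushCount q) (pushCount q')
  | .goto _ => 0
  | .halt => 0

theorem length_stepAux_le {K : Type*} [DecidableEq K] {Γ : K → Type*} {Λ σ : Type*}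
    (q : TM2.Stmt Γ Λ σ) (v : σ) (S : ∀ k, List (Γ k)) (k : K) :
    ((TM2.stepAux q v S).stk k).length ≤ (S k).length + pushCount q := by
  induction q generalizing v S with
  | push k' f q ih =>
    refine (ih v _).trans ?_
    by_cases h : k = k'
    · subst h; simp [pushCount]; omega
    · simp [pushCount, update_of_ne h]
  | peek k' f q ih => exact ih _ _
  | pop k' f q ih =>
    refine (ih _ _).trans ?_
    by_cases h : k = k'
    · subst h; simp [pushCount]
    · simp [pushCount, update_of_ne h]
  | load f q ih => exact ih _ _
  | branch f q q' ih ih' =>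
    simp only [TM2.stepAux, pushCount]
    cases f v
    · exact (ih' v S).trans (by simp)
    · exact (ih v S).trans (by simp)
  | goto f => simp [TM2.stepAux]
  | halt => simp [TM2.stepAux]

/-- A step executes one of finitely many statements, each with a bounded number of pushes. Time
bounds for an oracle thus bound the lengths of its answers, which have to be read and compared
afterwards. -/
theorem exists_length_le (M : FinTM2) : ∃ C : ℕ, ∀ (c c' : M.Cfg) (t : ℕ),
    ReachIn M.step c c' t → ∀ k, (c'.stk k).length ≤ (c.stk k).length + C * t := by
  let _ := M.ΛFin
  refine ⟨Finset.univ.sup fun l => pushCount (M.m l), fun c c' t h k => ?_⟩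
  set C := Finset.univ.sup fun l => pushCount (M.m l) with hC
  obtain ⟨⟨⟨n, hn⟩, hle⟩⟩ := h
  refine le_trans ?_ (Nat.add_le_add_left (Nat.mul_le_mul_left C hle) _)
  change (c'.stk k).length ≤ (c.stk k).length + C * n
  clear hle
  induction n generalizing c with
  | zero =>
    have : c = c' := Option.some_injective _ hn
    simp [this]
  | succ n ih =>
    have hn' : (flip bind M.step)^[n] (M.step c) = some c' := hn
    rcases c with ⟨_ | l, v, S⟩
    · have none_iter : ∀ n : ℕ, (flip bind M.step)^[n] (none : Option M.Cfg) = none := by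
        intro n
        induction n with
        | zero => rfl
        | succ n ih => rw [iterate_succ_apply]; exact ih
      rw [show M.step ⟨none, v, S⟩ = none from rfl, none_iter] at hn'
      cases hn'
    · have h1 := ih _ hn'
      have h2 := length_stepAux_le (M.m l) v S k
      have h3 : pushCount (M.m l) ≤ C := Finset.le_sup (f := fun l => pushCount (M.m l))
        (Finset.mem_univ l)
      change _ ≤ (S k).length + _
      rw [mul_add, mul_one]
      omega

variable {ι : Type} [DecidableEq ι] {tm : ι → FinTM2} {K : Type} [DecidableEq K] {Γ : K → Type}

/-! ### From fragments to machines -/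

/-- The compiled machine has one extra label, which resets the register before halting because the
final internal state must be the initial one. This accounts for the summand 1 in the time `q + 1`.
-/
theorem polyTimeComputable_of_frag [Fintype ι] [Fintype K] [∀ k, Fintype (Γ k)]
    {α β Γa Γb : Type} {ea : Encoding α Γa} {eb : Encoding β Γb} {f : α → β}
    (p : Frag tm Γ) (kin kout : K) (ein : Γ kin ≃ Γa) (eout : Γ kout ≃ Γb) (q : Polynomial ℕ)
    (h : ∀ a, p.Runs (update (fun _ => []) kin ((ea.encode a).map ein.symm))
      (update (fun _ => []) kout ((eb.encode (f a)).map eout.symm))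
      (q.eval (ea.encode a).length)) :
    PolyTimeComputable ea eb f := by
  let _ := p.fin
  let _ := fun i => (tm i).kFin
  let _ := fun i => (tm i).σFin
  let M : FinTM2 :=
    { K := FullK tm K
      k₀ := .inl kin
      k₁ := .inl kout
      Γ := FullΓ tm Γ
      Λ := Option p.Λ
      main := some p.entry
      σ := FullState tm Γ
      initialState := (initVar tm, none)
      Γk₀Fin := inferInstanceAs (Fintype (Γ kin))
      m := fun l => l.elim (.load (fun v => (v.1, none)) .halt) (p.code some none) }
  refine ⟨{ tm := M, inputAlphabet := ein, outputAlphabet := eout, time := q + 1,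
            outputsFun := fun a => Nonempty.some ?_ }⟩
  obtain ⟨r, hr⟩ := h a _ M.m some none (fun l => rfl) none
  have h₁ : full (update (fun _ => []) kin ((ea.encode a).map ein.symm)) noPriv =
      (initList M ((ea.encode a).map ein.symm)).stk := by
    rw [Frag.initList_stk, ← update_full_inl]
    congr 1
    funext k
    rcases k with k | k <;> rfl
  have h₂ : full (update (fun _ => []) kout ((eb.encode (f a)).map eout.symm)) noPriv =
      (haltList M ((eb.encode (f a)).map eout.symm)).stk := by
    rw [Frag.haltList_stk, ← update_full_inl]
    congr 1
    funext k
    rcases k with k | k <;> rfl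
  rw [h₁, h₂] at hr
  have h₃ : ReachIn M.step (initList M ((ea.encode a).map ein.symm))
      (haltList M ((eb.encode (f a)).map eout.symm)) ((q + 1).eval (ea.encode a).length) := by
    rw [Polynomial.eval_add, Polynomial.eval_one]
    exact hr.trans (ReachIn.single rfl)
  exact h₃

namespace Frag

/-! ### Straight-line programs and transfers -/

/-- Push the symbols of a list onto a stack. -/
def pushList (k : K) : List (Γ k) → Frag tm Γ
  | [] => skip
  | a :: l => (pushList k l).seq (push k a)

theorem runs_pushList (k : K) (l : List (Γ k)) (s : Store Γ) :
    (pushList k l : Frag tm Γ).Runs s (update s k (l ++ s k)) (l.length + 1) := by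
  induction l with
  | nil => simpa [pushList] using runs_skip (tm := tm) s
  | cons a l ih =>
    have := ih.seq (runs_push (tm := tm) k a _)
    rw [update_idem, update_self] at this
    exact this

/-- Push lists onto several stacks. -/
def pushSome (d : Store Γ) : List K → Frag tm Γ
  | [] => skip
  | k :: ks => (pushList k (d k)).seq (pushSome d ks)

theorem runs_pushSome (d : Store Γ) (ks : List K) (hks : ks.Nodup) (s : Store Γ) :
    (pushSome d ks : Frag tm Γ).Runs s (fun k => if k ∈ ks then d k ++ s k else s k)
      ((ks.map fun k => (d k).length + 1).sum + 1) := by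
  induction ks generalizing s with
  | nil => simpa [pushSome] using runs_skip (tm := tm) s
  | cons k ks ih =>
    have h := (runs_pushList (tm := tm) k (d k) s).seq (ih hks.of_cons _)
    have hk : k ∉ ks := (List.nodup_cons.1 hks).1
    have e : (fun k' => if k' ∈ k :: ks then d k' ++ s k' else s k') = fun k' =>
        if k' ∈ ks then d k' ++ update s k (d k ++ s k) k' else update s k (d k ++ s k) k' := by
      funext k'
      by_cases h : k' = k
      · subst h; simp [hk]
      · simp [h]
    rw [e]
    refine h.mono ?_
    simp; omega

variable [Fintype K] [∀ k, Fintype (Γ k)]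

/-- Push a list onto every stack. -/
noncomputable def pushAll (d : Store Γ) : Frag tm Γ := pushSome d Finset.univ.toList

/-- A bound for the running time of `pushAll`. -/
noncomputable def pushAllCost (d : Store Γ) : ℕ :=
  ((Finset.univ.toList : List K).map fun k => (d k).length + 1).sum + 1

theorem runs_pushAll (d s : Store Γ) :
    (pushAll d : Frag tm Γ).Runs s (fun k => d k ++ s k) (pushAllCost d) := by
  have h := runs_pushSome (tm := tm) d Finset.univ.toList (Finset.nodup_toList _) s
  simp only [Finset.mem_toList, Finset.mem_univ, if_true] at h
  exact h

/-- Empty a stack, and push lists onto the other stacks for each of its symbols. -/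
noncomputable def transfer (k : K) (g : Γ k → Store Γ) : Frag tm Γ :=
  loop k fun a => pushAll (g a)

/-- The effect of `transfer`. -/
def transferred (k : K) (g : Γ k → Store Γ) (s : Store Γ) : Store Γ := fun k' =>
  if k' = k then [] else ((s k).reverse.flatMap fun a => g a k') ++ s k'

/-- The time that `transfer` needs for each symbol. -/
noncomputable def transferCost {k : K} (g : Γ k → Store Γ) : ℕ :=
  (Finset.univ.sup fun a => pushAllCost (g a)) + 1

/-- By `hg` nothing is pushed back onto the stack that is being emptied, so a single pass suffices.
Each transfer reverses the order of the symbols, which is why copies are made by two transfers. -/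
theorem runs_transfer {k : K} {g : Γ k → Store Γ} (hg : ∀ a, g a k = []) (s : Store Γ) :
    (transfer k g : Frag tm Γ).Runs s (transferred k g s)
      (transferCost g * (s k).length + 1) := by
  generalize hl : s k = l
  induction l generalizing s with
  | nil =>
    have : transferred k g s = s := by
      funext k'
      by_cases h : k' = k
      · subst h; simp [transferred, hl]
      · simp [transferred, hl, h]
    rw [this]
    exact (runs_loop_nil hl).mono (by simp)
  | cons a l ih =>
    have h₁ := runs_pushAll (tm := tm) (g a) (update s k l)
    have h₂ := ih (fun k' => g a k' ++ update s k l k') (by simp [hg])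
    have e : transferred k g (fun k' => g a k' ++ update s k l k') = transferred k g s := by
      funext k'
      by_cases h : k' = k
      · simp [transferred, h]
      · simp [transferred, h, hl, hg]
    rw [e] at h₂
    refine (runs_loop_cons hl h₁ h₂).mono ?_
    have h₃ : pushAllCost (g a) ≤ Finset.univ.sup fun a => pushAllCost (g a) :=
      Finset.le_sup (f := fun a => pushAllCost (g a)) (Finset.mem_univ a)
    simp only [transferCost, List.length_cons, mul_add, mul_one, add_mul, one_mul]
    omega

/-- Empty the stacks of a list. -/
def clear : List K → Frag tm Γ
  | [] => skip
  | k :: ks => (loop k fun _ => skip).seq (clear ks)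

theorem runs_clear_one (k : K) (s : Store Γ) :
    (loop k fun _ => skip : Frag tm Γ).Runs s (update s k []) (2 * (s k).length + 1) := by
  generalize hl : s k = l
  induction l generalizing s with
  | nil =>
    rw [← hl, update_eq_self]
    exact (runs_loop_nil (tm := tm) hl).mono (by omega)
  | cons a l ih =>
    have := runs_loop_cons (tm := tm) hl (runs_skip _) (ih (update s k l) (by simp))
    rw [update_idem] at this
    exact this.mono (by simp; omega)

theorem runs_clear (ks : List K) (s : Store Γ) (n : ℕ) (hs : ∀ k, (s k).length ≤ n) :
    (clear ks : Frag tm Γ).Runs s (fun k => if k ∈ ks then [] else s k)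
      (ks.length * (2 * n + 1) + 1) := by
  induction ks generalizing s with
  | nil => simpa [clear] using runs_skip (tm := tm) s
  | cons k ks ih =>
    have h₂ := ih (update s k []) (fun k' => by
      by_cases h : k' = k
      · subst h; simp
      · simpa [h] using hs k')
    have e : (fun k' => if k' ∈ ks then [] else update s k [] k') =
        fun k' => if k' ∈ k :: ks then [] else s k' := by
      funext k'
      by_cases h : k' = k
      · subst h; simp
      · simp [h]
    rw [e] at h₂
    refine ((runs_clear_one k s).seq h₂).mono ?_
    have := hs k
    simp only [List.length_cons, add_mul, one_mul]
    omega

/-! ### Oracle calls on pairs of lists -/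

/-- Call the oracle `i` on the pair of the reversed contents of two stacks. -/
def call (i : ι) (k₁ k₂ k : K) (g₁ : Γ k₁ → (tm i).Γ (tm i).k₀) (g₂ : Γ k₂ → (tm i).Γ (tm i).k₀)
    (g : (tm i).Γ (tm i).k₁ → Γ k) : Frag tm Γ :=
  (send i k₂ g₂).seq ((send i k₁ g₁).seq ((oracle i).seq (receive i k g)))

/-- Sending reverses a stack. The second component is sent first and ends up below the first one, as
the encoding of a pair requires. -/
theorem runs_call {i : ι} {k₁ k₂ k : K} (hk : k₁ ≠ k₂) {g₁ : Γ k₁ → (tm i).Γ (tm i).k₀}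
    {g₂ : Γ k₂ → (tm i).Γ (tm i).k₀} {g : (tm i).Γ (tm i).k₁ → Γ k} {s : Store Γ} {t : ℕ}
    {l : List ((tm i).Γ (tm i).k₁)}
    (h : Nonempty (TM2OutputsInTime (tm i)
      ((s k₁).reverse.map g₁ ++ (s k₂).reverse.map g₂) (some l) t)) :
    (call i k₁ k₂ k g₁ g₂ g).Runs s
      (update (update (update s k₂ []) k₁ []) k
        (l.reverse.map g ++ update (update s k₂ []) k₁ [] k))
      (2 * (s k₁).length + 2 * (s k₂).length + t + 2 * l.length + 3) := by
  have h₁ := runsF_send i k₂ g₂ s (s k₂) []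
  have h₂ := runsF_send i k₁ g₁ (update s k₂ []) (s k₁) ((s k₂).reverse.map g₂)
  have e : update (update s k₂ []) k₁ (s k₁) = update s k₂ [] := by
    rw [update_eq_self_iff]
    simp [hk]
  rw [update_eq_self, List.append_nil, privAt_nil] at h₁
  rw [e] at h₂
  have h₃ := runsF_oracle (s := update (update s k₂ []) k₁ []) h
  have h₄ := runsF_receive i k g (update (update s k₂ []) k₁ []) l
  exact (h₁.seq (h₂.seq (h₃.seq h₄))).mono (by omega)

theorem exists_runs_call {β Γ₁ Γ₂ Γ₃ : Type} {f : List Γ₁ × List Γ₂ → β} {eb : β → List Γ₃}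
    (i : ι) (ein : (tm i).Γ (tm i).k₀ ≃ Γ₁ ⊕ Γ₂) (eout : (tm i).Γ (tm i).k₁ ≃ Γ₃)
    (T : Polynomial ℕ)
    (hT : ∀ x, Nonempty (TM2OutputsInTime (tm i)
      (((encodingProd (encodingList Γ₁) (encodingList Γ₂)).encode x).map ein.symm)
      (some ((eb (f x)).map eout.symm))
      (T.eval ((encodingProd (encodingList Γ₁) (encodingList Γ₂)).encode x).length)))
    {k₁ k₂ k : K} (hk : k₁ ≠ k₂) (g₁ : Γ k₁ → Γ₁) (g₂ : Γ k₂ → Γ₂) (g : Γ₃ → Γ k) :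
    ∃ (p : Frag tm Γ) (q : Polynomial ℕ), ∀ (s : Store Γ) (n : ℕ),
      (s k₁).length + (s k₂).length ≤ n →
      (eb (f ((s k₁).reverse.map g₁, (s k₂).reverse.map g₂))).length ≤ q.eval n ∧
      p.Runs s (update (update (update s k₂ []) k₁ []) k
        ((eb (f ((s k₁).reverse.map g₁, (s k₂).reverse.map g₂))).reverse.map g ++
          update (update s k₂ []) k₁ [] k)) (q.eval n) := by
  obtain ⟨C, hC⟩ := exists_length_le (tm i)
  refine ⟨call i k₁ k₂ k (fun a => ein.symm (.inl (g₁ a))) (fun a => ein.symm (.inr (g₂ a)))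
    (fun a => g (eout a)), 4 * Polynomial.X + T + 2 * (Polynomial.X + Polynomial.C C * T) + 3,
    fun s n hn => ?_⟩
  have h := hT ((s k₁).reverse.map g₁, (s k₂).reverse.map g₂)
  set y := eb (f ((s k₁).reverse.map g₁, (s k₂).reverse.map g₂)) with hy
  have hTn : T.eval ((s k₁).length + (s k₂).length) ≤ T.eval n :=
    eval_nat_mono T hn
  have hlen : y.length ≤ n + C * T.eval n := by
    have := hC _ _ _ (show ReachIn _ _ _ _ from h) (tm i).k₁
    rw [initList_stk, haltList_stk] at this
    simp only [update_self, List.length_map] at this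
    refine this.trans (Nat.add_le_add ?_ (Nat.mul_le_mul_left C ?_))
    -- The input stack may also be the output stack, in which case its initial contents count.
    · by_cases h : (tm i).k₁ = (tm i).k₀
      · rw [h]; simpa [encodingProd, encodingList] using hn
      · simp [update_of_ne h]
    · simpa [encodingProd, encodingList] using hTn
  have hval : (4 * Polynomial.X + T + 2 * (Polynomial.X + Polynomial.C C * T) + 3).eval n =
      4 * n + T.eval n + 2 * (n + C * T.eval n) + 3 := by
    simp
  rw [hval]
  refine ⟨by omega, ?_⟩
  have h' : Nonempty (TM2OutputsInTime (tm i)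
      ((s k₁).reverse.map (fun a => ein.symm (.inl (g₁ a))) ++
        (s k₂).reverse.map (fun a => ein.symm (.inr (g₂ a)))) (some (y.map eout.symm))
      (T.eval n)) := by
    have h₂ : ReachIn _ _ _ _ := h
    have h₃ := h₂.mono (t₂ := T.eval n) (by simpa [encodingProd, encodingList] using hTn)
    have e : ((encodingProd (encodingList Γ₁) (encodingList Γ₂)).encode
        ((s k₁).reverse.map g₁, (s k₂).reverse.map g₂)).map ein.symm =
      (s k₁).reverse.map (fun a => ein.symm (.inl (g₁ a))) ++
        (s k₂).reverse.map (fun a => ein.symm (.inr (g₂ a))) := by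
      simp [encodingProd, encodingList, Function.comp_def]
    rw [e] at h₃
    exact h₃
  have h₄ := runs_call hk (g := fun a => g (eout a)) h'
  have e : (y.map eout.symm).reverse.map (fun a => g (eout a)) = y.reverse.map g := by
    rw [← List.map_reverse, List.map_map]
    simp [Function.comp_def]
  rw [e] at h₄
  refine h₄.mono ?_
  simp only [List.length_map]
  omega

end Frag
end StackProg

/-! ### Unions of two languages in NP -/

namespace StackProg

open Function StateTransition

namespace Frag

variable {ι : Type} [DecidableEq ι] {tm : ι → FinTM2} {K : Type} [DecidableEq K] {Γ : K → Type}
  [∀ k, Fintype (Γ k)]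

/-- Discard symbols from the top of a stack. -/
def discard (k : K) : ℕ → Frag tm Γ
  | 0 => skip
  | m + 1 => pop k fun _ => discard k m

theorem runs_discard (k : K) (m : ℕ) (s : Store Γ) :
    (discard k m : Frag tm Γ).Runs s (update s k ((s k).drop m)) (m + 1) := by
  induction m generalizing s with
  | zero => simpa [discard] using runs_skip (tm := tm) s
  | succ m ih =>
    have := ih (update s k (s k).tail)
    rw [update_idem, update_self, List.drop_tail] at this
    exact Runs.pop this

end Frag

/-! ### NP is closed under certain unions -/

/-- The stacks of the program that selects one of two verifiers. -/
inductive ChoiceStack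
  | inp | word | word' | cert | out
  deriving DecidableEq

namespace ChoiceStack

instance : Fintype ChoiceStack :=
  ⟨{inp, word, word', cert, out}, fun k => by cases k <;> decide⟩

/-- The alphabets of the stacks. -/
abbrev Alph (Γ : Type) : ChoiceStack → Type
  | inp => Γ ⊕ Bool
  | word => Γ
  | word' => Γ
  | cert => Bool
  | out => Bool

instance {Γ : Type} [Fintype Γ] : ∀ k, Fintype (Alph Γ k)
  | inp => inferInstanceAs (Fintype (Γ ⊕ Bool))
  | word => inferInstanceAs (Fintype Γ)
  | word' => inferInstanceAs (Fintype Γ)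
  | cert => inferInstanceAs (Fintype Bool)
  | out => inferInstanceAs (Fintype Bool)

/-- A store with given contents. -/
def store {Γ : Type} (i : List (Γ ⊕ Bool)) (x x' : List Γ) (c o : List Bool) : Store (Alph Γ)
  | inp => i
  | word => x
  | word' => x'
  | cert => c
  | out => o

variable {ι : Type} [DecidableEq ι] {tm : ι → FinTM2} {Γ : Type} [Fintype Γ]

/-- Discard `m` symbols of the certificate for each symbol of the word. -/
def skipCert (m : ℕ) : Frag tm (Alph Γ) :=
  (Frag.loop word fun a => (Frag.push word' a).seq (Frag.discard cert m)).seq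
    (Frag.loop word' fun a => Frag.push word a)

/-- The word itself serves as the counter: `m` symbols are dropped for each of its letters while it
moves to an auxiliary stack, and a second pass moves it back in the original order. -/
theorem runs_skipCert (m : ℕ) (x : List Γ) (c : List Bool) :
    (skipCert m : Frag tm (Alph Γ)).Runs (store [] x [] c [])
      (store [] x [] (c.drop (m * x.length)) []) ((m + 5) * x.length + 2) := by
  have h₁ : ∀ (x x' : List Γ) (c : List Bool),
      (Frag.loop word fun a => (Frag.push word' a).seq (Frag.discard cert m) :
        Frag tm (Alph Γ)).Runs (store [] x x' c [])
        (store [] [] (x.reverse ++ x') (c.drop (m * x.length)) []) ((m + 3) * x.length + 1) := by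
    intro x
    induction x with
    | nil => intro x' c; simpa using Frag.runs_loop_nil (tm := tm) rfl
    | cons a x ih =>
      intro x' c
      have h := (Frag.runs_push (tm := tm) (Γ := Alph Γ) word' a (store [] x x' c [])).seq
        (Frag.runs_discard cert m _)
      have e : update (update (store [] x x' c []) word' (a :: store [] x x' c [] word')) cert
          ((update (store [] x x' c []) word' (a :: store [] x x' c [] word') cert).drop m) =
          store [] x (a :: x') (c.drop m) [] := by
        funext k
        cases k <;> simp [store]
      rw [e] at h
      have e : update (store [] (a :: x) x' c []) word x = store [] x x' c [] := by
        funext k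
        cases k <;> simp [store]
      rw [← e] at h
      have h' := ih (a :: x') (c.drop m)
      rw [List.drop_drop, show m + m * x.length = m * (a :: x).length by simp; ring,
        show x.reverse ++ a :: x' = (a :: x).reverse ++ x' by simp] at h'
      refine (Frag.runs_loop_cons rfl h h').mono ?_
      simp; ring_nf; omega
  have h₂ : ∀ (x' x : List Γ) (c : List Bool),
      (Frag.loop word' fun a => Frag.push word a :
        Frag tm (Alph Γ)).Runs (store [] x x' c [])
        (store [] (x'.reverse ++ x) [] c []) (2 * x'.length + 1) := by
    intro x'
    induction x' with
    | nil => intro x c; exact Frag.runs_loop_nil (tm := tm) rfl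
    | cons a x' ih =>
      intro x c
      have h := Frag.runs_push (tm := tm) (Γ := Alph Γ) word a (store [] x x' c [])
      have e : update (store [] x x' c []) word (a :: store [] x x' c [] word) =
          store [] (a :: x) x' c [] := by
        funext k
        cases k <;> simp [store]
      rw [e] at h
      have e : update (store [] x (a :: x') c []) word' x' = store [] x x' c [] := by
        funext k
        cases k <;> simp [store]
      rw [← e] at h
      have h' := ih (a :: x) c
      rw [show x'.reverse ++ a :: x = (a :: x').reverse ++ x by simp] at h'
      refine (Frag.runs_loop_cons rfl h h').mono ?_
      simp; omega
  have h := (h₁ x [] c).seq (h₂ _ _ _)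
  simp only [List.append_nil, List.reverse_reverse, List.length_reverse] at h
  exact h.mono (by ring_nf; omega)

end ChoiceStack

/-- The language `L` has certificates of length at most `m |x|`, and the verifier accepts no
certificate whatsoever for words outside of `L`. -/
def HasLinearCertificates {Γ : Type} (L : Language Γ) : Prop :=
  ∃ (m : ℕ) (V : List Γ × List Bool → Bool),
    PolyTimeComputable (encodingProd (encodingList Γ) (encodingList Bool)) encodingBoolBool V ∧
    (∀ x ∈ L, ∃ c : List Bool, c.length ≤ m * x.length ∧ V (x, c) = true) ∧
    ∀ x c, V (x, c) = true → x ∈ L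

theorem HasLinearCertificates.inNP {Γ : Type} [Fintype Γ] {L : Language Γ}
    (h : HasLinearCertificates L) : L.InNP := by
  obtain ⟨m, V, hV, h₁, h₂⟩ := h
  refine ⟨Polynomial.C m * Polynomial.X, V, hV, fun x => ⟨fun hx => ?_, ?_⟩⟩
  · simpa using h₁ x hx
  · rintro ⟨c, -, hc⟩
    exact h₂ x c hc

-- The last bit of the certificate selects the verifier. The second one may wrongly accept
-- certificates longer than `p₂` allows, so overlong ones must be cut without evaluating `p₂`. If
-- the total length is at most m|x| + p₂(|x|) + 1, then dropping the selecting bit and m|x| further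
-- bits leaves at most p₂(|x|). The first verifier is sound for every length and needs no cut; this
-- is why only one of the languages is assumed to have linear certificates.
open ChoiceStack in
theorem HasLinearCertificates.inNP_or {Γ : Type} [Fintype Γ] {L₁ L₂ L : Language Γ}
    (h₁ : HasLinearCertificates L₁) (h₂ : L₂.InNP) (hL : ∀ x, x ∈ L ↔ x ∈ L₁ ∨ x ∈ L₂) :
    L.InNP := by
  obtain ⟨m, V₁, ⟨M₁⟩, hV₁, hV₁'⟩ := h₁
  obtain ⟨p₂, V₂, ⟨M₂⟩, hV₂⟩ := h₂
  let V : Bool → List Γ × List Bool → Bool := fun b => bif b then V₁ else V₂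
  let M : ∀ b, TM2ComputableInPolyTime (encodingProd (encodingList Γ) (encodingList Bool)).encode
      encodingBoolBool.encode (V b) := fun b => match b with
    | true => M₁
    | false => M₂
  let tm : Bool → FinTM2 := fun b => (M b).tm
  have hcall : ∀ b : Bool, _ := fun b => Frag.exists_runs_call (tm := tm) (Γ := Alph Γ) b
    (M b).inputAlphabet (M b).outputAlphabet (M b).time (fun x => ⟨(M b).outputsFun x⟩)
    (k₁ := word) (k₂ := cert) (k := out) (by decide) id id id
  choose call q hcall using hcall
  let g : Γ ⊕ Bool → Store (Alph Γ)
    | .inl y => store [] [y] [] [] []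
    | .inr b => store [] [] [] [b] []
  have hC := Frag.runs_transfer (tm := tm) (Γ := Alph Γ) (k := inp) (g := g)
    (by rintro (y | b) <;> rfl)
  set C := Frag.transferCost (Γ := Alph Γ) (k := inp) g
  let prog : Frag tm (Alph Γ) := (Frag.transfer inp g).seq (Frag.pop cert fun o => match o with
    | none => (Frag.loop word fun _ => Frag.skip).seq (Frag.push out false)
    | some true => call true
    | some false => (skipCert m).seq (call false))
  -- The certificate is read from its end, because loading it onto a stack reverses it.
  let W : List Γ × List Bool → Bool := fun y => match y.2.reverse with
    | [] => false
    | true :: c => V₁ (y.1, c.reverse)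
    | false :: c => V₂ (y.1, (c.drop (m * y.1.length)).reverse)
  refine ⟨Polynomial.C m * Polynomial.X + p₂ + 1, W, ?_, fun x => ?_⟩
  · refine polyTimeComputable_of_frag prog inp out (Equiv.refl _) (Equiv.refl _)
      (Polynomial.C C * Polynomial.X + 1 + (2 * Polynomial.X + 2 + q true +
        (q false + (Polynomial.C (m + 5) * Polynomial.X + 2)) + 1)) ?_
    rintro ⟨x, c⟩
    have e₀ : (update (fun _ => []) inp (((encodingProd (encodingList Γ)
        (encodingList Bool)).encode (x, c)).map (Equiv.refl _).symm) : Store (Alph Γ)) =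
        store (x.map .inl ++ c.map .inr) [] [] [] [] := by
      funext k
      cases k <;> simp [store, encodingProd, encodingList]
    have e₁ : Frag.transferred inp g (store (x.map .inl ++ c.map .inr) [] [] [] []) =
        store [] x.reverse [] c.reverse [] := by
      funext k
      cases k <;> simp [Frag.transferred, store, List.flatMap_append, List.flatMap_map, g,
        ← List.map_reverse, List.flatMap_singleton']
    rw [e₀]
    have h₁ := hC (store (x.map .inl ++ c.map .inr) [] [] [] [])
    rw [e₁] at h₁
    have hlen : ((encodingProd (encodingList Γ) (encodingList Bool)).encode (x, c)).length =
      x.length + c.length := by simp [encodingProd, encodingList]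
    set n := x.length + c.length with hn
    rw [hlen]
    simp only [Polynomial.eval_add, Polynomial.eval_mul, Polynomial.eval_C, Polynomial.eval_X,
      Polynomial.eval_one, Polynomial.eval_ofNat]
    refine (h₁.seq (Frag.Runs.pop (t := 2 * n + 2 + (q true).eval n + ((q false).eval n +
      ((m + 5) * n + 2))) ?_)).mono
      (by simp only [store, List.length_append, List.length_map, ← hn]; omega)
    have hout : ∀ (b : Bool) (l : List Bool),
        (update (update (update (store [] x.reverse [] l []) cert []) word []) out
          ((encodingBoolBool.encode (V b ((store [] x.reverse [] l [] word).reverse.map id,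
            (store [] x.reverse [] l ([] : List Bool) cert).reverse.map id))).reverse.map id ++
            update (update (store [] x.reverse [] l [] : Store (Alph Γ)) cert []) word [] out)
            : Store (Alph Γ)) =
          (update (fun _ => []) out ((encodingBoolBool.encode (V b (x, l.reverse))).map
            (Equiv.refl _).symm) : Store (Alph Γ)) := by
      intro b l
      funext k
      cases k <;> simp [store, encodingBoolBool, encodeBool]
    have htail : ∀ (b : Bool) (l : List Bool),
        (update (store [] x.reverse [] (b :: l) ([] : List Bool)) cert
          (store [] x.reverse [] (b :: l) ([] : List Bool) cert).tail : Store (Alph Γ)) =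
          store [] x.reverse [] l [] := by
      intro b l
      funext k
      cases k <;> simp [store]
    rcases hc : c.reverse with _ | ⟨_ | _, l⟩
    · have e₂ : update (store [] x.reverse [] [] ([] : List Bool)) cert
          (store [] x.reverse [] [] ([] : List Bool) cert).tail =
          (store [] x.reverse [] [] [] : Store (Alph Γ)) := by
        funext k
        cases k <;> simp [store]
      rw [e₂]
      have h₂ := (Frag.runs_clear_one (tm := tm) word (store [] x.reverse [] [] [])).seq
        (Frag.runs_push (Γ := Alph Γ) out false _)
      have e₃ : (update (update (store [] x.reverse [] [] []) word []) out
          (false :: update (store [] x.reverse [] [] [] : Store (Alph Γ)) word [] out)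
            : Store (Alph Γ)) =
          (update (fun _ => []) out ((encodingBoolBool.encode (W (x, c))).map
            (Equiv.refl _).symm) : Store (Alph Γ)) := by
        funext k
        cases k <;> simp [store, W, hc, encodingBoolBool, encodeBool]
      rw [e₃] at h₂
      exact h₂.mono (by simp [store]; omega)
    · rw [htail]
      have hcl : c.length = l.length + 1 := by
        rw [← List.length_reverse, hc]; rfl
      have h₂ := (hcall false (store [] x.reverse [] (l.drop (m * x.length)) []) n
        (by simp [store]; omega)).2
      rw [hout, show V false = V₂ from rfl,
        show V₂ (x, (l.drop (m * x.length)).reverse) = W (x, c) by simp [W, hc]] at h₂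
      have h₃ := runs_skipCert (tm := tm) m x.reverse l
      rw [List.length_reverse] at h₃
      refine (h₃.seq h₂).mono ?_
      have : (m + 5) * x.length ≤ (m + 5) * n := Nat.mul_le_mul_left _ (by omega)
      omega
    · rw [htail]
      have hcl : c.length = l.length + 1 := by
        rw [← List.length_reverse, hc]; rfl
      have h₂ := (hcall true (store [] x.reverse [] l []) n (by simp [store]; omega)).2
      rw [hout, show V true = V₁ from rfl, show V₁ (x, l.reverse) = W (x, c) by simp [W, hc]] at h₂
      exact h₂.mono (by omega)
  · rw [hL, hV₂]
    simp only [Polynomial.eval_add, Polynomial.eval_mul, Polynomial.eval_C, Polynomial.eval_X,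
      Polynomial.eval_one]
    constructor
    · rintro (h | ⟨c, hc, h⟩)
      · obtain ⟨c, hc, h⟩ := hV₁ x h
        exact ⟨c ++ [true], by simp; omega, by simpa [W] using h⟩
      -- The filler of length m|x| is what the selecting program discards.
      · refine ⟨c ++ List.replicate (m * x.length) true ++ [false], by simp; omega, ?_⟩
        have : W (x, c ++ List.replicate (m * x.length) true ++ [false]) = V₂ (x, c) := by
          simp [W]
        rw [this, h]
    · rintro ⟨c, hc, h⟩
      rcases hc' : c.reverse with _ | ⟨_ | _, l⟩
      · simp [W, hc'] at h
      · have hcl : c.length = l.length + 1 := by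
          rw [← List.length_reverse, hc']; rfl
        exact .inr ⟨(l.drop (m * x.length)).reverse, by simp; omega, by simpa [W, hc'] using h⟩
      · exact .inl (hV₁' x l.reverse (by simpa [W, hc'] using h))

end StackProg

/-! ### Data of the generic verifier: records, tests and stacks -/

namespace StackProg

open Function StateTransition

/-! ### A verifier that compares values of an oracle -/

/-- A position of a list of records carries a bit of the instance and `m` bits of the
certificate. -/
abbrev Rec (m : ℕ) : Type := Bool × (Fin m → Bool)

/-- The indicator vector that the predicate `g` selects from the records `l₁`, `cur`, `l₂`; the
first argument of `g` tells whether the record is the current one. -/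
def indicator {m : ℕ} (g : Bool → Rec m → Bool) (l₁ : List (Rec m)) (cur : Option (Rec m))
    (l₂ : List (Rec m)) : List Bool :=
  l₁.map (g false) ++ (cur.toList.map (g true) ++ l₂.map (g false))

/-- A comparison of the value of the oracle at one vector with its value at another vector, or with
the number that is part of the instance. -/
structure Test (m : ℕ) where
  lhs : Bool → Rec m → Bool
  rhs : Option (Bool → Rec m → Bool)
  equal : Bool

/-- The string with which a test compares. -/
def Test.target {m : ℕ} (T : Test m) (f : List Bool × List Bool → ℕ) (w a : List Bool)
    (l₁ : List (Rec m)) (cur : Option (Rec m)) (l₂ : List (Rec m)) : List Bool :=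
  match T.rhs with
  | none => a
  | some g => encodeNat (f (w, indicator g l₁ cur l₂))

/-- The test succeeds. -/
def Test.Holds {m : ℕ} (T : Test m) (f : List Bool × List Bool → ℕ) (w a : List Bool)
    (l₁ : List (Rec m)) (cur : Option (Rec m)) (l₂ : List (Rec m)) : Prop :=
  encodeNat (f (w, indicator T.lhs l₁ cur l₂)) = T.target f w a l₁ cur l₂ ↔ T.equal = true

/-- The stacks of the verifier. -/
inductive Stk
  | inp | w | r | a | c | left | right | tmp | argw | arg | o₁ | o₂ | ne | fail
  | n₀ | n₁ | n₂ | n₃ | d | tmpb | out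
  deriving DecidableEq

namespace Stk

instance : Fintype Stk :=
  ⟨{inp, w, r, a, c, left, right, tmp, argw, arg, o₁, o₂, ne, fail, n₀, n₁, n₂, n₃, d, tmpb, out},
    fun k => by cases k <;> decide⟩

/-- The alphabets of the stacks. -/
abbrev Alph (m : ℕ) : Stk → Type
  | inp => (Bool ⊕ (Bool ⊕ Bool)) ⊕ Bool
  | left | right | tmp => Rec m
  | w | r | a | c | argw | arg | o₁ | o₂ | ne | fail | n₀ | n₁ | n₂ | n₃ | d | tmpb | out => Bool

instance {m : ℕ} (k : Stk) : Fintype (Alph m k) := by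
  cases k <;> simp only [Alph] <;> infer_instance

end Stk

/-- The contents of the stacks of the verifier. -/
structure Contents (m : ℕ) where
  inp : List ((Bool ⊕ (Bool ⊕ Bool)) ⊕ Bool) := []
  w : List Bool := []
  r : List Bool := []
  a : List Bool := []
  c : List Bool := []
  left : List (Rec m) := []
  right : List (Rec m) := []
  tmp : List (Rec m) := []
  argw : List Bool := []
  arg : List Bool := []
  o₁ : List Bool := []
  o₂ : List Bool := []
  ne : List Bool := []
  fail : List Bool := []
  n₀ : List Bool := []
  n₁ : List Bool := []
  n₂ : List Bool := []
  n₃ : List Bool := []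
  d : List Bool := []
  tmpb : List Bool := []
  out : List Bool := []

/-- The store with given contents. -/
def Contents.store {m : ℕ} (s : Contents m) : Store (Stk.Alph m)
  | .inp => s.inp
  | .w => s.w
  | .r => s.r
  | .a => s.a
  | .c => s.c
  | .left => s.left
  | .right => s.right
  | .tmp => s.tmp
  | .argw => s.argw
  | .arg => s.arg
  | .o₁ => s.o₁
  | .o₂ => s.o₂
  | .ne => s.ne
  | .fail => s.fail
  | .n₀ => s.n₀
  | .n₁ => s.n₁
  | .n₂ => s.n₂
  | .n₃ => s.n₃
  | .d => s.d
  | .tmpb => s.tmpb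
  | .out => s.out

variable {tm : Unit → FinTM2} {m : ℕ}

/-- Execution in terms of contents. -/
def Frag.Exec (p : Frag tm (Stk.Alph m)) (s s' : Contents m) (t : ℕ) : Prop :=
  p.Runs s.store s'.store t

namespace Frag.Exec

open Stk

theorem mono {p : Frag tm (Alph m)} {s s' : Contents m} {t t' : ℕ} (h : p.Exec s s' t)
    (ht : t ≤ t') : p.Exec s s' t' := Runs.mono h ht

theorem seq {p q : Frag tm (Alph m)} {s s' s'' : Contents m} {t t' : ℕ}
    (h : p.Exec s s' t) (h' : q.Exec s' s'' t') : (p.seq q).Exec s s'' (t + t') :=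
  Runs.seq h h'

theorem of_runs {p : Frag tm (Alph m)} {s s' : Contents m} {S : Store (Alph m)} {t : ℕ}
    (h : p.Runs s.store S t) (hS : S = s'.store) : p.Exec s s' t := by
  rw [hS] at h
  exact h

theorem skip (s : Contents m) : (skip : Frag tm (Alph m)).Exec s s 1 := runs_skip _

theorem push {k : Stk} {x : Alph m k} {s s' : Contents m}
    (h : update s.store k (x :: s.store k) = s'.store) :
    (Frag.push k x : Frag tm (Alph m)).Exec s s' 1 := by
  have := runs_push (tm := tm) k x s.store
  rwa [h] at this

theorem transfer {k : Stk} {g : Alph m k → Store (Alph m)} {s s' : Contents m}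
    (hg : ∀ a, g a k = []) (h : transferred k g s.store = s'.store) :
    (Frag.transfer k g : Frag tm (Alph m)).Exec s s' (transferCost g * (s.store k).length + 1) := by
  have := runs_transfer (tm := tm) hg s.store
  rwa [h] at this

theorem pop {k : Stk} {q : Option (Alph m k) → Frag tm (Alph m)} {s s₁ s' : Contents m} {t : ℕ}
    (h : update s.store k (s.store k).tail = s₁.store)
    (hq : (q (s.store k).head?).Exec s₁ s' t) : (Frag.pop k q).Exec s s' (t + 1) := by
  apply Runs.pop
  rw [h]
  exact hq

theorem loop_nil {k : Stk} {body : Alph m k → Frag tm (Alph m)} {s : Contents m}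
    (hs : s.store k = []) : (Frag.loop k body).Exec s s 1 := runs_loop_nil hs

theorem loop_cons {k : Stk} {body : Alph m k → Frag tm (Alph m)} {s s₁ s' s'' : Contents m}
    {a : Alph m k} {l : List (Alph m k)} {t t' : ℕ} (hs : s.store k = a :: l)
    (hs₁ : update s.store k l = s₁.store) (h : (body a).Exec s₁ s' t)
    (h' : (Frag.loop k body).Exec s' s'' t') : (Frag.loop k body).Exec s s'' (t + t' + 1) := by
  refine runs_loop_cons hs ?_ h'
  rw [hs₁]
  exact h

end Frag.Exec

/-- Execution in polynomial time, for a family of contents. -/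
def Frag.PolyExec {X : Type} (p : Frag tm (Stk.Alph m)) (s s' : X → Contents m) (n : X → ℕ) :
    Prop :=
  ∃ q : Polynomial ℕ, ∀ x, p.Exec (s x) (s' x) (q.eval (n x))

namespace Frag.PolyExec

open Stk

variable {X : Type} {n : X → ℕ}

theorem seq {p q : Frag tm (Alph m)} {s s' s'' : X → Contents m}
    (h : p.PolyExec s s' n) (h' : q.PolyExec s' s'' n) : (p.seq q).PolyExec s s'' n := by
  obtain ⟨P, h⟩ := h
  obtain ⟨Q, h'⟩ := h'
  exact ⟨P + Q, fun x => by rw [Polynomial.eval_add]; exact (h x).seq (h' x)⟩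

theorem comp {Y : Type} {p : Frag tm (Alph m)} {s s' : X → Contents m} (h : p.PolyExec s s' n)
    (φ : Y → X) {n' : Y → ℕ} (hn : ∀ y, n (φ y) ≤ n' y) :
    p.PolyExec (fun y => s (φ y)) (fun y => s' (φ y)) n' := by
  obtain ⟨P, h⟩ := h
  exact ⟨P, fun y => (h (φ y)).mono (eval_nat_mono P (hn y))⟩

theorem skip (s : X → Contents m) : (skip : Frag tm (Alph m)).PolyExec s s n :=
  ⟨1, fun x => by rw [Polynomial.eval_one]; exact Exec.skip _⟩

theorem push {k : Stk} {a : Alph m k} {s s' : X → Contents m}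
    (h : ∀ x, update (s x).store k (a :: (s x).store k) = (s' x).store) :
    (Frag.push k a : Frag tm (Alph m)).PolyExec s s' n :=
  ⟨1, fun x => by rw [Polynomial.eval_one]; exact Exec.push (h x)⟩

theorem transfer {k : Stk} {g : Alph m k → Store (Alph m)} {s s' : X → Contents m}
    (hg : ∀ a, g a k = []) (h : ∀ x, transferred k g (s x).store = (s' x).store)
    (hn : ∀ x, ((s x).store k).length ≤ n x) :
    (Frag.transfer k g : Frag tm (Alph m)).PolyExec s s' n := by
  refine ⟨Polynomial.C (transferCost g) * Polynomial.X + 1, fun x =>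
    (Exec.transfer hg (h x)).mono ?_⟩
  simpa using Nat.mul_le_mul_left _ (hn x)

end Frag.PolyExec

namespace Verifier

open Stk

/-- The auxiliary stacks for queries are empty. -/
def Ready (m : ℕ) : Type :=
  {s : Contents m // s.tmp = [] ∧ s.tmpb = [] ∧ s.arg = [] ∧ s.argw = []}

/-- Copy the code of the matroid to an argument stack. -/
noncomputable def copyCode : Frag tm (Alph m) :=
  (Frag.transfer w fun b => Contents.store { tmpb := [b] }).seq
    (Frag.transfer tmpb fun b => Contents.store { w := [b], argw := [b] })

theorem polyExec_copyCode : (copyCode : Frag tm (Alph m)).PolyExec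
    (fun s : Ready m => s.1) (fun s => { s.1 with argw := s.1.w }) (fun s => s.1.w.length) := by
  refine Frag.PolyExec.seq (s' := fun s => { s.1 with w := [], tmpb := s.1.w.reverse })
    (Frag.PolyExec.transfer (fun _ => rfl) ?_ (fun s => le_rfl))
    (Frag.PolyExec.transfer (fun _ => rfl) ?_ (fun s => by simp [Contents.store]))
  · rintro ⟨s, h₁, h₂, h₃, h₄⟩
    funext k
    cases k <;> simp [Frag.transferred, Contents.store, h₂, List.flatMap_singleton']
  · rintro ⟨s, h₁, h₂, h₃, h₄⟩
    funext k
    cases k <;> simp [Frag.transferred, Contents.store, h₂, h₄, List.flatMap_singleton']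

/-- Write the indicator vector selected by a predicate to an argument stack. -/
noncomputable def writeVector (g : Bool → Rec m → Bool) (cur : Option (Rec m)) :
    Frag tm (Alph m) :=
  (Frag.transfer left fun x => Contents.store { tmp := [x] }).seq
    ((Frag.transfer tmp fun x => Contents.store { left := [x], arg := [g false x] }).seq
      ((cur.elim Frag.skip fun x => Frag.push arg (g true x)).seq
        ((Frag.transfer right fun x => Contents.store { tmp := [x], arg := [g false x] }).seq
          (Frag.transfer tmp fun x => Contents.store { right := [x] }))))

theorem flatMap_pure {α β : Type} (f : α → β) (l : List α) :
    l.flatMap (fun x => [f x]) = l.map f := by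
  induction l with
  | nil => rfl
  | cons a l ih => simp [ih]

/-- The records form a zipper: `left` holds those already passed with the latest on top, `right`
those to come, and the current one is known to the program. The vector is written in reversed order
since the oracle call reverses it again. -/
theorem polyExec_writeVector (g : Bool → Rec m → Bool) (cur : Option (Rec m)) :
    (writeVector g cur : Frag tm (Alph m)).PolyExec (fun s : Ready m => { s.1 with argw := s.1.w })
      (fun s => { s.1 with
        argw := s.1.w
        arg := (indicator g s.1.left.reverse cur s.1.right).reverse })
      (fun s => s.1.left.length + s.1.right.length) := by
  refine Frag.PolyExec.seq (s' := fun s => { s.1 with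
      argw := s.1.w, left := [], tmp := s.1.left.reverse }) ?_
    (Frag.PolyExec.seq (s' := fun s => { s.1 with
      argw := s.1.w, tmp := [], arg := s.1.left.map (g false) }) ?_
    (Frag.PolyExec.seq (s' := fun s => { s.1 with
      argw := s.1.w, tmp := [], arg := cur.toList.map (g true) ++ s.1.left.map (g false) }) ?_
    (Frag.PolyExec.seq (s' := fun s => { s.1 with
      argw := s.1.w, tmp := s.1.right.reverse, right := [],
      arg := (indicator g s.1.left.reverse cur s.1.right).reverse }) ?_ ?_)))
  · refine Frag.PolyExec.transfer (fun _ => rfl) ?_ (fun s => by simp [Contents.store])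
    rintro ⟨s, h₁, h₂, h₃, h₄⟩
    funext k
    cases k <;> simp [Frag.transferred, Contents.store, h₁, h₃, List.flatMap_singleton']
  · refine Frag.PolyExec.transfer (fun _ => rfl) ?_ (fun s => by simp [Contents.store])
    rintro ⟨s, h₁, h₂, h₃, h₄⟩
    funext k
    cases k <;> simp [Frag.transferred, Contents.store, h₃, flatMap_pure]
  · cases cur with
    | none => simpa using Frag.PolyExec.skip _
    | some x =>
      refine Frag.PolyExec.push ?_
      rintro ⟨s, h₁, h₂, h₃, h₄⟩
      funext k
      cases k <;> simp [Contents.store]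
  · refine Frag.PolyExec.transfer (fun _ => rfl) ?_ (fun s => by simp [Contents.store])
    rintro ⟨s, h₁, h₂, h₃, h₄⟩
    funext k
    cases k <;> simp [Frag.transferred, Contents.store, flatMap_pure, indicator]
    cases cur <;> simp
  · refine Frag.PolyExec.transfer (fun _ => rfl) ?_ (fun s => by simp [Contents.store])
    rintro ⟨s, h₁, h₂, h₃, h₄⟩
    funext k
    cases k <;> simp [Frag.transferred, Contents.store, h₁]

end Verifier

end StackProg

/-! ### Queries to the oracle and comparison of the answers -/

namespace StackProg

open Function StateTransition

variable {tm : Unit → FinTM2} {m : ℕ}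

namespace Verifier

open Stk

/-- The machine `tm ()` computes `f` in polynomial time. -/
def IsOracle (tm : Unit → FinTM2) (f : List Bool × List Bool → ℕ) : Prop :=
  ∃ (ein : (tm ()).Γ (tm ()).k₀ ≃ Bool ⊕ Bool) (eout : (tm ()).Γ (tm ()).k₁ ≃ Bool)
    (T : Polynomial ℕ), ∀ x, Nonempty (TM2OutputsInTime (tm ())
      (((encodingProd (encodingList Bool) (encodingList Bool)).encode x).map ein.symm)
      (some ((encodeNat (f x)).map eout.symm))
      (T.eval ((encodingProd (encodingList Bool) (encodingList Bool)).encode x).length))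

variable {f : List Bool × List Bool → ℕ}

/-- The answer to a query, in the reversed order in which it is received. -/
def reply (f : List Bool × List Bool → ℕ) (g : Bool → Rec m → Bool) (cur : Option (Rec m))
    (s : Contents m) : List Bool :=
  (encodeNat (f (s.w.reverse, indicator g s.left.reverse cur s.right))).reverse

/-- The size that governs the running time. -/
def size (s : Contents m) : ℕ := s.w.length + s.left.length + s.right.length + s.a.length + 1

theorem length_indicator_le (g : Bool → Rec m → Bool) (cur : Option (Rec m))
    (l₁ l₂ : List (Rec m)) : (indicator g l₁ cur l₂).length ≤ l₁.length + l₂.length + 1 := by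
  cases cur <;> simp [indicator]; omega

/-- Two programs are provided because both sides of a comparison must be kept on separate stacks.
The bound on the reply is needed for the time of the comparison. -/
theorem exists_query (h : IsOracle tm f) (g : Bool → Rec m → Bool) (cur : Option (Rec m)) :
    ∃ (p₁ p₂ : Frag tm (Alph m)) (B : Polynomial ℕ),
      (∀ s : Contents m, (reply f g cur s).length ≤ B.eval (size s)) ∧
      p₁.PolyExec (fun s : Ready m => s.1)
        (fun s => { s.1 with o₁ := reply f g cur s.1 ++ s.1.o₁ }) (fun s => size s.1) ∧
      p₂.PolyExec (fun s : Ready m => s.1)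
        (fun s => { s.1 with o₂ := reply f g cur s.1 ++ s.1.o₂ }) (fun s => size s.1) := by
  obtain ⟨ein, eout, T, hT⟩ := h
  obtain ⟨c₁, q₁, h₁⟩ := Frag.exists_runs_call (tm := tm) (Γ := Alph m) () ein eout T hT
    (k₁ := argw) (k₂ := arg) (k := o₁) (by decide) id id id
  obtain ⟨c₂, q₂, h₂⟩ := Frag.exists_runs_call (tm := tm) (Γ := Alph m) () ein eout T hT
    (k₁ := argw) (k₂ := arg) (k := o₂) (by decide) id id id
  let s' : Contents m → Contents m := fun s => { s with
        argw := s.w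
        arg := (indicator g s.left.reverse cur s.right).reverse }
  have hs : ∀ s : Contents m, ((s' s).store argw).length + ((s' s).store arg).length ≤ size s := by
    intro s
    have := length_indicator_le g cur s.left.reverse s.right
    simp only [s', Contents.store, size, List.length_reverse] at this ⊢
    omega
  refine ⟨(copyCode.seq (writeVector g cur)).seq c₁, (copyCode.seq (writeVector g cur)).seq c₂, q₁,
    fun s => ?_, ?_, ?_⟩
  · simpa [reply, s', Contents.store] using (h₁ _ _ (hs s)).1
  · refine Frag.PolyExec.seq (s' := fun s => s' s.1) (Frag.PolyExec.seq
      (polyExec_copyCode.comp (fun s => s) fun s => by simp [size]; omega)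
      ((polyExec_writeVector g cur).comp (fun s => s) fun s => by simp [size]; omega)) ⟨q₁, ?_⟩
    rintro ⟨s, h₃, h₄, h₅, h₆⟩
    refine Frag.Exec.of_runs (h₁ _ _ (hs s)).2 ?_
    funext k
    cases k <;> simp [reply, s', Contents.store, h₅, h₆]
  · refine Frag.PolyExec.seq (s' := fun s => s' s.1) (Frag.PolyExec.seq
      (polyExec_copyCode.comp (fun s => s) fun s => by simp [size]; omega)
      ((polyExec_writeVector g cur).comp (fun s => s) fun s => by simp [size]; omega)) ⟨q₂, ?_⟩
    rintro ⟨s, h₃, h₄, h₅, h₆⟩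
    refine Frag.Exec.of_runs (h₂ _ _ (hs s)).2 ?_
    funext k
    cases k <;> simp [reply, s', Contents.store, h₅, h₆]

/-- The number of mismatches between two strings. -/
def mismatches : List Bool → List Bool → ℕ
  | [], v => v.length
  | _ :: u, [] => mismatches u [] + 1
  | b :: u, b' :: v => mismatches u v + if b' = b then 0 else 1

theorem mismatches_eq_zero {u v : List Bool} : mismatches u v = 0 ↔ u = v := by
  induction u generalizing v with
  | nil => cases v <;> simp [mismatches]
  | cons b u ih =>
    cases v with
    | nil => simp [mismatches]
    | cons b' v => simp [mismatches, ih, and_comm, eq_comm]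

theorem mismatches_le (u v : List Bool) : mismatches u v ≤ u.length + v.length := by
  induction u generalizing v with
  | nil => simp [mismatches]
  | cons b u ih =>
    cases v with
    | nil => have := ih []; simp [mismatches] at this ⊢; omega
    | cons b' v => have := ih v; simp only [mismatches, List.length_cons]; split <;> omega

/-- Compare two answers, and record the mismatches. -/
def compare : Frag tm (Alph m) :=
  (Frag.loop o₁ fun b => Frag.pop o₂ fun o =>
    if o = some b then Frag.skip else Frag.push ne true).seq
  (Frag.loop o₂ fun _ => Frag.push ne true)

/-- The answers are read in lockstep. A symbol of `o₁` without a partner counts as a mismatch, and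
so does each remaining symbol of `o₂`. Only whether the count is zero matters later. -/
theorem exec_compare (s : Contents m) (u v N : List Bool) :
    (compare : Frag tm (Alph m)).Exec { s with o₁ := u, o₂ := v, ne := N }
      { s with o₁ := [], o₂ := [], ne := List.replicate (mismatches u v) true ++ N }
      (3 * u.length + 2 * v.length + 2) := by
  have h₂ : ∀ v N : List Bool, (Frag.loop o₂ fun _ => Frag.push ne true :
      Frag tm (Alph m)).Exec { s with o₁ := [], o₂ := v, ne := N }
      { s with o₁ := [], o₂ := [], ne := List.replicate v.length true ++ N }
      (2 * v.length + 1) := by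
    intro v
    induction v with
    | nil => intro N; exact Frag.Exec.loop_nil rfl
    | cons b v ih =>
      intro N
      have h' := ih (true :: N)
      rw [show List.replicate v.length true ++ true :: N =
        List.replicate (b :: v).length true ++ N by
          rw [List.length_cons, List.replicate_succ', List.append_assoc]; rfl] at h'
      refine Frag.Exec.mono (Frag.Exec.loop_cons (a := b) (l := v) (t := 1) (t' := 2 * v.length + 1)
        (s₁ := { s with o₁ := [], o₂ := v, ne := N }) rfl ?_ (Frag.Exec.push ?_) h')
        (by simp; omega)
      · funext k; cases k <;> rfl
      · funext k; cases k <;> rfl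
  have h₁ : ∀ u v N : List Bool, ∃ N₀ v₀, mismatches u v = N₀ + v₀ ∧ v₀ ≤ v.length ∧
      (Frag.loop o₁ fun b => Frag.pop o₂ fun o =>
        if o = some b then Frag.skip else Frag.push ne true : Frag tm (Alph m)).Exec
      { s with o₁ := u, o₂ := v, ne := N }
      { s with o₁ := [], o₂ := v.drop u.length, ne := List.replicate N₀ true ++ N }
      (3 * u.length + 1) ∧ v₀ = (v.drop u.length).length := by
    intro u
    induction u with
    | nil =>
      intro v N
      exact ⟨0, v.length, by simp [mismatches], le_rfl, Frag.Exec.loop_nil rfl, rfl⟩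
    | cons b u ih =>
      intro v N
      by_cases hb : v.head? = some b
      · obtain ⟨N₀, v₀, h₃, h₄, h₅, h₆⟩ := ih v.tail N
        rw [List.drop_tail] at h₅ h₆
        refine ⟨N₀, v₀, ?_, by simp at h₄; omega, (Frag.Exec.loop_cons
          (s₁ := { s with o₁ := u, o₂ := v, ne := N }) (t := 2) rfl ?_
          (Frag.Exec.pop (s₁ := { s with o₁ := u, o₂ := v.tail, ne := N }) ?_ ?_)
            h₅).mono (by simp; omega), h₆⟩
        · cases v with
          | nil => simp at hb
          | cons b' v =>
            simp at hb
            simp [mismatches, hb, ← h₃]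
        · funext k; cases k <;> rfl
        · funext k; cases k <;> rfl
        · have : Contents.store { s with o₁ := u, o₂ := v, ne := N } o₂ = v := rfl
          rw [this, if_pos hb]
          exact Frag.Exec.skip _
      · obtain ⟨N₀, v₀, h₃, h₄, h₅, h₆⟩ := ih v.tail (true :: N)
        rw [List.drop_tail] at h₅ h₆
        rw [show List.replicate N₀ true ++ true :: N =
          List.replicate (N₀ + 1) true ++ N by
            rw [List.replicate_succ', List.append_assoc]; rfl] at h₅
        refine ⟨N₀ + 1, v₀, ?_, by simp at h₄; omega, (Frag.Exec.loop_cons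
          (s₁ := { s with o₁ := u, o₂ := v, ne := N }) (t := 2) rfl ?_
          (Frag.Exec.pop (s₁ := { s with o₁ := u, o₂ := v.tail, ne := N }) ?_ ?_)
            h₅).mono (by simp; omega), h₆⟩
        · cases v with
          | nil => simp [mismatches] at h₃ ⊢; omega
          | cons b' v =>
            simp at hb h₃
            simp [mismatches, hb]; omega
        · funext k; cases k <;> rfl
        · funext k; cases k <;> rfl
        · have : Contents.store { s with o₁ := u, o₂ := v, ne := N } o₂ = v := rfl
          rw [this, if_neg hb]
          exact Frag.Exec.push (by funext k; cases k <;> rfl)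
  obtain ⟨N₀, v₀, h₃, h₄, h₅, h₆⟩ := h₁ u v N
  have h₇ := h₂ (v.drop u.length) (List.replicate N₀ true ++ N)
  rw [← h₆, ← List.append_assoc, List.replicate_append_replicate, add_comm v₀, ← h₃] at h₇
  exact (h₅.seq h₇).mono (by omega)

/-- Compare two answers, and record a failure if the outcome is not as desired. -/
def judge (equal : Bool) : Frag tm (Alph m) :=
  compare.seq ((Frag.pop ne fun o => if o.isSome = equal then Frag.push fail true else
    Frag.skip).seq (Frag.loop ne fun _ => Frag.skip))

theorem exec_judge (equal : Bool) (s : Contents m) (h₁ : s.o₁ = []) (h₂ : s.o₂ = [])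
    (h₃ : s.ne = []) (u v : List Bool) :
    (judge equal : Frag tm (Alph m)).Exec { s with o₁ := u, o₂ := v }
      { s with fail := (if u = v ↔ equal = true then [] else [true]) ++ s.fail }
      (5 * u.length + 4 * v.length + 6) := by
  have e : ({ s with o₁ := u, o₂ := v } : Contents m) = { s with o₁ := u, o₂ := v, ne := [] } := by
    rw [← h₃]
  have h := exec_compare (tm := tm) s u v []
  rw [← e, List.append_nil] at h
  set k := mismatches u v with hk
  have hkle := mismatches_le u v
  set s₁ : Contents m := { s with o₁ := [], o₂ := [], ne := List.replicate k true } with hs₁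
  set F := (if u = v ↔ equal = true then [] else [true]) ++ s.fail with hF
  have h' : (Frag.pop ne fun o => if o.isSome = equal then Frag.push fail true else
      Frag.skip : Frag tm (Alph m)).Exec s₁ { s₁ with ne := List.replicate (k - 1) true, fail := F }
      2 := by
    refine Frag.Exec.pop (s₁ := { s₁ with ne := List.replicate (k - 1) true }) ?_ ?_
    · funext k'
      cases k' <;> simp [Contents.store, hs₁]
    · have e₁ : (s₁.store ne).head?.isSome = decide (k ≠ 0) := by
        simp only [Contents.store, hs₁]
        cases k <;> simp [List.replicate_succ]
      rw [e₁]
      have e₂ : k = 0 ↔ u = v := mismatches_eq_zero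
      have e₃ : decide (k ≠ 0) = equal ↔ ¬ (u = v ↔ equal = true) := by
        rw [← e₂]
        cases equal <;> by_cases hk : k = 0 <;> simp [hk]
      by_cases hc : u = v ↔ equal = true
      · rw [if_neg (by rw [e₃]; exact not_not.2 hc)]
        have : F = s.fail := by simp [hF, hc]
        rw [this]
        exact Frag.Exec.skip _
      · rw [if_pos (e₃.2 hc)]
        refine Frag.Exec.push ?_
        have : F = true :: s.fail := by simp [hF, hc]
        funext k'
        cases k' <;> simp [Contents.store, hs₁, this]
  have h'' := Frag.runs_clear_one (tm := tm) ne
    ({ s₁ with ne := List.replicate (k - 1) true, fail := F } : Contents m).store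
  have e' : update ({ s₁ with ne := List.replicate (k - 1) true, fail := F } : Contents m).store
      ne [] = ({ s with fail := F } : Contents m).store := by
    funext k'
    cases k' <;> simp [Contents.store, hs₁, h₁, h₂, h₃]
  rw [e'] at h''
  refine (h.seq (h'.seq h'')).mono ?_
  simp [Contents.store]
  omega

/-- All auxiliary stacks for tests are empty. -/
def Idle (m : ℕ) : Type :=
  {s : Contents m // s.tmp = [] ∧ s.tmpb = [] ∧ s.arg = [] ∧ s.argw = [] ∧ s.o₁ = [] ∧ s.o₂ = [] ∧
    s.ne = []}

open Classical in
/-- The effect of a test. -/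
noncomputable def tested (f : List Bool × List Bool → ℕ) (T : Test m) (cur : Option (Rec m))
    (s : Contents m) : Contents m :=
  { s with
    fail := (if T.Holds f s.w.reverse s.a.reverse s.left.reverse cur s.right then [] else [true]) ++
      s.fail }

/-- The right-hand side comes either from a second query or from a copy of the number in the
instance; `judge` then compares the two strings. A failure is only recorded on a stack, so that
tests can be chained without branching. -/
theorem exists_test (h : IsOracle tm f) (T : Test m) (cur : Option (Rec m)) :
    ∃ p : Frag tm (Alph m), p.PolyExec (fun s : Idle m => s.1) (fun s => tested f T cur s.1)
      (fun s => size s.1) := by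
  obtain ⟨p, -, B, hB, hp, -⟩ := exists_query h T.lhs cur
  have hp' := hp.comp (Y := Idle m) (n' := fun s => size s.1) (fun s => ⟨s.1, s.2.1, s.2.2.1,
    s.2.2.2.1, s.2.2.2.2.1⟩) (fun s => le_rfl)
  obtain ⟨p₂, B₂, hB₂, hp₂⟩ : ∃ (p : Frag tm (Alph m)) (B : Polynomial ℕ),
      (∀ s : Contents m, (T.target f s.w.reverse s.a.reverse s.left.reverse cur s.right).length ≤
        B.eval (size s)) ∧
      p.PolyExec (fun s : Idle m => { s.1 with o₁ := reply f T.lhs cur s.1 ++ s.1.o₁ })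
        (fun s => { s.1 with
          o₁ := reply f T.lhs cur s.1
          o₂ := (T.target f s.1.w.reverse s.1.a.reverse s.1.left.reverse cur
            s.1.right).reverse }) (fun s => size s.1) := by
    cases hT : T.rhs with
    | none =>
      refine ⟨(Frag.transfer a fun b => Contents.store { tmpb := [b] }).seq
        (Frag.transfer tmpb fun b => Contents.store { a := [b], o₂ := [b] }), Polynomial.X, ?_, ?_⟩
      · intro s
        simp [Test.target, hT, size]; omega
      · refine Frag.PolyExec.seq (s' := fun s => { s.1 with
            o₁ := reply f T.lhs cur s.1 ++ s.1.o₁, a := [], tmpb := s.1.a.reverse })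
          (Frag.PolyExec.transfer (fun _ => rfl) ?_ (fun s => by simp [Contents.store, size]; omega))
          (Frag.PolyExec.transfer (fun _ => rfl) ?_ (fun s => by simp [Contents.store, size]; omega))
        · rintro ⟨s, h₁, h₂, h₃, h₄, h₅, h₆, h₇⟩
          funext k
          cases k <;> simp [Frag.transferred, Contents.store, h₂]
        · rintro ⟨s, h₁, h₂, h₃, h₄, h₅, h₆, h₇⟩
          funext k
          cases k <;> simp [Frag.transferred, Contents.store, h₂, h₅, h₆, Test.target, hT]
    | some g =>
      obtain ⟨-, p₂, B₂, hB₂, -, hp₂⟩ := exists_query h g cur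
      refine ⟨p₂, B₂, fun s => ?_, ?_⟩
      · have := hB₂ s
        rw [reply, List.length_reverse] at this
        simpa [Test.target, hT] using this
      · have := hp₂.comp (Y := Idle m) (n' := fun s => size s.1)
          (fun s => ⟨{ s.1 with o₁ := reply f T.lhs cur s.1 ++ s.1.o₁ }, s.2.1, s.2.2.1,
            s.2.2.2.1, s.2.2.2.2.1⟩) (fun s => le_rfl)
        obtain ⟨q, hq⟩ := this
        refine ⟨q, fun s => ?_⟩
        obtain ⟨s, h₁, h₂, h₃, h₄, h₅, h₆, h₇⟩ := s
        refine Frag.Exec.of_runs (hq ⟨s, h₁, h₂, h₃, h₄, h₅, h₆, h₇⟩) ?_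
        funext k
        cases k <;> simp [Contents.store, h₅, h₆, Test.target, hT, reply]
  refine ⟨(p.seq p₂).seq (judge T.equal), (hp'.seq hp₂).seq
    ⟨5 * B + 4 * B₂ + 6, fun ⟨s, h₁, h₂, h₃, h₄, h₅, h₆, h₇⟩ => ?_⟩⟩
  have h := exec_judge (tm := tm) T.equal s h₅ h₆ h₇ (reply f T.lhs cur s)
    (T.target f s.w.reverse s.a.reverse s.left.reverse cur s.right).reverse
  refine Frag.Exec.mono (Frag.Exec.of_runs h ?_) ?_
  · congr 1
    simp only [tested, Test.Holds, reply, List.reverse_inj]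
    congr
  · have := hB s
    have := hB₂ s
    simp only [Polynomial.eval_add, Polynomial.eval_mul, Polynomial.eval_ofNat,
      List.length_reverse]
    omega

open Classical in
/-- The failures of a list of tests. -/
noncomputable def failures (f : List Bool × List Bool → ℕ) (cur : Option (Rec m))
    (s : Contents m) (Ts : List (Test m)) : List Bool :=
  Ts.reverse.flatMap fun T =>
    if T.Holds f s.w.reverse s.a.reverse s.left.reverse cur s.right then [] else [true]

theorem failures_eq_nil {cur : Option (Rec m)} {s : Contents m} {Ts : List (Test m)} :
    failures f cur s Ts = [] ↔
      ∀ T ∈ Ts, T.Holds f s.w.reverse s.a.reverse s.left.reverse cur s.right := by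
  simp [failures, List.flatMap_eq_nil_iff]

theorem length_failures_le (cur : Option (Rec m)) (s : Contents m) (Ts : List (Test m)) :
    (failures f cur s Ts).length ≤ Ts.length := by
  induction Ts with
  | nil => simp [failures]
  | cons T Ts ih =>
    simp only [failures, List.reverse_cons, List.flatMap_append, List.length_append,
      List.length_cons] at ih ⊢
    refine Nat.add_le_add ih ?_
    simp only [List.flatMap_cons, List.flatMap_nil, List.append_nil]
    split <;> simp

theorem exists_tests (h : IsOracle tm f) (Ts : List (Test m)) (cur : Option (Rec m)) :
    ∃ p : Frag tm (Alph m), p.PolyExec (fun s : Idle m => s.1)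
      (fun s => { s.1 with fail := failures f cur s.1 Ts ++ s.1.fail }) (fun s => size s.1) := by
  induction Ts with
  | nil => exact ⟨Frag.skip, by simpa [failures] using Frag.PolyExec.skip _⟩
  | cons T Ts ih =>
    obtain ⟨p, hp⟩ := ih
    obtain ⟨p₁, hp₁⟩ := exists_test h T cur
    have hp' := hp.comp (Y := Idle m) (n' := fun s => size s.1)
      (fun s => ⟨tested f T cur s.1, s.2⟩) (fun s => le_rfl)
    refine ⟨p₁.seq p, hp₁.seq ?_⟩
    obtain ⟨q, hq⟩ := hp'
    refine ⟨q, fun s => Frag.Exec.of_runs (hq s) ?_⟩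
    congr 1
    simp [tested, failures, List.flatMap_append]
    rfl

end Verifier

end StackProg

/-! ### Tests for every element, and arithmetic in unary -/

namespace StackProg

open Function StateTransition

variable {tm : Unit → FinTM2} {m : ℕ}

namespace Verifier

open Stk

variable {f : List Bool × List Bool → ℕ}

/-- All tests for all records of `r` succeed, where the records `l` precede those of `r`. -/
def AllHold (f : List Bool × List Bool → ℕ) (Ts : Rec m → List (Test m)) (w a : List Bool)
    (l r : List (Rec m)) : Prop :=
  ∀ l₁ x l₂, r = l₁ ++ x :: l₂ → ∀ T ∈ Ts x, T.Holds f w a (l ++ l₁) (some x) l₂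

theorem allHold_cons {Ts : Rec m → List (Test m)} {w a : List Bool} {l r : List (Rec m)}
    {x : Rec m} : AllHold f Ts w a l (x :: r) ↔
      (∀ T ∈ Ts x, T.Holds f w a l (some x) r) ∧ AllHold f Ts w a (l ++ [x]) r := by
  constructor
  · intro h
    refine ⟨by simpa using h [] x r rfl, fun l₁ y l₂ hr T hT => ?_⟩
    have := h (x :: l₁) y l₂ (by rw [hr]; rfl) T hT
    simpa using this
  · rintro ⟨h₁, h₂⟩ l₁ y l₂ hr T hT
    cases l₁ with
    | nil =>
      simp only [List.nil_append, List.cons.injEq] at hr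
      obtain ⟨rfl, rfl⟩ := hr
      simpa using h₁ T hT
    | cons z l₁ =>
      simp only [List.cons_append, List.cons.injEq] at hr
      obtain ⟨rfl, rfl⟩ := hr
      simpa using h₂ l₁ y l₂ rfl T hT

/-- There are finitely many possible records, so the current one is kept in the finite control, and
the tests for it form a fixed program. Afterwards it is pushed onto `left`, which moves the zipper
by one position. -/
theorem exists_sweep (h : IsOracle tm f) (Ts : Rec m → List (Test m)) :
    ∃ (p : Frag tm (Alph m)) (F : Idle m → List Bool) (B : ℕ),
      p.PolyExec (fun s : Idle m => s.1) (fun s => { s.1 with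
        left := s.1.right.reverse ++ s.1.left
        right := []
        fail := F s ++ s.1.fail }) (fun s => size s.1) ∧
      ∀ s : Idle m, (F s).length ≤ B * s.1.right.length ∧
        (F s = [] ↔ AllHold f Ts s.1.w.reverse s.1.a.reverse s.1.left.reverse s.1.right) := by
  choose p hp using fun x => exists_tests h (Ts x) (some x)
  choose q hq using hp
  let B := Finset.univ.sup fun x => (Ts x).length
  -- One polynomial that dominates the running times for all possible current records.
  let Q := ∑ x, q x
  let body : Rec m → Frag tm (Alph m) := fun x => (p x).seq (Frag.push left x)
  suffices H : ∀ s : Idle m, ∃ F : List Bool,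
      ((Frag.loop right body).Exec s.1 { s.1 with
        left := s.1.right.reverse ++ s.1.left
        right := []
        fail := F ++ s.1.fail } ((Q.eval (size s.1) + 2) * s.1.right.length + 1)) ∧
      F.length ≤ B * s.1.right.length ∧
        (F = [] ↔ AllHold f Ts s.1.w.reverse s.1.a.reverse s.1.left.reverse s.1.right) by
    choose F hF using H
    refine ⟨Frag.loop right body, F, B, ⟨(Q + 2) * Polynomial.X + 1, fun s => (hF s).1.mono ?_⟩,
      fun s => (hF s).2⟩
    simp only [Polynomial.eval_add, Polynomial.eval_mul, Polynomial.eval_ofNat,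
      Polynomial.eval_X, Polynomial.eval_one]
    refine Nat.add_le_add_right (Nat.mul_le_mul_left _ ?_) _
    simp [size]; omega
  rintro ⟨s, hs⟩
  generalize hr : s.right = r
  induction r generalizing s with
  | nil =>
    have h₁ : (Frag.loop right body).Exec s s 1 :=
      Frag.Exec.loop_nil (s := s) (k := right) (show s.store right = [] from hr)
    refine ⟨[], (Frag.Exec.of_runs h₁ ?_).mono (Nat.le_add_left _ _), by simp, by
      simp [AllHold]⟩
    funext k
    cases k <;> simp [Contents.store, hr]
  | cons x r ih =>
    let s₁ : Contents m := { s with right := r }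
    let F₁ := failures f (some x) s₁ (Ts x)
    let s₂ : Contents m := { s₁ with left := x :: s.left, fail := F₁ ++ s.fail }
    obtain ⟨F₂, h₂, h₃, h₄⟩ := ih s₂ hs rfl
    have h₁ := hq x ⟨s₁, hs⟩
    have hsize : size s₂ = size s := by simp [size, s₂, s₁, hr]; omega
    have hsize₁ : size s₁ ≤ size s := by simp [size, s₁, hr]
    have hqQ : (q x).eval (size s) ≤ Q.eval (size s) := by
      rw [Polynomial.eval_finsetSum]
      exact Finset.single_le_sum (f := fun x => (q x).eval (size s)) (fun _ _ => Nat.zero_le _)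
        (Finset.mem_univ x)
    refine ⟨F₂ ++ F₁, ?_, ?_, ?_⟩
    · have h₅ : (body x).Exec s₁ s₂ ((q x).eval (size s₁) + 1) :=
        h₁.seq (Frag.Exec.push (by
          funext k; cases k <;> simp [Contents.store, s₂, s₁, F₁]))
      have h₆ := Frag.Exec.loop_cons (s := s) (s₁ := s₁) (k := right) (a := x) (l := r)
        (show s.store right = _ from hr)
        (by funext k; cases k <;> simp [Contents.store, s₁]) h₅ h₂
      refine Frag.Exec.mono (Frag.Exec.of_runs h₆ ?_) ?_
      · congr 1
        simp [s₂, s₁]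
      · have := eval_nat_mono (q x) hsize₁
        rw [hsize]
        simp only [List.length_cons, mul_add, mul_one]
        omega
    · have := length_failures_le (f := f) (some x) s₁ (Ts x)
      have hB : (Ts x).length ≤ B := Finset.le_sup (f := fun x => (Ts x).length)
        (Finset.mem_univ x)
      simp only [List.length_append, List.length_cons, mul_add, mul_one]
      exact Nat.add_le_add h₃ (this.trans hB)
    · rw [allHold_cons, List.append_eq_nil_iff, failures_eq_nil, h₄, and_comm]
      simp [s₂, s₁]

/-! ### Counting -/

/-- Append a copy of the stack `n₁` to the stack `d`. -/
noncomputable def addOnce : Frag tm (Alph m) :=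
  (Frag.transfer n₁ fun b => Contents.store { tmpb := [b] }).seq
    (Frag.transfer tmpb fun b => Contents.store { n₁ := [b], d := [b] })

/-- Remove as many symbols from the stack `d` as there are symbols on the stack `n₃`. -/
noncomputable def removeOnce : Frag tm (Alph m) :=
  (Frag.loop n₃ fun b => (Frag.push tmpb b).seq (Frag.pop d fun _ => Frag.skip)).seq
    (Frag.transfer tmpb fun b => Contents.store { n₃ := [b] })

/-- The unary numbers used for counting. -/
def unary (k : ℕ) : List Bool := List.replicate k true

theorem unary_succ (k : ℕ) : unary (k + 1) = true :: unary k := List.replicate_succ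

theorem exists_exec_addOnce : ∃ C : ℕ, ∀ (s : Contents m) (k l : ℕ), s.tmpb = [] →
    (addOnce : Frag tm (Alph m)).Exec { s with n₁ := unary k, d := unary l }
      { s with n₁ := unary k, d := unary (k + l) } (C * k + 2) := by
  refine ⟨Frag.transferCost (Γ := Alph m) (k := n₁) (fun b => Contents.store { tmpb := [b] }) +
    Frag.transferCost (Γ := Alph m) (k := tmpb) (fun b => Contents.store { n₁ := [b], d := [b] }),
    fun s k l hs => ?_⟩
  refine Frag.Exec.mono (Frag.Exec.seq
    (s' := { s with n₁ := [], d := unary l, tmpb := unary k })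
    (Frag.Exec.transfer (fun _ => rfl) ?_) (Frag.Exec.transfer (fun _ => rfl) ?_)) ?_
  · funext k'
    cases k' <;> simp [Frag.transferred, Contents.store, hs, unary]
  · funext k'
    cases k' <;> simp [Frag.transferred, Contents.store, hs, unary]
  · simp [Contents.store, unary, add_mul]; omega

theorem exists_exec_removeOnce : ∃ C : ℕ, ∀ (s : Contents m) (k l : ℕ), s.tmpb = [] →
    (removeOnce : Frag tm (Alph m)).Exec { s with n₃ := unary k, d := unary l }
      { s with n₃ := unary k, d := unary (l - k) } (C * k + 2) := by
  refine ⟨4 +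
    Frag.transferCost (Γ := Alph m) (k := tmpb) (fun b => Contents.store { n₃ := [b] }),
    fun s k l hs => ?_⟩
  have h₁ : ∀ k l j : ℕ, (Frag.loop n₃ fun b => (Frag.push tmpb b).seq
      (Frag.pop d fun _ => Frag.skip) : Frag tm (Alph m)).Exec
      { s with n₃ := unary k, d := unary l, tmpb := unary j }
      { s with n₃ := [], d := unary (l - k), tmpb := unary (k + j) } (4 * k + 1) := by
    intro k
    induction k with
    | zero => intro l j; simpa [unary] using Frag.Exec.loop_nil rfl
    | succ k ih =>
      intro l j
      have h := ih (l - 1) (j + 1)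
      rw [show l - 1 - k = l - (k + 1) by omega, show k + (j + 1) = k + 1 + j by omega] at h
      refine Frag.Exec.mono (Frag.Exec.loop_cons (a := true) (l := unary k)
        (s₁ := { s with n₃ := unary k, d := unary l, tmpb := unary j }) (t := 1 + (1 + 1))
        (by simp [Contents.store, unary_succ]) ?_ (Frag.Exec.seq (s' :=
          { s with n₃ := unary k, d := unary l, tmpb := unary (j + 1) }) (Frag.Exec.push ?_)
          (Frag.Exec.pop (s₁ := { s with n₃ := unary k, d := unary (l - 1), tmpb := unary (j + 1) })
            ?_ (Frag.Exec.skip _))) h) (by omega)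
      · funext k'; cases k' <;> simp [Contents.store]
      · funext k'; cases k' <;> simp [Contents.store, unary_succ]
      · funext k'; cases k' <;> simp [Contents.store, unary]
  have h := h₁ k l 0
  rw [show unary 0 = [] from rfl, ← hs] at h
  refine Frag.Exec.mono (h.seq (Frag.Exec.transfer (fun _ => rfl) ?_)) ?_
  · funext k'
    cases k' <;> simp [Frag.transferred, Contents.store, hs, unary]
  · simp [Contents.store, unary, add_mul]; omega

/-- Compute `n₀ n₁ - n₂ n₃` on the stack `d`. -/
noncomputable def crossDifference : Frag tm (Alph m) :=
  (Frag.loop n₀ fun _ => addOnce).seq (Frag.loop n₂ fun _ => removeOnce)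

/-- Products are repeated additions and repeated truncated subtractions. Truncation is harmless:
subtracting k₃ in k₂ rounds agrees with one truncated subtraction of k₂ k₃, and only the positivity
of the result is used. -/
theorem exists_exec_crossDifference : ∃ C : ℕ, ∀ (s : Contents m) (k₀ k₁ k₂ k₃ l : ℕ),
    s.tmpb = [] → (crossDifference : Frag tm (Alph m)).Exec
      { s with n₀ := unary k₀, n₁ := unary k₁, n₂ := unary k₂, n₃ := unary k₃, d := unary l }
      { s with
        n₀ := []
        n₁ := unary k₁
        n₂ := []
        n₃ := unary k₃
        d := unary (k₀ * k₁ + l - k₂ * k₃) }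
      ((C * k₁ + 3) * k₀ + 1 + ((C * k₃ + 3) * k₂ + 1)) := by
  obtain ⟨C₁, h₁⟩ := exists_exec_addOnce (tm := tm) (m := m)
  obtain ⟨C₂, h₂⟩ := exists_exec_removeOnce (tm := tm) (m := m)
  refine ⟨C₁ + C₂, fun s k₀ k₁ k₂ k₃ l hs => Frag.Exec.seq (s' := { s with
      n₀ := []
      n₁ := unary k₁
      n₂ := unary k₂
      n₃ := unary k₃
      d := unary (k₀ * k₁ + l) }) ?_ ?_⟩
  · induction k₀ generalizing l with
    | zero => simpa [unary] using Frag.Exec.loop_nil rfl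
    | succ k₀ ih =>
      have h := ih (k₁ + l)
      rw [show k₀ * k₁ + (k₁ + l) = (k₀ + 1) * k₁ + l by ring] at h
      refine Frag.Exec.mono (Frag.Exec.loop_cons (a := true) (l := unary k₀) (s₁ :=
        { s with n₀ := unary k₀, n₁ := unary k₁, n₂ := unary k₂, n₃ := unary k₃, d := unary l })
        (by simp [Contents.store, unary_succ]) ?_ (h₁
          { s with n₀ := unary k₀, n₂ := unary k₂, n₃ := unary k₃ } k₁ l hs) h) ?_
      · funext k'; cases k' <;> simp [Contents.store]
      · have : C₁ * k₁ ≤ (C₁ + C₂) * k₁ := Nat.mul_le_mul_right _ (by omega)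
        simp only [mul_add, mul_one]
        omega
  · generalize k₀ * k₁ + l = l
    induction k₂ generalizing l with
    | zero => simpa [unary] using Frag.Exec.loop_nil rfl
    | succ k₂ ih =>
      have h := ih (l - k₃)
      rw [show l - k₃ - k₂ * k₃ = l - (k₂ + 1) * k₃ by rw [add_mul, one_mul]; omega] at h
      refine Frag.Exec.mono (Frag.Exec.loop_cons (a := true) (l := unary k₂) (s₁ :=
        { s with n₀ := [], n₁ := unary k₁, n₂ := unary k₂, n₃ := unary k₃, d := unary l })
        (by simp [Contents.store, unary_succ]) ?_ (h₂
          { s with n₀ := [], n₁ := unary k₁, n₂ := unary k₂ } k₃ l hs) h) ?_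
      · funext k'; cases k' <;> simp [Contents.store]
      · have : C₂ * k₃ ≤ (C₁ + C₂) * k₃ := Nat.mul_le_mul_right _ (by omega)
        simp only [mul_add, mul_one]
        omega

end Verifier

end StackProg

/-! ### Reading the instance and the certificate -/

namespace StackProg

open Function StateTransition

variable {tm : Unit → FinTM2} {m : ℕ}

namespace Verifier

open Stk

variable {f : List Bool × List Bool → ℕ}

/-! ### Reading the input -/

/-- The symbols of the three components of an instance, and of the certificate. -/
def readSymbol : (Bool ⊕ (Bool ⊕ Bool)) ⊕ Bool → Contents m
  | .inl (.inl b) => { w := [b] }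
  | .inl (.inr (.inl b)) => { r := [b] }
  | .inl (.inr (.inr b)) => { a := [b] }
  | .inr b => { c := [b] }

/-- The first component of an instance. -/
def codeOf (x : List (Bool ⊕ (Bool ⊕ Bool))) : List Bool :=
  x.flatMap fun y => (readSymbol (m := 0) (.inl y)).w

/-- The second component of an instance. -/
def vectorOf (x : List (Bool ⊕ (Bool ⊕ Bool))) : List Bool :=
  x.flatMap fun y => (readSymbol (m := 0) (.inl y)).r

/-- The third component of an instance. -/
def numberOf (x : List (Bool ⊕ (Bool ⊕ Bool))) : List Bool :=
  x.flatMap fun y => (readSymbol (m := 0) (.inl y)).a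

/-- The first `j` symbols of a list, which is extended by `false` if it is too short. -/
def takePad : ℕ → List Bool → List Bool
  | 0, _ => []
  | j + 1, l => l.head?.getD false :: takePad j l.tail

theorem takePad_append (u v : List Bool) : takePad u.length (u ++ v) = u := by
  induction u with
  | nil => rfl
  | cons b u ih => simp [takePad, ih]

/-- The record with a given first entry whose other entries are at the start of a list. -/
def record (m : ℕ) (b : Bool) (l : List Bool) : Rec m := (b, fun i => l.getD i false)

theorem record_takePad (x : Rec m) (l : List Bool) :
    record m x.1 (takePad m (List.ofFn x.2 ++ l)) = x := by
  have h := takePad_append (List.ofFn x.2) l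
  rw [List.length_ofFn] at h
  rw [h]
  refine Prod.ext rfl (funext fun i => ?_)
  simp [record]

/-- The records with given first entries, in reversed order, whose other entries are taken from
a list. -/
def build (m : ℕ) : List Bool → List Bool → List (Rec m) → List (Rec m)
  | [], _, V => V
  | b :: R, C, V => build m R (C.drop m) (record m b (takePad m C) :: V)

theorem map_fst_build (R C : List Bool) (V : List (Rec m)) :
    (build m R C V).map Prod.fst = R.reverse ++ V.map Prod.fst := by
  induction R generalizing C V with
  | nil => rfl
  | cons b R ih => simp [build, ih, record]

theorem build_eq (U V : List (Rec m)) :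
    build m (U.map Prod.fst) (U.flatMap fun x => List.ofFn x.2) V = U.reverse ++ V := by
  induction U generalizing V with
  | nil => rfl
  | cons x U ih =>
    have h : ((x :: U).flatMap fun x => List.ofFn x.2).drop m = U.flatMap fun x => List.ofFn x.2 := by
      simp
    rw [List.map_cons, build, h, ih, List.flatMap_cons, record_takePad]
    simp

/-- Pop bits from the stack `c`, and go on with them. -/
def popBits : ℕ → (List Bool → Frag tm (Alph m)) → Frag tm (Alph m)
  | 0, q => q []
  | j + 1, q => Frag.pop c fun o => popBits j fun l => q (o.getD false :: l)

theorem exec_popBits (j : ℕ) (q : List Bool → Frag tm (Alph m)) (s s' : Contents m) (C : List Bool)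
    (t : ℕ) (hq : (q (takePad j C)).Exec { s with c := C.drop j } s' t) :
    (popBits j q).Exec { s with c := C } s' (t + j) := by
  induction j generalizing q C with
  | zero => exact hq
  | succ j ih =>
    refine Frag.Exec.pop (s₁ := { s with c := C.tail }) ?_ (ih _ _ ?_)
    · funext k; cases k <;> rfl
    · rw [List.drop_tail]
      exact hq

/-- Combine the bits of the vector and of the certificate to records. -/
def buildRecords : Frag tm (Alph m) :=
  Frag.loop r fun b => popBits m fun l => Frag.push right (record m b l)

theorem exec_buildRecords (s : Contents m) (R C : List Bool) (V : List (Rec m)) :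
    (buildRecords : Frag tm (Alph m)).Exec { s with r := R, c := C, right := V }
      { s with r := [], c := C.drop (m * R.length), right := build m R C V }
      ((m + 2) * R.length + 1) := by
  induction R generalizing C V with
  | nil => exact (Frag.Exec.loop_nil rfl)
  | cons b R ih =>
    have h := ih (C.drop m) (record m b (takePad m C) :: V)
    rw [List.drop_drop, show m + m * R.length = m * (b :: R).length by simp; ring] at h
    refine Frag.Exec.mono (Frag.Exec.loop_cons (a := b) (l := R)
      (s₁ := { s with r := R, c := C, right := V }) rfl ?_
      (exec_popBits m _ { s with r := R, right := V } _ C 1 (Frag.Exec.push ?_)) h) ?_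
    · funext k; cases k <;> rfl
    · funext k; cases k <;> rfl
    · simp only [List.length_cons, mul_add, mul_one, add_mul]
      omega

/-! ### The verifier -/

/-- The conditions that the verifier checks for a list of records. -/
structure Accepts (f : List Bool × List Bool → ℕ) (G : List (Test m)) (Ts : Rec m → List (Test m))
    (cp : Rec m → Fin 4 → Bool) (δ : ℕ) (w a : List Bool) (V : List (Rec m)) : Prop where
  global : ∀ T ∈ G, T.Holds f w a [] none V
  pointwise : AllHold f Ts w a [] V
  count : V.countP (cp · 2) * V.countP (cp · 3) < V.countP (cp · 0) * V.countP (cp · 1) + δ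

theorem flatMap_replicate_eq (p : Rec m → Bool) (V : List (Rec m)) :
    V.flatMap (fun x => if p x then [true] else []) = unary (V.countP p) := by
  induction V with
  | nil => rfl
  | cons x V ih =>
    rw [List.flatMap_cons, ih, List.countP_cons]
    cases p x <;> simp [unary_succ]

end Verifier

end StackProg

/-! ### The assembled verifier -/

namespace StackProg

open Function StateTransition

variable {m : ℕ}

namespace Verifier

open Stk

variable {f : List Bool × List Bool → ℕ}

/-- The records that the verifier reads. -/
def records (m : ℕ) (y : List (Bool ⊕ (Bool ⊕ Bool)) × List Bool) : List (Rec m) :=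
  build m (vectorOf y.1).reverse y.2.reverse []

theorem map_fst_records (y : List (Bool ⊕ (Bool ⊕ Bool)) × List Bool) :
    (records m y).map Prod.fst = vectorOf y.1 := by
  simp [records, map_fst_build]

theorem length_records (y : List (Bool ⊕ (Bool ⊕ Bool)) × List Bool) :
    (records m y).length = (vectorOf y.1).length := by
  rw [← map_fst_records (m := m) y, List.length_map]

theorem length_parts (x : List (Bool ⊕ (Bool ⊕ Bool))) :
    (codeOf x).length + (vectorOf x).length + (numberOf x).length = x.length := by
  induction x with
  | nil => rfl
  | cons b x ih =>
    rcases b with b | b | b <;>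
      simp [codeOf, vectorOf, numberOf, readSymbol] at ih ⊢ <;> omega

theorem exists_records (x : List (Bool ⊕ (Bool ⊕ Bool))) (V : List (Rec m))
    (hV : V.map Prod.fst = vectorOf x) :
    ∃ c : List Bool, c.length ≤ m * x.length ∧ records m (x, c) = V := by
  refine ⟨(V.reverse.flatMap fun x => List.ofFn x.2).reverse, ?_, ?_⟩
  · have h : V.length ≤ x.length := by
      rw [← List.length_map (f := Prod.fst) (as := V), hV, ← length_parts x]
      omega
    simpa [List.length_flatMap, Function.comp_def, mul_comm] using Nat.mul_le_mul_left m h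
  · rw [records, List.reverse_reverse, ← hV, ← List.map_reverse, build_eq]
    simp

theorem read_code (y : List (Bool ⊕ (Bool ⊕ Bool)) × List Bool) :
    (y.1.map Sum.inl ++ y.2.map Sum.inr).reverse.flatMap
      (fun b => (readSymbol (m := m) b).w) = (codeOf y.1).reverse := by
  obtain ⟨x, c⟩ := y
  induction x with
  | nil => simp [readSymbol, codeOf, List.flatMap_eq_nil_iff]
  | cons b x ih =>
    simp only [List.map_cons, List.cons_append, List.reverse_cons, List.flatMap_append, ih]
    rcases b with b | b | b <;> simp [readSymbol, codeOf]

theorem read_vector (y : List (Bool ⊕ (Bool ⊕ Bool)) × List Bool) :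
    (y.1.map Sum.inl ++ y.2.map Sum.inr).reverse.flatMap
      (fun b => (readSymbol (m := m) b).r) = (vectorOf y.1).reverse := by
  obtain ⟨x, c⟩ := y
  induction x with
  | nil => simp [readSymbol, vectorOf, List.flatMap_eq_nil_iff]
  | cons b x ih =>
    simp only [List.map_cons, List.cons_append, List.reverse_cons, List.flatMap_append, ih]
    rcases b with b | b | b <;> simp [readSymbol, vectorOf]

theorem read_number (y : List (Bool ⊕ (Bool ⊕ Bool)) × List Bool) :
    (y.1.map Sum.inl ++ y.2.map Sum.inr).reverse.flatMap
      (fun b => (readSymbol (m := m) b).a) = (numberOf y.1).reverse := by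
  obtain ⟨x, c⟩ := y
  induction x with
  | nil => simp [readSymbol, numberOf, List.flatMap_eq_nil_iff]
  | cons b x ih =>
    simp only [List.map_cons, List.cons_append, List.reverse_cons, List.flatMap_append, ih]
    rcases b with b | b | b <;> simp [readSymbol, numberOf]

theorem read_certificate (y : List (Bool ⊕ (Bool ⊕ Bool)) × List Bool) :
    (y.1.map Sum.inl ++ y.2.map Sum.inr).reverse.flatMap
      (fun b => (readSymbol (m := m) b).c) = (y.2).reverse := by
  obtain ⟨x, c⟩ := y
  induction x with
  | nil => simp [readSymbol, List.flatMap_map, ← List.map_reverse]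
  | cons b x ih =>
    simp only [List.map_cons, List.cons_append, List.reverse_cons, List.flatMap_append, ih]
    rcases b with b | b | b <;> simp [readSymbol]

theorem encode_eq (y : List (Bool ⊕ (Bool ⊕ Bool)) × List Bool) :
    (encodingProd (encodingList (Bool ⊕ (Bool ⊕ Bool))) (encodingList Bool)).encode y =
      y.1.map .inl ++ y.2.map .inr := rfl

/-- The certificate supplies a block of `m` bits for each element of the ground set. Missing bits
are read as `false` and surplus bits are ignored, so every string whatsoever determines a list of
records over the given vector. This gives soundness for certificates of all lengths, while `m` bits
for each position suffice for completeness. -/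
theorem hasLinearCertificates_accepts {f : List Bool × List Bool → ℕ}
    (hf : PolyTimeComputable (encodingProd (encodingList Bool) (encodingList Bool)) encodingNatBool
      f) (G : List (Test m)) (Ts : Rec m → List (Test m)) (cp : Rec m → Fin 4 → Bool) (δ : ℕ) :
    HasLinearCertificates {x : List (Bool ⊕ (Bool ⊕ Bool)) | ∃ V : List (Rec m),
      V.map Prod.fst = vectorOf x ∧ Accepts f G Ts cp δ (codeOf x) (numberOf x) V} := by
  obtain ⟨M⟩ := hf
  let tm : Unit → FinTM2 := fun _ => M.tm
  have hO : IsOracle tm f := ⟨M.inputAlphabet, M.outputAlphabet, M.time, fun x => ⟨M.outputsFun x⟩⟩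
  obtain ⟨p₂, hp₂⟩ := exists_tests hO G none
  obtain ⟨p₃, F, B, hp₃, hF⟩ := exists_sweep hO Ts
  obtain ⟨C, hC⟩ := exists_exec_crossDifference (tm := tm) (m := m)
  let X := List (Bool ⊕ (Bool ⊕ Bool)) × List Bool
  let n : X → ℕ := fun y => y.1.length + y.2.length + 1
  let s₀ : X → Contents m := fun y => { inp := y.1.map .inl ++ y.2.map .inr }
  let s₁ : X → Contents m := fun y => {
    w := (codeOf y.1).reverse
    r := (vectorOf y.1).reverse
    a := (numberOf y.1).reverse
    c := y.2.reverse }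
  let s₂ : X → Contents m := fun y => {
    w := (codeOf y.1).reverse
    a := (numberOf y.1).reverse
    c := y.2.reverse.drop (m * (vectorOf y.1).reverse.length)
    right := records m y }
  let F₁ : X → List Bool := fun y => failures f none (s₂ y) G
  let s₃ : X → Contents m := fun y => { s₂ y with fail := F₁ y ++ [] }
  let F₂ : X → List Bool := fun y => F ⟨s₃ y, rfl, rfl, rfl, rfl, rfl, rfl, rfl⟩
  let s₄ : X → Contents m := fun y => { s₂ y with
    left := (records m y).reverse ++ []
    right := []
    fail := F₂ y ++ (F₁ y ++ []) }
  let N : X → Fin 4 → ℕ := fun y j => (records m y).countP (cp · j)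
  let s₅ : X → Contents m := fun y => { s₄ y with
    left := []
    n₀ := unary (N y 0)
    n₁ := unary (N y 1)
    n₂ := unary (N y 2)
    n₃ := unary (N y 3)
    d := [] }
  let s₆ : X → Contents m := fun y => { s₅ y with d := unary δ }
  -- The subtraction is truncated, so this is positive exactly if the condition on the counts holds.
  let D : X → ℕ := fun y => N y 0 * N y 1 + δ - N y 2 * N y 3
  let s₇ : X → Contents m := fun y => { s₅ y with n₀ := [], n₂ := [], d := unary (D y) }
  let F₃ : X → List Bool := fun y => (if D y = 0 then [true] else []) ++ (F₂ y ++ (F₁ y ++ []))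
  let s₈ : X → Contents m := fun y => { s₇ y with d := unary (D y - 1), fail := F₃ y }
  let V : X → Bool := fun y => decide (F₃ y = [])
  let s₉ : X → Contents m := fun y => { s₈ y with fail := (F₃ y).tail, out := [V y] }
  let s₁₀ : X → Contents m := fun y => { out := [V y] }
  have hn : ∀ y : X, (codeOf y.1).length + (vectorOf y.1).length + (numberOf y.1).length +
      y.2.length + 1 ≤ n y := fun y => by simp only [n, length_parts]; omega
  have hN : ∀ y j, N y j ≤ n y := fun y j => by
    have h₁ := hn y
    have h₂ : N y j ≤ (records m y).length := List.countP_le_length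
    rw [length_records] at h₂
    omega
  have h₁ : (Frag.transfer inp fun b => (readSymbol b).store : Frag tm (Alph m)).PolyExec
      s₀ s₁ n := by
    refine Frag.PolyExec.transfer (by rintro ((b | b | b) | b) <;> rfl) (fun y => ?_)
      (fun y => by simp [Contents.store, s₀, n])
    funext k
    cases k <;> simp only [Frag.transferred, Contents.store, s₀, s₁, reduceCtorEq, if_false, if_true,
      List.append_nil]
    all_goals first
      | exact read_code y
      | exact read_vector y
      | exact read_number y
      | exact read_certificate y
      | exact List.flatMap_eq_nil_iff.2 (by rintro ((b | b | b) | b) _ <;> rfl)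
  have h₁' : (buildRecords : Frag tm (Alph m)).PolyExec s₁ s₂ n := by
    refine ⟨Polynomial.C (m + 2) * Polynomial.X + 1, fun y => ?_⟩
    refine (exec_buildRecords (s₁ y) (vectorOf y.1).reverse y.2.reverse []).mono ?_
    have := hn y
    simp only [Polynomial.eval_add, Polynomial.eval_mul, Polynomial.eval_C, Polynomial.eval_X,
      Polynomial.eval_one, List.length_reverse]
    exact Nat.add_le_add_right (Nat.mul_le_mul_left _ (by omega)) _
  have hsize : ∀ y, size (s₂ y) ≤ n y := fun y => by
    have := hn y
    simp only [size, s₂, List.length_reverse, length_records, List.length_nil]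
    omega
  have h₂ : p₂.PolyExec s₂ s₃ n :=
    hp₂.comp (fun y => ⟨s₂ y, rfl, rfl, rfl, rfl, rfl, rfl, rfl⟩) hsize
  have h₃ : p₃.PolyExec s₃ s₄ n :=
    hp₃.comp (fun y => ⟨s₃ y, rfl, rfl, rfl, rfl, rfl, rfl, rfl⟩) hsize
  have h₄ : (Frag.transfer left fun x => Contents.store {
      n₀ := if cp x 0 then [true] else []
      n₁ := if cp x 1 then [true] else []
      n₂ := if cp x 2 then [true] else []
      n₃ := if cp x 3 then [true] else [] } : Frag tm (Alph m)).PolyExec s₄ s₅ n := by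
    refine Frag.PolyExec.transfer (fun _ => rfl) (fun y => ?_) (fun y => ?_)
    · funext k
      cases k <;> simp [Frag.transferred, Contents.store, s₄, s₅, s₂, flatMap_replicate_eq, N]
    · have := hn y
      simp only [Contents.store, s₄, List.append_nil, List.length_reverse, length_records]
      omega
  have h₅ : (Frag.pushList d (unary δ) : Frag tm (Alph m)).PolyExec s₅ s₆ n := by
    refine ⟨Polynomial.C (δ + 1), fun y => ?_⟩
    have h := Frag.runs_pushList (tm := tm) d (unary δ) (s₅ y).store
    refine Frag.Exec.mono (Frag.Exec.of_runs h ?_) (by simp [unary])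
    funext k
    cases k <;> simp [Contents.store, s₅, s₆]
  have h₆ : (crossDifference : Frag tm (Alph m)).PolyExec s₆ s₇ n := by
    refine ⟨((Polynomial.C C * Polynomial.X + 3) * Polynomial.X + 1) +
      ((Polynomial.C C * Polynomial.X + 3) * Polynomial.X + 1), fun y => ?_⟩
    refine (hC (s₅ y) (N y 0) (N y 1) (N y 2) (N y 3) δ rfl).mono ?_
    simp only [Polynomial.eval_add, Polynomial.eval_mul, Polynomial.eval_C, Polynomial.eval_X,
      Polynomial.eval_one, Polynomial.eval_ofNat]
    gcongr <;> exact hN y _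
  have h₇ : (Frag.pop d fun o => if o.isSome then Frag.skip else Frag.push fail true :
      Frag tm (Alph m)).PolyExec s₇ s₈ n := by
    refine ⟨2, fun y => ?_⟩
    rw [Polynomial.eval_ofNat]
    refine Frag.Exec.pop (s₁ := { s₇ y with d := unary (D y - 1) }) ?_ ?_
    · funext k
      cases k <;> simp [Contents.store, s₇, unary]
    · have e : ((s₇ y).store d).head? = (unary (D y)).head? := rfl
      rw [e]
      by_cases hD : D y = 0
      · have : s₈ y = { s₇ y with
            d := unary (D y - 1), fail := true :: (F₂ y ++ (F₁ y ++ [])) } := by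
          simp [s₈, F₃, hD]
        rw [this, hD]
        exact Frag.Exec.push (by funext k; cases k <;> rfl)
      · have : s₈ y = { s₇ y with d := unary (D y - 1) } := by
          simp [s₈, F₃, hD, s₇, s₅, s₄]
        rw [this]
        obtain ⟨j, hj⟩ := Nat.exists_eq_succ_of_ne_zero hD
        rw [hj, Nat.succ_eq_add_one, unary_succ]
        exact Frag.Exec.skip _
  have h₈ : (Frag.pop fail fun o => if o.isSome then Frag.push out false else Frag.push out true :
      Frag tm (Alph m)).PolyExec s₈ s₉ n := by
    refine ⟨2, fun y => ?_⟩
    rw [Polynomial.eval_ofNat]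
    refine Frag.Exec.pop (s₁ := { s₈ y with fail := (F₃ y).tail }) ?_ ?_
    · funext k
      cases k <;> simp [Contents.store, s₈]
    · have e : ((s₈ y).store fail).head? = (F₃ y).head? := rfl
      rw [e]
      by_cases hD : F₃ y = []
      · rw [hD]
        refine Frag.Exec.push ?_
        funext k
        cases k <;> simp [Contents.store, s₉, s₈, V, hD, s₇, s₅, s₄, s₂]
      · obtain ⟨b, l, hl⟩ := List.exists_cons_of_ne_nil hD
        rw [hl]
        refine Frag.Exec.push ?_
        funext k
        cases k <;> simp [Contents.store, s₉, s₈, V, s₇, s₅, s₄, s₂, hl]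
  -- All other stacks must be empty at the end. Clearing them is polynomial because the unary
  -- product on `d` is at most quadratic, up to the constant `δ`, and all other stacks are linearly
  -- bounded.
  have h₉ : (Frag.clear (Finset.univ.erase out).toList : Frag tm (Alph m)).PolyExec s₉ s₁₀ n := by
    let b : Polynomial ℕ := Polynomial.X * Polynomial.X + Polynomial.C (B + 1) * Polynomial.X +
      Polynomial.C (G.length + δ + 1)
    refine ⟨Polynomial.C (Finset.univ.erase out).toList.length * (2 * b + 1) + 1, fun y => ?_⟩
    have h := Frag.runs_clear (tm := tm) (Finset.univ.erase out).toList (s₉ y).store (b.eval (n y)) ?_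
    · refine Frag.Exec.mono (Frag.Exec.of_runs h ?_) ?_
      · funext k
        cases k <;> simp [Contents.store, s₉, s₁₀]
      · simp
    · have hb : b.eval (n y) = n y * n y + (B + 1) * n y + (G.length + δ + 1) := by simp [b]
      have hny := hn y
      have hD : D y ≤ n y * n y + δ :=
        (Nat.sub_le _ _).trans (Nat.add_le_add_right (Nat.mul_le_mul (hN y 0) (hN y 1)) _)
      have hF₁ : (F₁ y).length ≤ G.length := length_failures_le _ _ _
      have hF₂ : (F₂ y).length ≤ B * n y := (hF _).1.trans (Nat.mul_le_mul_left _ (by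
        simp only [s₃, s₂, length_records]; omega))
      have hF₃ : (F₃ y).length ≤ 1 + (B * n y + G.length) := by
        simp only [F₃, List.length_append, List.append_nil]
        refine Nat.add_le_add ?_ (Nat.add_le_add hF₂ hF₁)
        split <;> simp
      have hN₁ := hN y 1
      have hN₃ := hN y 3
      have hBn : (B + 1) * n y = B * n y + n y := by ring
      rw [hb, hBn]
      generalize n y = K at hny hD hF₂ hF₃ hN₁ hN₃
      generalize K * K = K₂ at hD
      generalize B * K = K₃ at hF₂ hF₃
      intro k
      cases k <;> simp [Contents.store, s₉, s₈, s₇, s₅, s₄, s₂, unary] <;> omega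
  obtain ⟨prog, q, hq⟩ : ∃ prog : Frag tm (Alph m), prog.PolyExec s₀ s₁₀ n :=
    ⟨_, h₁.seq <| h₁'.seq <| h₂.seq <| h₃.seq <|
    h₄.seq <| h₅.seq <| h₆.seq <| h₇.seq <| h₈.seq h₉⟩
  have hV : ∀ y, V y = true ↔
      Accepts f G Ts cp δ (codeOf y.1) (numberOf y.1) (records m y) := by
    intro y
    have e₁ : F₁ y = [] ↔ ∀ T ∈ G, T.Holds f (codeOf y.1) (numberOf y.1) [] none (records m y) := by
      have := failures_eq_nil (f := f) (cur := none) (s := s₂ y) (Ts := G)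
      simpa [F₁, s₂] using this
    have e₂ : F₂ y = [] ↔ AllHold f Ts (codeOf y.1) (numberOf y.1) [] (records m y) := by
      have := (hF ⟨s₃ y, rfl, rfl, rfl, rfl, rfl, rfl, rfl⟩).2
      refine Iff.trans this ?_
      simp [s₃, s₂]
    have e₃ : (if D y = 0 then [true] else []) = [] ↔ N y 2 * N y 3 < N y 0 * N y 1 + δ := by
      have : D y = 0 ↔ ¬ N y 2 * N y 3 < N y 0 * N y 1 + δ := by simp only [D]; omega
      rw [← not_iff_not, ← this]
      simp
    rw [decide_eq_true_iff]
    simp only [F₃, List.append_eq_nil_iff, e₁, e₂, e₃]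
    exact ⟨fun ⟨h₁, h₂, h₃, _⟩ => ⟨h₃, h₂, h₁⟩, fun ⟨h₁, h₂, h₃⟩ => ⟨h₃, h₂, h₁, trivial⟩⟩
  refine ⟨m, V, ?_, ?_, ?_⟩
  · refine polyTimeComputable_of_frag (tm := tm) (Γ := Alph m) prog inp out (Equiv.refl _) (Equiv.refl _)
      (q.comp (Polynomial.X + 1)) fun y => ?_
    have h := hq y
    have e : n y = ((encodingProd (encodingList (Bool ⊕ (Bool ⊕ Bool)))
        (encodingList Bool)).encode y).length + 1 := by simp [n, encode_eq]
    rw [Polynomial.eval_comp, Polynomial.eval_add, Polynomial.eval_X, Polynomial.eval_one, ← e]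
    have e₀ : (s₀ y).store = (update (fun _ => []) inp
        (((encodingProd (encodingList (Bool ⊕ (Bool ⊕ Bool))) (encodingList Bool)).encode y).map
          (Equiv.refl _).symm) : Store (Alph m)) := by
      funext k
      cases k <;> simp [Contents.store, s₀, encode_eq]
    have e₁ : (s₁₀ y).store = (update (fun _ => []) out
        ((encodingBoolBool.encode (V y)).map (Equiv.refl _).symm) : Store (Alph m)) := by
      funext k
      cases k <;> simp [Contents.store, s₁₀, encodingBoolBool, encodeBool]
    rw [← e₀, ← e₁]
    exact h
  · rintro x ⟨U, hU, hA⟩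
    obtain ⟨c, hc, hr⟩ := exists_records x U hU
    refine ⟨c, hc, (hV _).2 ?_⟩
    rw [hr]
    exact hA
  · exact fun x c h => ⟨records m (x, c), map_fst_records _, (hV _).1 h⟩

end Verifier

end StackProg

/-! ### Reverse Cauchy–Schwarz inequalities and the Bochner method -/

namespace MatroidForm

open Matrix

variable {α : Type} [Fintype α]

/-! ### Lorentzian bilinear forms -/

/-- q² - p s = (q + t s)² - s (p + 2 t q + t² s). -/
theorem mul_le_sq_of_nonpos {p q s t : ℝ} (hs : 0 < s) (h : p + 2 * t * q + t ^ 2 * s ≤ 0) :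
    p * s ≤ q ^ 2 := by
  nlinarith [sq_nonneg (q + t * s), mul_nonneg hs.le (neg_nonneg.2 h)]

/-- A symmetric matrix with nonnegative entries satisfies the reverse Cauchy–Schwarz inequality. -/
def Hyperbolic (Q : Matrix α α ℝ) : Prop :=
  ∀ x y : α → ℝ, 0 ≤ y → (x ⬝ᵥ Q *ᵥ x) * (y ⬝ᵥ Q *ᵥ y) ≤ (x ⬝ᵥ Q *ᵥ y) ^ 2

variable {Q : Matrix α α ℝ}

theorem form_comm (hQ : Q.IsSymm) (x y : α → ℝ) : x ⬝ᵥ Q *ᵥ y = y ⬝ᵥ Q *ᵥ x := by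
  rw [dotProduct_mulVec, dotProduct_comm, ← mulVec_transpose, hQ.eq]

theorem form_add_smul (hQ : Q.IsSymm) (x y : α → ℝ) (t : ℝ) :
    (x + t • y) ⬝ᵥ Q *ᵥ (x + t • y) =
      x ⬝ᵥ Q *ᵥ x + 2 * t * (x ⬝ᵥ Q *ᵥ y) + t ^ 2 * (y ⬝ᵥ Q *ᵥ y) := by
  simp only [mulVec_add, mulVec_smul, add_dotProduct, dotProduct_add, smul_dotProduct,
    dotProduct_smul, smul_eq_mul, form_comm hQ y x]
  ring

theorem form_eq_sum (x y : α → ℝ) : x ⬝ᵥ Q *ᵥ y = ∑ e, ∑ f, x e * Q e f * y f := by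
  simp only [dotProduct, mulVec, Finset.mul_sum, mul_assoc]

theorem form_nonneg (h : ∀ e f, 0 ≤ Q e f) {x y : α → ℝ} (hx : 0 ≤ x) (hy : 0 ≤ y) :
    0 ≤ x ⬝ᵥ Q *ᵥ y := by
  rw [form_eq_sum]
  exact Finset.sum_nonneg fun e _ => Finset.sum_nonneg fun f _ =>
    mul_nonneg (mul_nonneg (hx e) (h e f)) (hy f)

theorem eq_zero_of_form_eq_zero (h : ∀ e f, 0 ≤ Q e f) {u : α → ℝ} (hu : ∀ e, 0 < u e)
    (h0 : u ⬝ᵥ Q *ᵥ u = 0) : Q = 0 := by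
  rw [form_eq_sum] at h0
  have h₁ : ∀ e f, 0 ≤ u e * Q e f * u f := fun e f =>
    mul_nonneg (mul_nonneg (hu e).le (h e f)) (hu f).le
  ext e f
  have h₂ := (Finset.sum_eq_zero_iff_of_nonneg fun e _ =>
    Finset.sum_nonneg fun f _ => h₁ e f).1 h0 e (Finset.mem_univ e)
  have h₃ := (Finset.sum_eq_zero_iff_of_nonneg fun f _ => h₁ e f).1 h₂ f (Finset.mem_univ f)
  have := (hu e).ne'
  have := (hu f).ne'
  simp_all

/-- It suffices to find a point with nonpositive value on each line x + t y with Q(y,y) > 0: the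
quadratic polynomial in t then has nonnegative discriminant. -/
theorem hyperbolic_of_exists (hQ : Q.IsSymm)
    (h : ∀ x y : α → ℝ, 0 ≤ y → 0 < y ⬝ᵥ Q *ᵥ y →
      ∃ t : ℝ, (x + t • y) ⬝ᵥ Q *ᵥ (x + t • y) ≤ 0) (h' : ∀ e f, 0 ≤ Q e f) : Hyperbolic Q := by
  intro x y hy
  rcases (form_nonneg h' hy hy).eq_or_lt with h0 | h0
  · rw [← h0, mul_zero]
    positivity
  · obtain ⟨t, ht⟩ := h x y hy h0
    rw [form_add_smul hQ] at ht
    exact mul_le_sq_of_nonpos h0 ht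

/-- A vector on which a hyperbolic form vanishes, and which is orthogonal to a positive vector, is
in the kernel. -/
theorem Hyperbolic.kernel (h : Hyperbolic Q) (hQ : Q.IsSymm) {y z : α → ℝ} (hy : 0 ≤ y)
    (hyy : 0 < y ⬝ᵥ Q *ᵥ y) (hzy : z ⬝ᵥ Q *ᵥ y = 0) (hzz : 0 ≤ z ⬝ᵥ Q *ᵥ z) (x : α → ℝ) :
    z ⬝ᵥ Q *ᵥ x = 0 := by
  have neg : ∀ v : α → ℝ, v ⬝ᵥ Q *ᵥ y = 0 → v ⬝ᵥ Q *ᵥ v ≤ 0 := by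
    intro v hv
    have := h v y hy
    rw [hv] at this
    by_contra! hc
    nlinarith [mul_pos hc hyy]
  set t := (x ⬝ᵥ Q *ᵥ y) / (y ⬝ᵥ Q *ᵥ y) with ht
  set x' := x + (-t) • y with hx'
  have hx'y : x' ⬝ᵥ Q *ᵥ y = 0 := by
    rw [hx', add_dotProduct, smul_dotProduct, ht, smul_eq_mul]
    field_simp
    ring
  have hz : z ⬝ᵥ Q *ᵥ x = z ⬝ᵥ Q *ᵥ x' := by
    rw [hx', mulVec_add, mulVec_smul, dotProduct_add, dotProduct_smul, hzy, smul_zero, add_zero]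
  rw [hz]
  set b := z ⬝ᵥ Q *ᵥ x' with hb
  set p := x' ⬝ᵥ Q *ᵥ x' with hp
  -- The form is nonpositive on the orthogonal complement of `y`, which contains z + s x'. A
  -- quadratic polynomial in s without constant term that is never positive has no linear term.
  have key : ∀ s : ℝ, 2 * s * b + s ^ 2 * p ≤ 0 := by
    intro s
    have h₁ := neg (z + s • x') (by
      rw [add_dotProduct, smul_dotProduct, hzy, hx'y, smul_zero, add_zero])
    rw [form_add_smul hQ] at h₁
    linarith
  have hp0 : p ≤ 0 := neg x' hx'y
  by_contra hb0
  rcases hp0.eq_or_lt with h₂ | h₂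
  · have := key b
    rw [h₂] at this
    nlinarith [sq_nonneg b, (sq_pos_of_ne_zero hb0)]
  · have h₁ := key (-b / p)
    have h₃ : 2 * (-b / p) * b + (-b / p) ^ 2 * p = -(b ^ 2 / p) := by
      field_simp
      ring
    rw [h₃] at h₁
    have := div_neg_of_pos_of_neg (sq_pos_of_ne_zero hb0) h₂
    linarith

/-! ### The Bochner inequality implies hyperbolicity -/

section Bochner

variable [DecidableEq α]

/-- After normalization by d = Qu, the Bochner inequality says l ≤ l² for every eigenvalue l, so
positive eigenvalues are at least 1. The vector u belongs to the eigenvalue 1. A Dirichlet form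
shows that every eigenvector with l ≥ 1 is proportional to u on the support of d, since `hconn`
connects that support by paths of length at most 2. Hence only nonpositive eigenvalues contribute on
the orthogonal complement of u. -/
theorem form_nonpos_of_bochner (hQ : Q.IsSymm) (h0 : ∀ e f, 0 ≤ Q e f) {u : α → ℝ}
    (hu : ∀ e, 0 < u e)
    (hB : ∀ x : α → ℝ, x ⬝ᵥ Q *ᵥ x ≤ ∑ e, u e / (Q *ᵥ u) e * (Q *ᵥ x) e ^ 2)
    (hconn : ∀ e f, 0 < (Q *ᵥ u) e → 0 < (Q *ᵥ u) f →
      e = f ∨ 0 < Q e f ∨ ∃ g, 0 < Q e g ∧ 0 < Q g f)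
    (x : α → ℝ) (hx : x ⬝ᵥ Q *ᵥ u = 0) : x ⬝ᵥ Q *ᵥ x ≤ 0 := by
  set d := Q *ᵥ u with hd
  have hd0 : ∀ e, 0 ≤ d e := fun e =>
    Finset.sum_nonneg fun f _ => mul_nonneg (h0 e f) (hu f).le
  have hrow : ∀ e, d e = 0 → ∀ f, Q e f = 0 := by
    intro e he f
    have := (Finset.sum_eq_zero_iff_of_nonneg
      fun f _ => mul_nonneg (h0 e f) (hu f).le).1 he f (Finset.mem_univ f)
    exact (mul_eq_zero.1 this).resolve_right (hu f).ne'
  -- Scaling by `c` turns the operator into a symmetric matrix, to which the spectral theorem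
  -- applies. Where `d` vanishes, division by zero makes `c` vanish; there the row of `Q` is zero
  -- anyway.
  set c : α → ℝ := fun e => √(u e / d e) with hc
  have hc2 : ∀ e, c e ^ 2 = u e / d e := fun e =>
    Real.sq_sqrt (div_nonneg (hu e).le (hd0 e))
  have hc0 : ∀ e, d e ≠ 0 → c e ≠ 0 := fun e he => by
    have : 0 < u e / d e := div_pos (hu e) (lt_of_le_of_ne (hd0 e) (Ne.symm he))
    exact (Real.sqrt_pos.2 this).ne'
  set A : Matrix α α ℝ := Matrix.of fun e f => c e * Q e f * c f with hA
  have hAsymm : A.IsHermitian := by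
    ext e f
    simp only [conjTranspose_apply, star_trivial, hA, of_apply]
    rw [hQ.apply e f]
    ring
  have hAv : ∀ v : α → ℝ, A *ᵥ v = fun e => c e * (Q *ᵥ (fun f => c f * v f)) e := by
    intro v
    funext e
    simp only [mulVec, dotProduct, hA, of_apply, Finset.mul_sum]
    exact Finset.sum_congr rfl fun f _ => by ring
  have hvA : ∀ v w : α → ℝ, v ⬝ᵥ A *ᵥ w = (fun e => c e * v e) ⬝ᵥ Q *ᵥ (fun f => c f * w f) := by
    intro v w
    rw [hAv]
    simp only [dotProduct]
    exact Finset.sum_congr rfl fun f _ => by ring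
  -- positive eigenvalues only have eigenvectors proportional to `u`
  have heig : ∀ (v : α → ℝ) (l : ℝ), A *ᵥ v = l • v → v ≠ 0 → 0 < l →
      ∃ k : ℝ, ∀ e, d e ≠ 0 → c e * v e = k * u e := by
    intro v l hv hv0 hl
    set y : α → ℝ := fun e => c e * v e with hy
    have hvv : 0 < v ⬝ᵥ v := by
      refine lt_of_le_of_ne (Finset.sum_nonneg fun e _ => mul_self_nonneg _) (Ne.symm ?_)
      rwa [Ne, dotProduct_self_eq_zero]
    have h₁ : y ⬝ᵥ Q *ᵥ y = l * (v ⬝ᵥ v) := by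
      rw [← hvA, hv, dotProduct_smul, smul_eq_mul]
    have h₂ : ∑ e, u e / d e * (Q *ᵥ y) e ^ 2 = l ^ 2 * (v ⬝ᵥ v) := by
      rw [dotProduct, Finset.mul_sum]
      refine Finset.sum_congr rfl fun e _ => ?_
      have h₃ : c e * (Q *ᵥ y) e = l * v e := by
        have := congrFun hv e
        rw [hAv] at this
        simpa using this
      rw [← hc2, ← mul_pow, h₃]
      ring
    -- The Bochner inequality for y reads l |v|² ≤ l² |v|².
    have h₃ : 1 ≤ l := by
      have := hB y
      rw [h₁, h₂] at this
      by_contra! hlt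
      nlinarith [mul_pos hl hvv]
    have hv1 : ∀ e, d e = 0 → v e = 0 := by
      intro e he
      have := congrFun hv e
      rw [hAv] at this
      have hce : c e = 0 := by simp [hc, he]
      simp only [hce, zero_mul] at this
      rw [Pi.smul_apply, smul_eq_mul, eq_comm, mul_eq_zero] at this
      exact this.resolve_left hl.ne'
    -- the Dirichlet form
    set g : α → ℝ := fun e => y e / u e with hg
    have hyg : ∀ e, y e = u e * g e := fun e => by
      simp only [hg]
      field_simp [(hu e).ne']
    have h₄ : ∑ e, ∑ f, Q e f * (u e * u f) * (g e - g f) ^ 2 =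
        2 * (∑ e, d e * u e * g e ^ 2) - 2 * (y ⬝ᵥ Q *ᵥ y) := by
      have e₁ : ∑ e, d e * u e * g e ^ 2 = ∑ e, ∑ f, Q e f * (u e * u f) * g e ^ 2 := by
        refine Finset.sum_congr rfl fun e _ => ?_
        simp only [hd, mulVec, dotProduct, Finset.sum_mul]
        exact Finset.sum_congr rfl fun f _ => by ring
      have e₂ : ∑ e, d e * u e * g e ^ 2 = ∑ e, ∑ f, Q e f * (u e * u f) * g f ^ 2 := by
        rw [e₁, Finset.sum_comm]
        refine Finset.sum_congr rfl fun e _ => Finset.sum_congr rfl fun f _ => ?_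
        rw [hQ.apply e f]
        ring
      rw [two_mul, sub_eq_add_neg]
      nth_rewrite 1 [e₁]
      rw [e₂, form_eq_sum, Finset.mul_sum, ← Finset.sum_neg_distrib, ← Finset.sum_add_distrib,
        ← Finset.sum_add_distrib]
      refine Finset.sum_congr rfl fun e _ => ?_
      rw [Finset.mul_sum, ← Finset.sum_neg_distrib, ← Finset.sum_add_distrib,
        ← Finset.sum_add_distrib]
      refine Finset.sum_congr rfl fun f _ => ?_
      rw [hyg e, hyg f]
      ring
    have h₅ : ∑ e, d e * u e * g e ^ 2 = v ⬝ᵥ v := by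
      refine Finset.sum_congr rfl fun e _ => ?_
      by_cases he : d e = 0
      · rw [he, hv1 e he]; ring
      · have h₆ : g e ^ 2 = u e / d e * v e ^ 2 / u e ^ 2 := by
          simp only [hg, hy, div_pow, mul_pow, hc2]
        rw [h₆]
        have := (hu e).ne'
        field_simp
    have h₆ : ∀ e f, 0 ≤ Q e f * (u e * u f) * (g e - g f) ^ 2 := fun e f =>
      mul_nonneg (mul_nonneg (h0 e f) (mul_pos (hu e) (hu f)).le) (sq_nonneg _)
    -- The Dirichlet form equals 2 (1 - l) |v|², which is nonpositive as l ≥ 1, while all its terms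
    -- are nonnegative.
    have h₇ : ∑ e, ∑ f, Q e f * (u e * u f) * (g e - g f) ^ 2 = 0 := by
      refine le_antisymm ?_ (Finset.sum_nonneg fun e _ => Finset.sum_nonneg fun f _ => h₆ e f)
      rw [h₄, h₅, h₁]
      nlinarith
    have h₈ : ∀ e f, 0 < Q e f → g e = g f := by
      intro e f hef
      have := (Finset.sum_eq_zero_iff_of_nonneg fun e _ =>
        Finset.sum_nonneg fun f _ => h₆ e f).1 h₇ e (Finset.mem_univ e)
      have := (Finset.sum_eq_zero_iff_of_nonneg fun f _ => h₆ e f).1 this f (Finset.mem_univ f)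
      have h₉ := (mul_eq_zero.1 this).resolve_left
        (mul_pos hef (mul_pos (hu e) (hu f))).ne'
      exact sub_eq_zero.1 (pow_eq_zero_iff two_ne_zero |>.1 h₉)
    have h₉ : ∀ e f, d e ≠ 0 → d f ≠ 0 → g e = g f := by
      intro e f he hf
      rcases hconn e f (lt_of_le_of_ne (hd0 e) (Ne.symm he)) (lt_of_le_of_ne (hd0 f) (Ne.symm hf))
        with h | h | ⟨k, h, h'⟩
      · rw [h]
      · exact h₈ e f h
      · rw [h₈ e k h, h₈ k f h']
    by_cases hex : ∃ e₀, d e₀ ≠ 0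
    · obtain ⟨e₀, he₀⟩ := hex
      refine ⟨g e₀, fun e he => ?_⟩
      rw [← h₉ e e₀ he he₀, mul_comm (g e)]
      exact hyg e
    · exact ⟨0, fun e he => absurd ⟨e, he⟩ hex⟩
  -- expand in eigenvectors
  set v : α → ℝ := fun e => x e / c e with hv
  have hcv : ∀ e, d e ≠ 0 → c e * v e = x e := fun e he => by
    simp only [hv]
    field_simp [hc0 e he]
  have hQx : x ⬝ᵥ Q *ᵥ x = v ⬝ᵥ A *ᵥ v := by
    rw [hvA, form_eq_sum, form_eq_sum]
    refine Finset.sum_congr rfl fun e _ => Finset.sum_congr rfl fun f _ => ?_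
    by_cases he : d e = 0
    · rw [hrow e he]; ring
    · by_cases hf : d f = 0
      · rw [← hQ.apply, hrow f hf]; ring
      · rw [hcv e he, hcv f hf]
  rw [hQx]
  set b := hAsymm.eigenvectorBasis with hb
  have hbe : ∀ i, A *ᵥ (b i).ofLp = hAsymm.eigenvalues i • (b i).ofLp := fun i =>
    hAsymm.mulVec_eigenvectorBasis i
  set a : α → ℝ := fun i => (b i).ofLp ⬝ᵥ v with ha
  have hexp : v = ∑ i, a i • (b i).ofLp := by
    have := b.sum_repr (WithLp.toLp 2 v)
    have h₁ := congrArg WithLp.ofLp this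
    rw [WithLp.ofLp_sum] at h₁
    rw [← show (WithLp.toLp 2 v).ofLp = v from rfl, ← h₁]
    refine Finset.sum_congr rfl fun i _ => ?_
    rw [WithLp.ofLp_smul]
    congr 1
    rw [b.repr_apply_apply, ha]
    simp [EuclideanSpace.inner_eq_star_dotProduct, dotProduct_comm]
  have hsum : v ⬝ᵥ A *ᵥ v = ∑ i, hAsymm.eigenvalues i * a i ^ 2 := by
    have : A *ᵥ v = ∑ i, (a i * hAsymm.eigenvalues i) • (b i).ofLp := by
      conv_lhs => rw [hexp]
      rw [mulVec_sum]
      refine Finset.sum_congr rfl fun i _ => ?_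
      rw [mulVec_smul, hbe, smul_smul]
    rw [this, dotProduct_sum]
    refine Finset.sum_congr rfl fun i _ => ?_
    rw [dotProduct_smul, dotProduct_comm, smul_eq_mul]
    simp only [ha]
    ring
  rw [hsum]
  refine Finset.sum_nonpos fun i _ => ?_
  rcases le_or_gt (hAsymm.eigenvalues i) 0 with hi | hi
  · exact mul_nonpos_of_nonpos_of_nonneg hi (sq_nonneg _)
  · obtain ⟨k, hk⟩ := heig (b i).ofLp _ (hbe i) (by
      intro h
      have h₁ := b.orthonormal.ne_zero i
      exact h₁ (by ext e; exact congrFun h e)) hi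
    -- Since the eigenvector is proportional to u after scaling, the coefficient of `v` along it is
    -- a multiple of Q(x,u) = 0.
    have : a i = k * (x ⬝ᵥ Q *ᵥ u) := by
      simp only [ha, dotProduct, Finset.mul_sum]
      refine Finset.sum_congr rfl fun e _ => ?_
      change (b i).ofLp e * v e = k * (x e * d e)
      by_cases he : d e = 0
      · have : c e = 0 := by simp [hc, he]
        simp [hv, this, he]
      · have h₁ := hk e he
        have h₂ : (b i).ofLp e = k * u e / c e := by
          rw [← h₁]
          field_simp [hc0 e he]
        have h₃ := hc2 e
        rw [h₂]
        simp only [hv]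
        have h₄ := hc0 e he
        have h₅ : u e = c e ^ 2 * d e := by rw [h₃]; field_simp
        rw [h₅]
        field_simp
    rw [this, hx]
    simp

/-- On the line x + t y, take the point that is orthogonal to u. It exists because Q(y,u) = 0 with y
≥ 0 and u > 0 would force Q(y,y) = 0. -/
theorem hyperbolic_of_bochner (hQ : Q.IsSymm) (h0 : ∀ e f, 0 ≤ Q e f) {u : α → ℝ}
    (hu : ∀ e, 0 < u e)
    (hB : ∀ x : α → ℝ, x ⬝ᵥ Q *ᵥ x ≤ ∑ e, u e / (Q *ᵥ u) e * (Q *ᵥ x) e ^ 2)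
    (hconn : ∀ e f, 0 < (Q *ᵥ u) e → 0 < (Q *ᵥ u) f →
      e = f ∨ 0 < Q e f ∨ ∃ g, 0 < Q e g ∧ 0 < Q g f) : Hyperbolic Q := by
  refine hyperbolic_of_exists hQ (fun x y hy hyy => ?_) h0
  have hyu : y ⬝ᵥ Q *ᵥ u ≠ 0 := by
    intro h
    have h₁ : ∀ e f, 0 ≤ y e * Q e f * u f := fun e f =>
      mul_nonneg (mul_nonneg (hy e) (h0 e f)) (hu f).le
    rw [form_eq_sum] at h hyy
    refine hyy.ne' (Finset.sum_eq_zero fun e _ => Finset.sum_eq_zero fun f _ => ?_)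
    have := (Finset.sum_eq_zero_iff_of_nonneg fun e _ =>
      Finset.sum_nonneg fun f _ => h₁ e f).1 h e (Finset.mem_univ e)
    have := (Finset.sum_eq_zero_iff_of_nonneg fun f _ => h₁ e f).1 this f (Finset.mem_univ f)
    rw [(mul_eq_zero.1 this).resolve_right (hu f).ne', zero_mul]
  refine ⟨-((x ⬝ᵥ Q *ᵥ u) / (y ⬝ᵥ Q *ᵥ u)), form_nonpos_of_bochner hQ h0 hu hB hconn _ ?_⟩
  rw [add_dotProduct, smul_dotProduct, smul_eq_mul]
  field_simp
  ring

end Bochner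

end MatroidForm

/-! ### The counting form of a matroid and its base case, the lines -/

namespace MatroidForm

open Matrix

variable {α : Type} [Fintype α]

/-! ### The polarized counting form of a matroid -/

open Classical in
/-- The sum of `u₁(e₁) ⋯ uₖ(eₖ)` over all sequences of distinct elements outside `I` that extend
`I` to an independent set. -/
noncomputable def countForm (M : Matroid α) : List (α → ℝ) → Set α → ℝ
  | [], I => if M.Indep I then 1 else 0
  | u :: L, I => ∑ e, if e ∈ I then 0 else u e * countForm M L (insert e I)

open Classical in
/-- The matrix of the bilinear form in the first two arguments of `countForm`. -/
noncomputable def pairMatrix (M : Matroid α) (L : List (α → ℝ)) (I : Set α) : Matrix α α ℝ :=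
  .of fun e f => if e ∈ I ∨ f ∈ I ∨ e = f then 0 else countForm M L (insert f (insert e I))

variable {M : Matroid α}

theorem countForm_cons_cons (x y : α → ℝ) (L : List (α → ℝ)) (I : Set α) :
    countForm M (x :: y :: L) I = x ⬝ᵥ pairMatrix M L I *ᵥ y := by
  rw [form_eq_sum]
  simp only [countForm, pairMatrix, of_apply]
  refine Finset.sum_congr rfl fun e _ => ?_
  by_cases he : e ∈ I
  · simp [he]
  · rw [if_neg he, Finset.mul_sum]
    refine Finset.sum_congr rfl fun f _ => ?_
    by_cases hf : f ∈ I
    · simp [hf]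
    · by_cases hef : e = f
      · simp [hef]
      · simp [he, hf, hef, Ne.symm hef]; ring

theorem pairMatrix_isSymm (L : List (α → ℝ)) (I : Set α) : (pairMatrix M L I).IsSymm := by
  ext e f
  simp only [transpose_apply, pairMatrix, of_apply]
  rw [Set.insert_comm]
  congr 1
  simp only [eq_comm (a := e), eq_iff_iff]
  tauto

theorem countForm_nonneg {L : List (α → ℝ)} (hL : ∀ u ∈ L, 0 ≤ u) (I : Set α) :
    0 ≤ countForm M L I := by
  classical
  induction L generalizing I with
  | nil => simp only [countForm]; split <;> norm_num
  | cons u L ih =>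
    simp only [List.mem_cons, forall_eq_or_imp] at hL
    refine Finset.sum_nonneg fun e _ => ?_
    split
    · rfl
    · exact mul_nonneg (hL.1 e) (ih hL.2 _)

theorem pairMatrix_nonneg {L : List (α → ℝ)} (hL : ∀ u ∈ L, 0 ≤ u) (I : Set α) (e f : α) :
    0 ≤ pairMatrix M L I e f := by
  simp only [pairMatrix, of_apply]
  split
  · rfl
  · exact countForm_nonneg hL _

theorem countForm_swap (x y : α → ℝ) (L : List (α → ℝ)) (I : Set α) :
    countForm M (x :: y :: L) I = countForm M (y :: x :: L) I := by
  rw [countForm_cons_cons, countForm_cons_cons, form_comm (pairMatrix_isSymm L I)]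

theorem countForm_perm {L L' : List (α → ℝ)} (h : L.Perm L') (I : Set α) :
    countForm M L I = countForm M L' I := by
  classical
  induction h generalizing I with
  | nil => rfl
  | cons u _ ih =>
    simp only [countForm]
    refine Finset.sum_congr rfl fun e _ => ?_
    rw [ih]
  | swap x y L => exact countForm_swap _ _ _ _
  | trans _ _ ih₁ ih₂ => rw [ih₁, ih₂]

theorem indep_of_countForm_ne_zero {L : List (α → ℝ)} {I : Set α} (h : countForm M L I ≠ 0) :
    ∃ J, M.Indep J ∧ I ⊆ J ∧ (J \ I).ncard = L.length := by
  classical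
  induction L generalizing I with
  | nil =>
    refine ⟨I, ?_, subset_rfl, by simp⟩
    by_contra hI
    exact h (if_neg hI)
  | cons u L ih =>
    obtain ⟨e, -, he⟩ := Finset.exists_ne_zero_of_sum_ne_zero h
    by_cases heI : e ∈ I
    · simp [heI] at he
    · rw [if_neg heI] at he
      obtain ⟨J, hJ, hIJ, hc⟩ := ih (right_ne_zero_of_mul he)
      refine ⟨J, hJ, (Set.subset_insert e I).trans hIJ, ?_⟩
      have h₁ : J \ I = insert e (J \ insert e I) := by
        ext f
        by_cases hf : f = e
        · subst hf
          simp [heI, hIJ (Set.mem_insert _ _)]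
        · simp [hf]
      rw [h₁, Set.ncard_insert_of_notMem (by simp), hc, List.length_cons]

theorem countForm_pos {L : List (α → ℝ)} (hL : ∀ u ∈ L, ∀ e, 0 < u e) {I J : Set α}
    (hJ : M.Indep J) (hIJ : I ⊆ J) (hc : (J \ I).ncard = L.length) : 0 < countForm M L I := by
  classical
  induction L generalizing I with
  | nil =>
    rw [List.length_nil, Set.ncard_eq_zero, Set.sdiff_eq_empty] at hc
    simp [countForm, hJ.subset hIJ]
  | cons u L ih =>
    simp only [List.mem_cons, forall_eq_or_imp] at hL
    have h₁ : (J \ I).Nonempty := by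
      rw [Set.nonempty_iff_ne_empty]
      intro h
      simp [h] at hc
    obtain ⟨e, heJ, heI⟩ := h₁
    refine Finset.sum_pos' (fun f _ => ?_) ⟨e, Finset.mem_univ e, ?_⟩
    · split
      · rfl
      · exact mul_nonneg (hL.1 f).le
          (countForm_nonneg (fun u hu e => (hL.2 u hu e).le) _)
    · rw [if_neg heI]
      refine mul_pos (hL.1 e) (ih hL.2 (Set.insert_subset heJ hIJ) ?_)
      have h₁ : J \ I = insert e (J \ insert e I) := by
        ext f
        by_cases hf : f = e
        · subst hf
          simp [heI, heJ]
        · simp [hf]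
      rw [h₁, Set.ncard_insert_of_notMem (by simp), List.length_cons] at hc
      omega

/-! ### Lines through an independent set -/

/-- The element `e` is not a loop of the contraction by `I`. -/
def Extends (M : Matroid α) (I : Set α) (e : α) : Prop := e ∉ I ∧ M.Indep (insert e I)

theorem extends_iff (hE : M.E = Set.univ) {I : Set α} (hI : M.Indep I) {e : α} :
    Extends M I e ↔ e ∉ M.closure I := by
  rw [Extends, hI.notMem_closure_iff (by rw [hE]; trivial), and_comm]

theorem Extends.mem_closure {I : Set α} {e : α} (h : Extends M I e) :
    e ∈ M.closure (insert e I) :=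
  M.subset_closure _ h.2.subset_ground (Set.mem_insert e I)

theorem Extends.closure_eq_iff (hE : M.E = Set.univ) {I : Set α} {e f : α} (he : Extends M I e)
    (hf : Extends M I f) :
    M.closure (insert e I) = M.closure (insert f I) ↔ f ∈ M.closure (insert e I) := by
  refine ⟨fun h => h ▸ hf.mem_closure, fun h => ?_⟩
  have hI := he.2.subset (Set.subset_insert e I)
  exact (Matroid.closure_insert_congr ⟨h, (extends_iff hE hI).1 hf⟩).symm

/-- In the contraction by `I`, two elements are independent exactly if they are nonloops in
different parallel classes. -/
theorem indep_insert_insert_iff (hE : M.E = Set.univ) {I : Set α} {e f : α} :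
    (e ∉ I ∧ f ∉ I ∧ e ≠ f ∧ M.Indep (insert f (insert e I))) ↔
      Extends M I e ∧ Extends M I f ∧ M.closure (insert e I) ≠ M.closure (insert f I) := by
  constructor
  · rintro ⟨he, hf, hef, h⟩
    have he' : Extends M I e := ⟨he, h.subset (Set.subset_insert _ _)⟩
    have hf' : Extends M I f := ⟨hf, h.subset (Set.insert_subset_insert (Set.subset_insert _ _))⟩
    refine ⟨he', hf', ?_⟩
    rw [Ne, he'.closure_eq_iff hE hf', he'.2.mem_closure_iff' ]
    simp [h, Ne.symm hef, hf, hE]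
  · rintro ⟨he, hf, h⟩
    rw [Ne, he.closure_eq_iff hE hf, he.2.notMem_closure_iff (by rw [hE]; trivial)] at h
    exact ⟨he.1, hf.1, fun hef => h.2 (by simp [hef]), h.1⟩

open Classical in
/-- The sum of the entries of `x` on a line through `I`. -/
noncomputable def lineSum (M : Matroid α) (I : Set α) (x : α → ℝ) (F : Set α) : ℝ :=
  ∑ e, if Extends M I e ∧ M.closure (insert e I) = F then x e else 0

theorem lineSum_add_smul (I : Set α) (x y : α → ℝ) (t : ℝ) (F : Set α) :
    lineSum M I (x + t • y) F = lineSum M I x F + t * lineSum M I y F := by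
  classical
  simp only [lineSum, Finset.mul_sum, ← Finset.sum_add_distrib]
  refine Finset.sum_congr rfl fun e _ => ?_
  split <;> simp

-- Only pairs of elements on different lines contribute: all pairs of nonloops, minus the pairs on a
-- common line.
open Classical in
theorem form_nil (hE : M.E = Set.univ) (I : Set α) (x y : α → ℝ) :
    x ⬝ᵥ pairMatrix M [] I *ᵥ y =
      (∑ F, lineSum M I x F) * (∑ F, lineSum M I y F) - ∑ F, lineSum M I x F * lineSum M I y F := by
  have h₁ : ∀ z : α → ℝ, ∑ F, lineSum M I z F = ∑ e, if Extends M I e then z e else 0 := by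
    intro z
    simp only [lineSum]
    rw [Finset.sum_comm]
    refine Finset.sum_congr rfl fun e _ => ?_
    by_cases he : Extends M I e <;> simp [he]
  have h₂ : ∑ F, lineSum M I x F * lineSum M I y F = ∑ e, ∑ f,
      if Extends M I e ∧ Extends M I f ∧ M.closure (insert e I) = M.closure (insert f I) then
        x e * y f else 0 := by
    simp only [lineSum, Finset.sum_mul_sum]
    rw [Finset.sum_comm]
    refine Finset.sum_congr rfl fun e _ => ?_
    rw [Finset.sum_comm]
    refine Finset.sum_congr rfl fun f _ => ?_
    rw [Finset.sum_eq_single (M.closure (insert f I))]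
    · by_cases he : Extends M I e <;> by_cases hf : Extends M I f <;> simp [he, hf]
    · intro F _ hF
      rw [if_neg (c := Extends M I f ∧ _) (fun h => hF h.2.symm), mul_zero]
    · simp
  rw [form_eq_sum, h₁, h₁, h₂, Finset.sum_mul_sum, ← Finset.sum_sub_distrib]
  refine Finset.sum_congr rfl fun e _ => ?_
  rw [← Finset.sum_sub_distrib]
  refine Finset.sum_congr rfl fun f _ => ?_
  have h₃ : pairMatrix M [] I e f = if Extends M I e ∧ Extends M I f ∧
      M.closure (insert e I) ≠ M.closure (insert f I) then 1 else 0 := by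
    simp only [← indep_insert_insert_iff hE, pairMatrix, of_apply, countForm]
    by_cases h₁ : e ∈ I <;> by_cases h₂ : f ∈ I <;> by_cases h₃ : e = f <;> simp [h₁, h₂, h₃]
  rw [h₃]
  by_cases he : Extends M I e <;> by_cases hf : Extends M I f <;>
    by_cases hef : M.closure (insert e I) = M.closure (insert f I) <;> simp [he, hf, hef]

/-- Choose t such that the total of x + t y over all lines vanishes; what remains is minus a sum of
squares. -/
theorem hyperbolic_nil (hE : M.E = Set.univ) (I : Set α) : Hyperbolic (pairMatrix M [] I) := by
  classical
  refine hyperbolic_of_exists (pairMatrix_isSymm _ _) (fun x y hy hyy => ?_)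
    (pairMatrix_nonneg (by simp) I)
  have hy0 : ∑ F, lineSum M I y F ≠ 0 := by
    intro h
    rw [form_nil hE, h, zero_mul, zero_sub] at hyy
    have : 0 ≤ ∑ F, lineSum M I y F * lineSum M I y F :=
      Finset.sum_nonneg fun F _ => mul_self_nonneg _
    linarith
  refine ⟨-((∑ F, lineSum M I x F) / ∑ F, lineSum M I y F), ?_⟩
  set t := -((∑ F, lineSum M I x F) / ∑ F, lineSum M I y F) with ht
  have h0 : ∑ F, lineSum M I (x + t • y) F = 0 := by
    simp only [lineSum_add_smul, Finset.sum_add_distrib, ← Finset.mul_sum]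
    rw [ht]
    field_simp
    ring
  rw [form_nil hE, h0, zero_mul, zero_sub, neg_nonpos]
  exact Finset.sum_nonneg fun F _ => mul_self_nonneg _

/-! ### Hyperbolicity -/

/-- Repeated augmentation from `J`. That `B` stays inside A ∪ J is what later controls its number of
elements outside `R`. -/
theorem exists_indep_superset {A J : Set α} (hA : M.Indep A) (hJ : M.Indep J)
    (h : A.ncard ≤ J.ncard) : ∃ B, M.Indep B ∧ A ⊆ B ∧ B ⊆ A ∪ J ∧ B.ncard = J.ncard := by
  obtain ⟨k, hk⟩ := Nat.exists_eq_add_of_le h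
  induction k generalizing A with
  | zero => exact ⟨A, hA, subset_rfl, Set.subset_union_left, by omega⟩
  | succ k ih =>
    obtain ⟨e, he, hAe⟩ := hA.augment hJ (by
      rw [← A.toFinite.cast_ncard_eq, ← J.toFinite.cast_ncard_eq]
      exact_mod_cast (by omega))
    have hc : (insert e A).ncard = A.ncard + 1 := Set.ncard_insert_of_notMem he.2
    obtain ⟨B, hB, hAB, hBJ, hBc⟩ := ih hAe (by omega) (by omega)
    refine ⟨B, hB, (Set.subset_insert _ _).trans hAB, hBJ.trans ?_, hBc⟩
    rw [Set.insert_union]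
    exact Set.insert_subset (Or.inr he.1) subset_rfl

theorem ncard_diff_of_subset {I J : Set α} (h : I ⊆ J) : (J \ I).ncard = J.ncard - I.ncard :=
  Set.ncard_sdiff h I.toFinite

end MatroidForm

/-! ### Hyperbolicity of the counting form, and counting by colours -/

namespace MatroidForm

open Matrix

variable {α : Type} [Fintype α] {M : Matroid α}

/-- By symmetry the fixed vector `u` can change places with a free argument. Row e of the form over
`I` becomes a value of the form over I + e, which links the form to its contractions. -/
theorem pairMatrix_cons_mulVec [DecidableEq α] (u y : α → ℝ) (L : List (α → ℝ)) (I : Set α) (e : α)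
    [Decidable (e ∈ I)] :
    (pairMatrix M (u :: L) I *ᵥ y) e =
      if e ∈ I then 0 else y ⬝ᵥ pairMatrix M L (insert e I) *ᵥ u := by
  classical
  have h := countForm_cons_cons (M := M) (Pi.single e 1) y (u :: L) I
  rw [single_one_dotProduct] at h
  rw [← h, countForm, Finset.sum_eq_single e]
  · rw [countForm_cons_cons]
    by_cases he : e ∈ I <;> simp [he]
  · intro f _ hf
    simp [Pi.single_eq_of_ne hf]
  · simp

theorem form_cons (x y u : α → ℝ) (L : List (α → ℝ)) (I : Set α) [DecidablePred (· ∈ I)] :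
    x ⬝ᵥ pairMatrix M (u :: L) I *ᵥ y =
      ∑ e, if e ∈ I then 0 else u e * (x ⬝ᵥ pairMatrix M L (insert e I) *ᵥ y) := by
  classical
  have h : List.Perm (x :: y :: u :: L) (u :: x :: y :: L) :=
    (List.Perm.cons x (List.Perm.swap u y L)).trans (List.Perm.swap u x _)
  rw [← countForm_cons_cons, countForm_perm h, countForm]
  refine Finset.sum_congr rfl fun e _ => ?_
  rw [countForm_cons_cons]
  congr

theorem pairMatrix_pos {L : List (α → ℝ)} (hL : ∀ u ∈ L, ∀ e, 0 < u e) {I J : Set α} {e f : α}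
    (he : e ∉ I) (hf : f ∉ I) (hef : e ≠ f) (h : M.Indep (insert f (insert e I)))
    (hJ : M.Indep J) (hc : J.ncard = I.ncard + 2 + L.length) : 0 < pairMatrix M L I e f := by
  have h₁ : (insert f (insert e I)).ncard = I.ncard + 2 := by
    rw [Set.ncard_insert_of_notMem, Set.ncard_insert_of_notMem he]
    simp [hf, Ne.symm hef]
  obtain ⟨B, hB, hAB, -, hBc⟩ := exists_indep_superset h hJ (by omega)
  simp only [pairMatrix, of_apply, he, hf, hef, or_self, if_false]
  exact countForm_pos hL hB hAB (by rw [ncard_diff_of_subset hAB]; omega)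

/-- With T_e the form over I + e, one has Q = Σ u_e T_e and (Qx)_e = T_e(x,u). The induction
hypothesis T_e(x,x) T_e(u,u) ≤ T_e(x,u)² summed with weights u_e is the Bochner inequality. Strict
positivity of the vectors makes the support of `Q` depend on the matroid only, as the Perron
argument requires. -/
theorem hyperbolic_of_pos (hE : M.E = Set.univ) {L : List (α → ℝ)} (hL : ∀ u ∈ L, ∀ e, 0 < u e)
    (I : Set α) : Hyperbolic (pairMatrix M L I) := by
  classical
  induction L generalizing I with
  | nil => exact hyperbolic_nil hE I
  | cons u L ih =>
    have hL' := hL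
    simp only [List.mem_cons, forall_eq_or_imp] at hL
    obtain ⟨hu, hL⟩ := hL
    have h0 : ∀ I e f, 0 ≤ pairMatrix M L I e f :=
      pairMatrix_nonneg fun u hu e => (hL u hu e).le
    refine hyperbolic_of_bochner (pairMatrix_isSymm _ _)
      (pairMatrix_nonneg (fun u hu e => (hL' u hu e).le) I) hu (fun x => ?_) (fun e f he hf => ?_)
    · rw [form_cons]
      refine Finset.sum_le_sum fun e _ => ?_
      rw [pairMatrix_cons_mulVec, pairMatrix_cons_mulVec]
      by_cases he : e ∈ I
      · simp [he]
      · simp only [he, if_false]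
        set T := pairMatrix M L (insert e I) with hT
        have hd : 0 ≤ u ⬝ᵥ T *ᵥ u := form_nonneg (h0 _) (fun e => (hu e).le) (fun e => (hu e).le)
        rcases hd.eq_or_lt with h | h
        · have : T = 0 := eq_zero_of_form_eq_zero (h0 _) hu h.symm
          simp [this]
        · have h₁ := ih hL (insert e I) x u (fun e => (hu e).le)
          rw [div_mul_eq_mul_div, mul_div_assoc]
          refine mul_le_mul_of_nonneg_left ?_ (hu e).le
          rw [le_div_iff₀ h]
          exact h₁
    · have key : ∀ e, 0 < (pairMatrix M (u :: L) I *ᵥ u) e → e ∉ I ∧ ∃ J, M.Indep J ∧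
          insert e I ⊆ J ∧ J.ncard = I.ncard + 2 + (u :: L).length := by
        intro e he
        rw [pairMatrix_cons_mulVec] at he
        by_cases heI : e ∈ I
        · simp [heI] at he
        · rw [if_neg heI, ← countForm_cons_cons] at he
          obtain ⟨J, hJ, hIJ, hc⟩ := indep_of_countForm_ne_zero he.ne'
          refine ⟨heI, J, hJ, hIJ, ?_⟩
          have h₁ := ncard_diff_of_subset hIJ
          have h₂ := Set.ncard_le_ncard hIJ J.toFinite
          rw [Set.ncard_insert_of_notMem heI] at h₁ h₂
          simp only [List.length_cons] at hc ⊢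
          omega
      obtain ⟨heI, J, hJ, hIJ, hc⟩ := key e he
      obtain ⟨hfI, J', hJ', hIJ', hc'⟩ := key f hf
      have hee : Extends M I e := ⟨heI, hJ.subset hIJ⟩
      have hff : Extends M I f := ⟨hfI, hJ'.subset hIJ'⟩
      by_cases hef : e = f
      · exact .inl hef
      refine .inr ?_
      by_cases hcl : M.closure (insert e I) = M.closure (insert f I)
      -- Elements on a common line do not see each other. They are joined through any `g` off this
      -- line, and such a `g` exists because an independent set of size at least |I| + 3 contains I
      -- + e.
      · right
        obtain ⟨g, hgJ, hg⟩ : ∃ g ∈ J, g ∉ insert e I := by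
          by_contra! hcon
          have := Set.ncard_le_ncard (show J ⊆ insert e I from hcon) (Set.toFinite _)
          rw [Set.ncard_insert_of_notMem heI, hc] at this
          simp only [List.length_cons] at this
          omega
        have hg' : g ≠ e ∧ g ∉ I := by simpa using hg
        have h₁ : M.Indep (insert g (insert e I)) := hJ.subset (Set.insert_subset hgJ hIJ)
        obtain ⟨-, hgg, hne⟩ := (indep_insert_insert_iff hE).1 ⟨heI, hg'.2, Ne.symm hg'.1, h₁⟩
        rw [hcl] at hne
        obtain ⟨-, -, hfg, h₂⟩ := (indep_insert_insert_iff hE).2 ⟨hff, hgg, hne⟩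
        refine ⟨g, pairMatrix_pos hL' heI hg'.2 (Ne.symm hg'.1) h₁ hJ hc, ?_⟩
        rw [← (pairMatrix_isSymm _ _).apply]
        exact pairMatrix_pos hL' hfI hg'.2 hfg h₂ hJ hc
      · left
        obtain ⟨-, -, -, h₂⟩ := (indep_insert_insert_iff hE).2 ⟨hee, hff, hcl⟩
        exact pairMatrix_pos hL' heI hfI hef h₂ hJ hc

theorem continuous_countForm (L L' : List (α → ℝ)) (I : Set α) :
    Continuous fun t : ℝ => countForm M (L' ++ L.map fun u e => u e + t) I := by
  classical
  induction L' generalizing I with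
  | nil =>
    induction L generalizing I with
    | nil => exact continuous_const
    | cons u L ih =>
      simp only [List.nil_append, List.map_cons, countForm] at ih ⊢
      refine continuous_finsetSum _ fun e _ => ?_
      by_cases he : e ∈ I
      · simp only [he, if_true]
        exact continuous_const
      · simp only [he, if_false]
        exact (continuous_const.add continuous_id).mul (ih _)
  | cons u L' ih =>
    simp only [List.cons_append, countForm]
    refine continuous_finsetSum _ fun e _ => ?_
    by_cases he : e ∈ I
    · simp only [he, if_true]
      exact continuous_const
    · simp only [he, if_false]
      exact continuous_const.mul (ih _)

/-- The reverse Cauchy–Schwarz inequality for the counting form of a matroid. -/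
theorem hyperbolic (hE : M.E = Set.univ) {L : List (α → ℝ)} (hL : ∀ u ∈ L, 0 ≤ u) (I : Set α) :
    Hyperbolic (pairMatrix M L I) := by
  intro x y hy
  -- Adding t > 0 to all entries of the fixed vectors gives the strictly positive case; then t tends
  -- to 0.
  have hc : ∀ x y : α → ℝ, Filter.Tendsto
      (fun t : ℝ => x ⬝ᵥ pairMatrix M (L.map fun u e => u e + t) I *ᵥ y)
      (nhdsWithin 0 (Set.Ioi 0)) (nhds (x ⬝ᵥ pairMatrix M L I *ᵥ y)) := by
    intro x y
    have h := (continuous_countForm (M := M) L [x, y] I).tendsto 0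
    simp only [List.cons_append, List.nil_append, countForm_cons_cons, add_zero, List.map_id'] at h
    exact h.mono_left nhdsWithin_le_nhds
  refine le_of_tendsto_of_tendsto ((hc x x).mul (hc y y)) ((hc x y).pow 2) ?_
  filter_upwards [self_mem_nhdsWithin] with t ht
  refine hyperbolic_of_pos hE ?_ I x y hy
  intro u hu e
  obtain ⟨v, hv, rfl⟩ := List.mem_map.1 hu
  exact add_pos_of_nonneg_of_pos (hL v hv e) ht

/-! ### Counting independent sets with a given number of elements of a set -/

/-- The independent set `J` contains `I`, and `J \ I` has `i` elements in `R` and `j` elements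
outside `R`. -/
structure Completes (M : Matroid α) (R I : Set α) (i j : ℕ) (J : Set α) : Prop where
  indep : M.Indep J
  subset : I ⊆ J
  ncard_inter : ((J \ I) ∩ R).ncard = i
  ncard_compl : ((J \ I) ∩ Rᶜ).ncard = j

variable {R I J : Set α} {i j : ℕ}

theorem completes_compl : Completes M Rᶜ I i j J ↔ Completes M R I j i J := by
  constructor
  · rintro ⟨h₁, h₂, h₃, h₄⟩
    exact ⟨h₁, h₂, by rwa [compl_compl] at h₄, h₃⟩
  · rintro ⟨h₁, h₂, h₃, h₄⟩
    exact ⟨h₁, h₂, h₄, by rwa [compl_compl]⟩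

theorem completes_insert {e : α} (heR : e ∈ R) (heI : e ∉ I) :
    Completes M R (insert e I) i j J ↔ Completes M R I (i + 1) j J ∧ e ∈ J := by
  by_cases heJ : e ∈ J
  · have h₁ : (J \ I) ∩ R = insert e ((J \ insert e I) ∩ R) := by
      ext f
      by_cases hf : f = e
      · subst hf; simp [heI, heJ, heR]
      · simp [hf]
    have h₂ : (J \ I) ∩ Rᶜ = (J \ insert e I) ∩ Rᶜ := by
      ext f
      by_cases hf : f = e
      · subst hf; simp [heR]
      · simp [hf]
    constructor
    · rintro ⟨a, b, c, d⟩
      refine ⟨⟨a, (Set.subset_insert _ _).trans b, ?_, by rw [h₂, d]⟩, heJ⟩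
      rw [h₁, Set.ncard_insert_of_notMem (by simp), c]
    · rintro ⟨⟨a, b, c, d⟩, -⟩
      refine ⟨a, Set.insert_subset heJ b, ?_, by rw [← h₂, d]⟩
      rw [h₁, Set.ncard_insert_of_notMem (by simp)] at c
      omega
  · exact iff_of_false (fun h => heJ (h.subset (Set.mem_insert _ _))) (fun h => heJ h.2)

/-- The list of `i` copies of the indicator of `R` and `j` copies of the indicator of its
complement. -/
noncomputable def colorList (R : Set α) (i j : ℕ) : List (α → ℝ) :=
  List.replicate i (R.indicator 1) ++ List.replicate j (Rᶜ.indicator 1)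

theorem colorList_succ (R : Set α) (i j : ℕ) :
    colorList R (i + 1) j = R.indicator 1 :: colorList R i j := by
  simp [colorList, List.replicate_succ]

theorem colorList_compl_perm (R : Set α) (i j : ℕ) : (colorList Rᶜ j i).Perm (colorList R i j) := by
  simp only [colorList, compl_compl]
  exact List.perm_append_comm

theorem colorList_nonneg : ∀ u ∈ colorList R i j, 0 ≤ u := by
  intro u hu
  simp only [colorList, List.mem_append, List.mem_replicate] at hu
  rcases hu with ⟨-, rfl⟩ | ⟨-, rfl⟩ <;> exact Set.indicator_nonneg fun _ _ => zero_le_one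

/-- Each set J arises from i! j! sequences of the prescribed colours. Removing the first vector 1_R
counts pairs of a set J and an element of (J \ I) ∩ R, which gives the factor i + 1. -/
theorem countForm_colorList (R I : Set α) (i j : ℕ) :
    countForm M (colorList R i j) I = i.factorial * j.factorial *
      ({J | Completes M R I i j J}.ncard : ℝ) := by
  classical
  have step : ∀ (R : Set α) (j : ℕ), (∀ I, countForm M (colorList R 0 j) I =
      Nat.factorial 0 * j.factorial * ({J | Completes M R I 0 j J}.ncard : ℝ)) → ∀ i I,
      countForm M (colorList R i j) I =
        i.factorial * j.factorial * ({J | Completes M R I i j J}.ncard : ℝ) := by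
    intro R j h0 i
    induction i with
    | zero => exact h0
    | succ i ih =>
      intro I
      have hcard : ∀ p : Set α → Prop, ({J | p J}.ncard : ℝ) = ∑ J, if p J then 1 else 0 := by
        intro p
        rw [Set.ncard_eq_toFinset_card', Finset.sum_boole]
        simp
      have h₁ : ∑ e, (if e ∈ I then 0 else R.indicator (1 : α → ℝ) e *
          ({J | Completes M R (insert e I) i j J}.ncard : ℝ)) =
          (i + 1 : ℝ) * ({J | Completes M R I (i + 1) j J}.ncard : ℝ) := by
        simp only [hcard]
        calc _ = ∑ e, ∑ J, if Completes M R I (i + 1) j J ∧ e ∈ (J \ I) ∩ R then (1 : ℝ) else 0 := by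
              refine Finset.sum_congr rfl fun e _ => ?_
              by_cases heI : e ∈ I
              · simp [heI]
              · by_cases heR : e ∈ R
                · simp [heI, heR, completes_insert heR heI]
                · simp [heR]
          _ = _ := by
              rw [Finset.sum_comm, Finset.mul_sum]
              refine Finset.sum_congr rfl fun J _ => ?_
              by_cases hJ : Completes M R I (i + 1) j J
              · simp only [hJ, true_and, if_true, mul_one]
                rw [Finset.sum_boole, ← Nat.cast_succ, Nat.succ_eq_add_one, ← hJ.ncard_inter,
                  Set.ncard_eq_toFinset_card']
                congr 2
                ext; simp
              · simp [hJ]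
      rw [colorList_succ, countForm, Nat.factorial_succ]
      simp only [ih]
      calc _ = (i.factorial * j.factorial : ℝ) * ∑ e, (if e ∈ I then 0 else
            R.indicator (1 : α → ℝ) e *
            ({J | Completes M R (insert e I) i j J}.ncard : ℝ)) := by
            rw [Finset.mul_sum]
            refine Finset.sum_congr rfl fun e _ => ?_
            split
            · simp
            · ring
        _ = _ := by
            rw [h₁]
            push_cast
            ring
  have base : ∀ (R I : Set α), countForm M (colorList R 0 0) I =
      Nat.factorial 0 * Nat.factorial 0 * ({J | Completes M R I 0 0 J}.ncard : ℝ) := by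
    intro R I
    have h : {J | Completes M R I 0 0 J} = {J | J = I ∧ M.Indep I} := by
      ext J
      simp only [Set.mem_ofPred_eq]
      constructor
      · rintro ⟨h₁, h₂, h₃, h₄⟩
        rw [Set.ncard_eq_zero] at h₃ h₄
        have : J \ I = ∅ := by
          rw [← Set.inter_union_compl (J \ I) R, h₃, h₄, Set.union_empty]
        have hJI : J = I := (Set.sdiff_eq_empty.1 this).antisymm h₂
        exact ⟨hJI, hJI ▸ h₁⟩
      · rintro ⟨rfl, h⟩
        exact ⟨h, subset_rfl, by simp, by simp⟩
    rw [h]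
    by_cases hI : M.Indep I <;> simp [colorList, countForm, hI]
  refine step R j (fun I => ?_) i I
  -- Exchanging `R` and its complement reuses the same induction for the second colour.
  have h := step Rᶜ 0 (base Rᶜ) j I
  rw [countForm_perm (colorList_compl_perm R 0 j)] at h
  rw [h]
  simp only [completes_compl]
  ring

end MatroidForm

/-! ### Interpolation and the descent of kernels to contractions -/

namespace MatroidForm

open Matrix

variable {α : Type} [Fintype α] {M : Matroid α} {R I J : Set α} {i j : ℕ}

/-! ### Interpolation between independent sets -/

theorem Completes.ncard (h : Completes M R I i j J) : J.ncard = I.ncard + i + j := by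
  have h₁ := Set.ncard_inter_add_ncard_sdiff_eq_ncard (J \ I) R (Set.toFinite _)
  rw [show (J \ I) \ R = (J \ I) ∩ Rᶜ from rfl, h.ncard_inter, h.ncard_compl] at h₁
  have h₂ := ncard_diff_of_subset h.subset
  have h₃ := Set.ncard_le_ncard h.subset J.toFinite
  omega

theorem completes_self (hJ : M.Indep J) (hIJ : I ⊆ J) :
    Completes M R I ((J \ I) ∩ R).ncard ((J \ I) ∩ Rᶜ).ncard J :=
  ⟨hJ, hIJ, rfl, rfl⟩

/-- Exchange elements of J₁ one by one for elements of J₂. Each exchange raises the number of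
elements in `R` by at most one and brings J₁ closer to J₂. No value is skipped on the way up,
although the number may also fall in between. -/
theorem Completes.interpolate {J₁ J₂ : Set α} {i' j' t : ℕ} (h₁ : Completes M R I i j J₁)
    (h₂ : Completes M R I i' j' J₂) (hij : i + j = i' + j') (hi : i ≤ t) (hi' : t ≤ i') :
    ∃ J, Completes M R I t (i + j - t) J := by
  induction hn : (J₁ \ J₂).ncard using Nat.strong_induction_on generalizing J₁ i j with
  | _ n ih =>
    rcases hi.eq_or_lt with rfl | hlt
    · exact ⟨J₁, by rwa [Nat.add_sub_cancel_left]⟩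
    have hc₁ := h₁.ncard
    have hc₂ := h₂.ncard
    obtain ⟨e, he₁, he₂⟩ : ∃ e ∈ J₁, e ∉ J₂ := by
      by_contra! hcon
      have : J₁ = J₂ := Set.eq_of_subset_of_ncard_le hcon (by omega) J₂.toFinite
      subst this
      have := h₁.ncard_inter
      have := h₂.ncard_inter
      omega
    have hce := Set.ncard_sdiff_singleton_add_one he₁ J₁.toFinite
    obtain ⟨f, hf, hJ₃⟩ := (h₁.indep.subset (Set.sdiff_subset (t := {e}))).augment h₂.indep (by
      rw [← (J₁ \ {e}).toFinite.cast_ncard_eq, ← J₂.toFinite.cast_ncard_eq]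
      exact_mod_cast (by omega))
    have hfe : f ≠ e := fun h => he₂ (h ▸ hf.1)
    have hf₁ : f ∉ J₁ := fun h => hf.2 ⟨h, hfe⟩
    set J₃ := insert f (J₁ \ {e}) with hJ₃'
    have hIJ₃ : I ⊆ J₃ := fun x hx => Or.inr ⟨h₁.subset hx, fun hxe => he₂ (hxe ▸ h₂.subset hx)⟩
    have h₃ := completes_self (R := R) hJ₃ hIJ₃
    have hc₃ : J₃.ncard = J₁.ncard := by
      rw [hJ₃', Set.ncard_insert_of_notMem hf.2, hce]
    have hi₃ : ((J₃ \ I) ∩ R).ncard ≤ i + 1 := by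
      rw [← h₁.ncard_inter]
      refine (Set.ncard_le_ncard ?_ (Set.toFinite _)).trans (Set.ncard_insert_le f _)
      rintro x ⟨⟨rfl | hx, hxI⟩, hxR⟩
      · exact Or.inl rfl
      · exact Or.inr ⟨⟨hx.1, hxI⟩, hxR⟩
    have hc := h₃.ncard
    have hlt' : (J₃ \ J₂).ncard < n := by
      rw [← hn]
      refine Set.ncard_lt_ncard ⟨?_, fun h => ?_⟩ (Set.toFinite _)
      · rintro x ⟨rfl | hx, hx₂⟩
        · exact absurd hf.1 hx₂
        · exact ⟨hx.1, hx₂⟩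
      · rcases (h ⟨he₁, he₂⟩).1 with h | h
        · exact hfe h.symm
        · exact h.2 rfl
    obtain ⟨K, hK⟩ := ih _ hlt' h₃ (by omega) (by omega) rfl
    exact ⟨K, by
      have : i + j = ((J₃ \ I) ∩ R).ncard + ((J₃ \ I) ∩ Rᶜ).ncard := by omega
      rwa [this]⟩

theorem countForm_colorList_pos :
    0 < countForm M (colorList R i j) I ↔ ∃ J, Completes M R I i j J := by
  rw [countForm_colorList]
  have : (0 : ℝ) < i.factorial * j.factorial := by positivity
  rw [mul_pos_iff_of_pos_left this, Nat.cast_pos, Set.ncard_pos]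
  rfl

theorem countForm_colorList_nonneg : 0 ≤ countForm M (colorList R i j) I :=
  countForm_nonneg colorList_nonneg I

theorem form_inter_inter : R.indicator 1 ⬝ᵥ pairMatrix M (colorList R i j) I *ᵥ R.indicator 1 =
    countForm M (colorList R (i + 2) j) I := by
  rw [← countForm_cons_cons, colorList_succ, colorList_succ]

theorem pairMatrix_perm {L L' : List (α → ℝ)} (h : L.Perm L') (I : Set α) :
    pairMatrix M L I = pairMatrix M L' I := by
  ext e f
  simp only [pairMatrix, of_apply, countForm_perm h]

theorem form_compl_compl : Rᶜ.indicator 1 ⬝ᵥ pairMatrix M (colorList R i j) I *ᵥ Rᶜ.indicator 1 =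
    countForm M (colorList R i (j + 2)) I := by
  rw [← pairMatrix_perm (colorList_compl_perm R i j), form_inter_inter,
    countForm_perm (colorList_compl_perm R i (j + 2))]

theorem form_inter_compl : R.indicator 1 ⬝ᵥ pairMatrix M (colorList R i j) I *ᵥ Rᶜ.indicator 1 =
    countForm M (colorList R (i + 1) (j + 1)) I := by
  rw [← countForm_cons_cons, colorList_succ]
  refine countForm_perm (List.Perm.cons _ ?_) I
  rw [← List.Perm.congr_left (List.Perm.cons _ (colorList_compl_perm R i j)), ← colorList_succ]
  exact colorList_compl_perm R i (j + 1)

/-! ### Kernels -/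

/-- The vector `a 1_R - b 1_{Rᶜ}` is in the kernel of the form given by `i` copies of `1_R` and `j`
copies of `1_{Rᶜ}`. -/
def InKernel (M : Matroid α) (R I : Set α) (i j : ℕ) (a b : ℝ) : Prop :=
  ∀ x : α → ℝ, (a • R.indicator 1 + (-b) • Rᶜ.indicator 1) ⬝ᵥ
    pairMatrix M (colorList R i j) I *ᵥ x = 0

variable {a b : ℝ}

theorem inKernel_compl : InKernel M Rᶜ I j i b a ↔ InKernel M R I i j a b := by
  have h : (b • Rᶜ.indicator (1 : α → ℝ) + (-a) • Rᶜᶜ.indicator 1) =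
      -(a • R.indicator 1 + (-b) • Rᶜ.indicator 1) := by
    rw [compl_compl, neg_smul, neg_smul]
    abel
  simp only [InKernel, h, neg_dotProduct, neg_eq_zero, pairMatrix_perm (colorList_compl_perm R i j)]

theorem InKernel.left (h : InKernel M R I i j a b) :
    a * countForm M (colorList R (i + 2) j) I =
      b * countForm M (colorList R (i + 1) (j + 1)) I := by
  have := h (R.indicator 1)
  rw [add_dotProduct, smul_dotProduct, smul_dotProduct,
    form_comm (pairMatrix_isSymm _ _) (Rᶜ.indicator 1), form_inter_inter, form_inter_compl,
    smul_eq_mul, smul_eq_mul] at this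
  linarith

theorem InKernel.right (h : InKernel M R I i j a b) :
    a * countForm M (colorList R (i + 1) (j + 1)) I =
      b * countForm M (colorList R i (j + 2)) I := by
  have := h (Rᶜ.indicator 1)
  rw [add_dotProduct, smul_dotProduct, smul_dotProduct, form_compl_compl, form_inter_compl,
    smul_eq_mul, smul_eq_mul] at this
  linarith

/-- Write Q = Σ T_e over e in `R`, with T_e the form over I + e. The kernel property of z gives
T_e(z,1_R) = (Qz)_e = 0, hence T_e(z,z) ≤ 0 by hyperbolicity. The sum of these values is Q(z,z) = 0,
so each of them is 0, and an isotropic vector orthogonal to a positive one lies in the kernel. The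
delicate point is that T_e(1_R,1_R) may vanish; then T_e is shown to be zero. -/
theorem InKernel.insert_of_mem (hE : M.E = Set.univ) (ha : 0 < a) (hb : 0 < b)
    (h : InKernel M R I (i + 1) j a b) {e : α} (heR : e ∈ R) (heI : e ∉ I) :
    InKernel M R (insert e I) i j a b := by
  classical
  set z := a • R.indicator (1 : α → ℝ) + (-b) • Rᶜ.indicator 1 with hz
  set r := R.indicator (1 : α → ℝ) with hr
  set s := Rᶜ.indicator (1 : α → ℝ) with hs
  let T := fun e => pairMatrix M (colorList R i j) (insert e I)
  have hT : ∀ e, (T e).IsSymm := fun e => pairMatrix_isSymm _ _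
  have hT0 : ∀ e, Hyperbolic (T e) := fun e => hyperbolic hE colorList_nonneg _
  have hr0 : 0 ≤ r := Set.indicator_nonneg fun _ _ => zero_le_one
  have h₁ : ∀ e ∉ I, z ⬝ᵥ T e *ᵥ r = 0 := by
    intro e he
    have h₂ := h (Pi.single e 1)
    rw [form_comm (pairMatrix_isSymm _ _), single_one_dotProduct, colorList_succ,
      pairMatrix_cons_mulVec, if_neg he] at h₂
    exact h₂
  -- a form that does not vanish is positive at `r`
  have h₂ : ∀ e ∈ R, e ∉ I → r ⬝ᵥ T e *ᵥ r = 0 → T e = 0 := by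
    intro e heR heI hrr
    have hrs : r ⬝ᵥ T e *ᵥ s = 0 := by
      have := h₁ e heI
      rw [hz, add_dotProduct, smul_dotProduct, smul_dotProduct, hrr, form_comm (hT e) s] at this
      simpa [hb.ne'] using this
    -- Suppose not. Then some independent set through I + e has colours (i, j+2) beyond I + e. The
    -- kernel relations over `I` move positivity from (i+1, j+2) to (i+2, j+1) and on to (i+3, j).
    have hss : s ⬝ᵥ T e *ᵥ s = 0 := by
      by_contra hss
      rw [form_compl_compl] at hss
      obtain ⟨J₁, hJ₁⟩ := countForm_colorList_pos.1
        (lt_of_le_of_ne countForm_colorList_nonneg (Ne.symm hss))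
      have h₃ : 0 < countForm M (colorList R (i + 1) (j + 2)) I :=
        countForm_colorList_pos.2 ⟨J₁, ((completes_insert heR heI).1 hJ₁).1⟩
      have h₄ : 0 < countForm M (colorList R (i + 1 + 1) (j + 1)) I := by
        have := h.right
        exact (pos_iff_pos_of_mul_pos (by rw [this]; exact mul_pos hb h₃)).1 ha
      have h₅ : 0 < countForm M (colorList R (i + 1 + 2) j) I := by
        have := h.left
        exact (pos_iff_pos_of_mul_pos (by rw [this]; exact mul_pos hb h₄)).1 ha
      obtain ⟨J₂, hJ₂⟩ := countForm_colorList_pos.1 h₅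
      have hc₁ := hJ₁.ncard
      have hc₂ := hJ₂.ncard
      have hce : (insert e I).ncard = I.ncard + 1 := Set.ncard_insert_of_notMem heI
      -- Filling up I + e from J₂ yields a set with at most j new elements outside `R`, hence at
      -- least i + 2 new ones inside. Interpolation with J₁ produces colours (i+2, j) over I + e,
      -- that is, T_e(1_R,1_R) > 0.
      obtain ⟨B, hB, hIB, hBJ, hBc⟩ := exists_indep_superset (hJ₁.indep.subset hJ₁.subset)
        hJ₂.indep (by omega)
      have h₆ := completes_self (R := R) hB hIB
      have h₇ := h₆.ncard
      have h₈ : ((B \ insert e I) ∩ Rᶜ).ncard ≤ j := by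
        rw [← hJ₂.ncard_compl]
        refine Set.ncard_le_ncard ?_ (Set.toFinite _)
        rintro x ⟨⟨hxB, hxe⟩, hxR⟩
        rcases hBJ hxB with hx | hx
        · exact absurd hx hxe
        · exact ⟨⟨hx, fun hxI => hxe (Or.inr hxI)⟩, hxR⟩
      obtain ⟨K, hK⟩ := hJ₁.interpolate h₆ (t := i + 2) (by omega) (by omega) (by omega)
      rw [show i + (j + 2) - (i + 2) = j by omega] at hK
      have h₉ := countForm_colorList_pos.2 ⟨K, hK⟩
      rw [← form_inter_inter] at h₉
      exact h₉.ne' hrr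
    have hone : r + (1 : ℝ) • s = 1 := by
      rw [one_smul, hr, hs, Set.indicator_self_add_compl]
    refine eq_zero_of_form_eq_zero (u := 1) (pairMatrix_nonneg colorList_nonneg _)
      (fun _ => zero_lt_one) ?_
    have := form_add_smul (hT e) r s 1
    rw [hone, hrr, hrs, hss] at this
    simpa using this
  have hpos : ∀ e ∈ R, e ∉ I → T e = 0 ∨ 0 < r ⬝ᵥ T e *ᵥ r := by
    intro e heR heI
    rcases (form_nonneg (pairMatrix_nonneg colorList_nonneg _) hr0 hr0 :
      0 ≤ r ⬝ᵥ T e *ᵥ r).eq_or_lt with h₃ | h₃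
    · exact .inl (h₂ e heR heI h₃.symm)
    · exact .inr h₃
  have hneg : ∀ e ∈ R, e ∉ I → z ⬝ᵥ T e *ᵥ z ≤ 0 := by
    intro e heR heI
    rcases hpos e heR heI with h₃ | h₃
    · simp [h₃]
    · have := hT0 e z r hr0
      rw [h₁ e heI] at this
      by_contra! hcon
      nlinarith [mul_pos hcon h₃]
  have hsum : ∑ e, (if e ∈ I then 0 else r e * (z ⬝ᵥ T e *ᵥ z)) = 0 := by
    rw [← form_cons, ← colorList_succ]
    exact h z
  have hzz : z ⬝ᵥ T e *ᵥ z = 0 := by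
    have := (Finset.sum_eq_zero_iff_of_nonpos (fun e _ => ?_)).1 hsum e (Finset.mem_univ e)
    · rw [if_neg heI] at this
      simpa [hr, heR] using this
    · by_cases heI : e ∈ I
      · simp [heI]
      · by_cases heR : e ∈ R
        · simpa [heI, hr, heR] using hneg e heR heI
        · simp [hr, heR]
  rcases hpos e heR heI with h₃ | h₃
  · intro x
    change _ ⬝ᵥ T e *ᵥ x = 0
    simp [h₃]
  · exact fun x => (hT0 e).kernel (hT e) hr0 h₃ (h₁ e heI) hzz.ge x

theorem Completes.exists_mem (h : Completes M R I (i + 1) j J) :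
    ∃ e ∈ R, e ∉ I ∧ Completes M R (insert e I) i j J := by
  obtain ⟨e, he⟩ : ((J \ I) ∩ R).Nonempty := by
    rw [Set.nonempty_iff_ne_empty]
    intro h₁
    have := h.ncard_inter
    simp [h₁] at this
  exact ⟨e, he.2, he.1.2, (completes_insert he.2 he.1.2).2 ⟨h, he.1.1⟩⟩

theorem Completes.eq (h : Completes M R I 0 0 J) : J = I := by
  have h₁ := h.ncard_inter
  have h₂ := h.ncard_compl
  rw [Set.ncard_eq_zero] at h₁ h₂
  refine (Set.sdiff_eq_empty.1 ?_).antisymm h.subset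
  rw [← Set.inter_union_compl (J \ I) R, h₁, h₂, Set.union_empty]

/-- Descend along the elements of J \ I, first those in `R`, then those outside. The second case is
the first one for the complement, which exchanges the roles of `a` and `b`. -/
theorem InKernel.of_completes (hE : M.E = Set.univ) (ha : 0 < a) (hb : 0 < b)
    (h : InKernel M R I i j a b) (hJ : Completes M R I i j J) : InKernel M R J 0 0 a b := by
  induction i generalizing I with
  | zero =>
    induction j generalizing I with
    | zero => rwa [hJ.eq]
    | succ j ih =>
      obtain ⟨e, heR, heI, hJe⟩ := (completes_compl.2 hJ).exists_mem
      exact ih (inKernel_compl.1 ((inKernel_compl.2 h).insert_of_mem hE hb ha heR heI))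
        (completes_compl.1 hJe)
  | succ i ih =>
    obtain ⟨e, heR, heI, hJe⟩ := hJ.exists_mem
    exact ih (h.insert_of_mem hE ha hb heR heI) hJe

theorem inKernel_succ (h : ∀ e ∈ R, e ∉ I → InKernel M R (insert e I) i j a b) :
    InKernel M R I (i + 1) j a b := by
  classical
  intro x
  rw [colorList_succ, form_cons]
  refine Finset.sum_eq_zero fun e _ => ?_
  by_cases heI : e ∈ I
  · simp [heI]
  · by_cases heR : e ∈ R
    · rw [if_neg heI, h e heR heI x, mul_zero]
    · simp [heR]

/-- The way back up needs no positivity: the form over `I` is a sum of forms over larger sets, and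
forms over dependent sets vanish. -/
theorem inKernel_of_forall (h : ∀ J, Completes M R I i j J → InKernel M R J 0 0 a b) :
    InKernel M R I i j a b := by
  classical
  induction i generalizing I with
  | zero =>
    induction j generalizing I with
    | zero =>
      by_cases hI : M.Indep I
      · exact h I ⟨hI, subset_rfl, by simp, by simp⟩
      · intro x
        have : pairMatrix M (colorList R 0 0) I = 0 := by
          ext e f
          have h₁ : ¬ M.Indep (insert f (insert e I)) := fun h =>
            hI (h.subset ((Set.subset_insert _ _).trans (Set.subset_insert _ _)))
          simp [pairMatrix, colorList, countForm, h₁]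
        simp [this]
    | succ j ih =>
      refine inKernel_compl.1 (inKernel_succ fun e heR heI => inKernel_compl.2 (ih fun J hJ => ?_))
      exact h J (completes_compl.1 ((completes_insert heR heI).1 (completes_compl.2 hJ)).1)
  | succ i ih =>
    exact inKernel_succ fun e heR heI => ih fun J hJ => h J ((completes_insert heR heI).1 hJ).1

end MatroidForm

/-! ### The equality case in terms of lines -/

namespace MatroidForm

open Matrix

variable {α : Type} [Fintype α] {M : Matroid α} {R I J : Set α} {i j : ℕ} {a b : ℝ}

/-! ### Characterization of equality -/

/-- The elements outside the closure of `A` that span, together with `A`, the same flat as `e`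
does. -/
def line (M : Matroid α) (A : Set α) (e : α) : Set α :=
  {f | Extends M A f ∧ M.closure (insert f A) = M.closure (insert e A)}

theorem lineSum_eq (A : Set α) (e : α) :
    lineSum M A (a • R.indicator 1 + (-b) • Rᶜ.indicator 1) (M.closure (insert e A)) =
      a * (line M A e ∩ R).ncard - b * (line M A e ∩ Rᶜ).ncard := by
  classical
  have h : ∀ S : Set α, lineSum M A (S.indicator 1) (M.closure (insert e A)) =
      (line M A e ∩ S).ncard := by
    intro S
    rw [Set.ncard_eq_toFinset_card', lineSum]
    calc _ = ∑ f, if f ∈ line M A e ∩ S then (1 : ℝ) else 0 := by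
          refine Finset.sum_congr rfl fun f _ => ?_
          by_cases hf : f ∈ line M A e
          · rw [if_pos (c := Extends M A f ∧ _) hf]
            by_cases hS : f ∈ S <;> simp [hf, hS]
          · rw [if_neg (c := Extends M A f ∧ _) hf, if_neg fun h => hf h.1]
      _ = _ := by
          rw [Finset.sum_boole]
          congr 2
          ext
          simp
  have h₀ : lineSum M A (0 : α → ℝ) (M.closure (insert e A)) = 0 := by simp [lineSum]
  have h₁ := lineSum_add_smul (M := M) A 0 (R.indicator 1) a (M.closure (insert e A))
  rw [zero_add, h₀, zero_add, h] at h₁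
  rw [lineSum_add_smul, h₁, h]
  ring

theorem lineSum_eq_zero (A : Set α) (x : α → ℝ) {F : Set α}
    (hF : ∀ e, Extends M A e → M.closure (insert e A) ≠ F) : lineSum M A x F = 0 :=
  Finset.sum_eq_zero fun e _ => if_neg fun h => hF e h.1 h.2

theorem colorList_zero : colorList R 0 0 = [] := rfl

theorem inKernel_zero_of_forall (hE : M.E = Set.univ)
    (h : ∀ e, Extends M I e → a * (line M I e ∩ R).ncard = b * (line M I e ∩ Rᶜ).ncard) :
    InKernel M R I 0 0 a b := by
  classical
  intro x
  have h₀ : ∀ F, lineSum M I (a • R.indicator 1 + (-b) • Rᶜ.indicator 1) F = 0 := by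
    intro F
    by_cases hF : ∃ e, Extends M I e ∧ M.closure (insert e I) = F
    · obtain ⟨e, he, rfl⟩ := hF
      rw [lineSum_eq, h e he, sub_self]
    · push Not at hF
      exact lineSum_eq_zero _ _ hF
  rw [colorList_zero, form_nil hE]
  simp only [h₀, Finset.sum_const_zero, zero_mul, sub_zero]

/-- If the combination `a 1_R - b 1_{Rᶜ}` is in the kernel, then its sum on each line vanishes. -/
theorem InKernel.line_eq (hE : M.E = Set.univ) (h : InKernel M R I 0 0 a b)
    (hI : ∃ J, M.Indep J ∧ I ⊆ J ∧ J.ncard = I.ncard + 2) {e : α} (he : Extends M I e) :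
    a * (line M I e ∩ R).ncard = b * (line M I e ∩ Rᶜ).ncard := by
  classical
  set z := a • R.indicator (1 : α → ℝ) + (-b) • Rᶜ.indicator 1 with hz
  set Z := ∑ F, lineSum M I z F with hZ
  -- Pairing with the unit vector at f gives Z minus the sum on the line of f, so all line sums
  -- equal their total Z. There are at least two lines, hence Z = 0.
  have h₁ : ∀ f, Extends M I f → lineSum M I z (M.closure (insert f I)) = Z := by
    intro f hf
    have h₂ : ∀ F, lineSum M I (Pi.single f 1) F =
        if F = M.closure (insert f I) then 1 else 0 := by
      intro F
      rw [lineSum, Finset.sum_eq_single f]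
      · by_cases hF : F = M.closure (insert f I)
        · simp [hf, hF]
        · simp [hF, Ne.symm hF]
      · intro g _ hg
        simp [Pi.single_eq_of_ne hg]
      · simp
    have h₃ := h (Pi.single f 1)
    rw [colorList_zero, form_nil hE] at h₃
    simp only [h₂, Finset.sum_ite_eq', Finset.mem_univ, if_true, mul_ite, mul_one, mul_zero] at h₃
    linarith
  obtain ⟨J, hJ, hIJ, hc⟩ := hI
  have hJI : (J \ I).ncard = 2 := by rw [ncard_diff_of_subset hIJ]; omega
  obtain ⟨g, k, hgk, hJgk⟩ := Set.ncard_eq_two.1 hJI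
  have hg : g ∈ J \ I := by rw [hJgk]; simp
  have hk : k ∈ J \ I := by rw [hJgk]; simp
  obtain ⟨hg', hk', hne⟩ := (indep_insert_insert_iff hE).1 ⟨hg.2, hk.2, hgk,
    hJ.subset (Set.insert_subset hk.1 (Set.insert_subset hg.1 hIJ))⟩
  have h₂ : ∑ F, lineSum M I z F =
      ((Finset.univ.filter fun F => ∃ e, Extends M I e ∧ M.closure (insert e I) = F).card : ℝ) *
        Z := by
    rw [← nsmul_eq_mul, ← Finset.sum_const, Finset.sum_filter]
    refine Finset.sum_congr rfl fun F _ => ?_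
    split_ifs with hF
    · obtain ⟨e, he, rfl⟩ := hF
      exact h₁ e he
    · push Not at hF
      exact lineSum_eq_zero _ _ hF
  have h₃ : 2 ≤ (Finset.univ.filter fun F =>
      ∃ e, Extends M I e ∧ M.closure (insert e I) = F).card := by
    rw [← Finset.card_pair hne]
    refine Finset.card_le_card ?_
    intro F hF
    rw [Finset.mem_insert, Finset.mem_singleton] at hF
    rw [Finset.mem_filter]
    rcases hF with rfl | rfl
    · exact ⟨Finset.mem_univ _, g, hg', rfl⟩
    · exact ⟨Finset.mem_univ _, k, hk', rfl⟩
  have hZ0 : Z = 0 := by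
    have h₄ : (2 : ℝ) ≤ ((Finset.univ.filter fun F =>
      ∃ e, Extends M I e ∧ M.closure (insert e I) = F).card : ℝ) := by exact_mod_cast h₃
    rw [← hZ] at h₂
    have h₅ : (((Finset.univ.filter fun F =>
      ∃ e, Extends M I e ∧ M.closure (insert e I) = F).card : ℝ) - 1) * Z = 0 := by linarith
    exact (mul_eq_zero.1 h₅).resolve_left (by linarith)
  have := h₁ e he
  rw [hz, lineSum_eq, hZ0] at this
  linarith

theorem mem_line_self {e : α} (he : Extends M I e) : e ∈ line M I e := ⟨he, rfl⟩

theorem ncard_of_completes_empty {A : Set α} (h : Completes M R ∅ i j A) : A.ncard = i + j := by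
  simpa using h.ncard

theorem sq_le_sq_countForm (hE : M.E = Set.univ) :
    countForm M (colorList R (i + 2) j) I * countForm M (colorList R i (j + 2)) I ≤
      countForm M (colorList R (i + 1) (j + 1)) I ^ 2 := by
  rw [← form_inter_inter, ← form_inter_compl, ← form_compl_compl]
  exact hyperbolic hE colorList_nonneg I _ _ (Set.indicator_nonneg fun _ _ => zero_le_one)

/-- Equality implies that a combination of the indicators of `R` and its complement is in the
kernel. -/
theorem exists_inKernel (hE : M.E = Set.univ)
    (h : countForm M (colorList R (i + 1) (j + 1)) I ^ 2 =
      countForm M (colorList R (i + 2) j) I * countForm M (colorList R i (j + 2)) I)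
    (hpos : 0 < countForm M (colorList R (i + 1) (j + 1)) I) :
    ∃ a b : ℝ, 0 < a ∧ 0 < b ∧ InKernel M R I i j a b := by
  set c := countForm M (colorList R (i + 1) (j + 1)) I with hc
  set p := countForm M (colorList R (i + 2) j) I with hp
  set q := countForm M (colorList R i (j + 2)) I with hq
  have hp0 : 0 ≤ p := countForm_colorList_nonneg
  have hq0 : 0 ≤ q := countForm_colorList_nonneg
  have hpq : 0 < p * q := by rw [← h]; positivity
  have hp1 : 0 < p := pos_of_mul_pos_left hpq hq0
  set Q := pairMatrix M (colorList R i j) I with hQ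
  have hsymm : Q.IsSymm := pairMatrix_isSymm _ _
  have hrr : R.indicator 1 ⬝ᵥ Q *ᵥ R.indicator 1 = p := form_inter_inter
  have hrs : R.indicator 1 ⬝ᵥ Q *ᵥ Rᶜ.indicator 1 = c := form_inter_compl
  have hss : Rᶜ.indicator 1 ⬝ᵥ Q *ᵥ Rᶜ.indicator 1 = q := form_compl_compl
  -- For z = c 1_R - p 1_S, with S the complement of `R`, the choice of coefficients gives Q(z,1_R)
  -- = 0, and Q(z,z) = p (p q - c²) vanishes by the assumed equality.
  refine ⟨c, p, hpos, hp1, fun x => (hyperbolic hE colorList_nonneg I).kernel hsymm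
    (y := R.indicator 1) (Set.indicator_nonneg fun _ _ => zero_le_one) (by rw [hrr]; exact hp1)
    ?_ ?_ x⟩
  · rw [add_dotProduct, smul_dotProduct, smul_dotProduct, form_comm hsymm (Rᶜ.indicator 1), hrr,
      hrs, smul_eq_mul, smul_eq_mul]
    ring
  · have h₁ : ((c • R.indicator (1 : α → ℝ)) + (-p) • Rᶜ.indicator 1) ⬝ᵥ Q *ᵥ
        ((c • R.indicator (1 : α → ℝ)) + (-p) • Rᶜ.indicator 1) = 0 := by
      rw [form_add_smul hsymm, mulVec_smul, smul_dotProduct, smul_dotProduct, dotProduct_smul, hrr,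
        hrs, hss]
      simp only [smul_eq_mul]
      linear_combination (-p) * h
    exact h₁.ge

theorem extend_of_extends {r : ℕ} (hr : ∃ J, M.Indep J ∧ J.ncard = r) {A : Set α} {e : α}
    (he : Extends M A e) (hA : A.ncard + 1 ≤ r) :
    ∃ B, insert e A ⊆ B ∧ M.Indep B ∧ B.ncard = r := by
  obtain ⟨J, hJ, rfl⟩ := hr
  obtain ⟨B, hB, hAB, -, hc⟩ := exists_indep_superset he.2 hJ (by
    rwa [Set.ncard_insert_of_notMem he.1])
  exact ⟨B, hAB, hB, hc⟩

theorem ncard_inter_insert_le {A B : Set α} {e : α} (h : insert e A ⊆ B) (heA : e ∉ A)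
    (heR : e ∈ R) : (A ∩ R).ncard + 1 ≤ (B ∩ R).ncard := by
  rw [← Set.ncard_insert_of_notMem (show e ∉ A ∩ R from fun h => heA h.1)]
  refine Set.ncard_le_ncard ?_ (Set.toFinite _)
  rintro x (rfl | hx)
  · exact ⟨h (Set.mem_insert _ _), heR⟩
  · exact ⟨h (Set.mem_insert_of_mem _ hx.1), hx.2⟩

/-- If one line meets `R` and another one meets the complement, then extending by such elements
gives independent sets of size i + j + 2, one with at least i + 1 elements in `R`, the other with at
least j + 1 outside. Interpolation yields exactly (i+1, j+1), which makes the form positive. -/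
theorem mul_eq_zero_of_not_pos {A A' : Set α} {e e' : α}
    (hr : ∃ J, M.Indep J ∧ J.ncard = i + j + 2)
    (hA : Completes M R ∅ i j A) (hA' : Completes M R ∅ i j A')
    (h0 : ¬ 0 < countForm M (colorList R (i + 1) (j + 1)) ∅) :
    (line M A e ∩ R).ncard * (line M A' e' ∩ Rᶜ).ncard = 0 := by
  by_contra hne
  obtain ⟨h₁, h₂⟩ := mul_ne_zero_iff.1 hne
  obtain ⟨f, hf, hfR⟩ := Set.nonempty_of_ncard_ne_zero h₁
  obtain ⟨f', hf', hfR'⟩ := Set.nonempty_of_ncard_ne_zero h₂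
  have hc := ncard_of_completes_empty hA
  have hc' := ncard_of_completes_empty hA'
  obtain ⟨B, hAB, hB, hBc⟩ := extend_of_extends hr hf.1 (by omega)
  obtain ⟨B', hAB', hB', hBc'⟩ := extend_of_extends hr hf'.1 (by omega)
  have h₃ := ncard_inter_insert_le hAB hf.1.1 hfR
  have h₄ := ncard_inter_insert_le hAB' hf'.1.1 hfR'
  have k₁ := completes_self (R := R) hB (Set.empty_subset B)
  have k₂ := completes_self (R := R) hB' (Set.empty_subset B')
  have hi := hA.ncard_inter
  have hj' := hA'.ncard_compl
  have n₁ := k₁.ncard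
  have n₂ := k₂.ncard
  simp only [Set.sdiff_empty, Set.ncard_empty, zero_add] at *
  obtain ⟨K, hK⟩ := k₂.interpolate k₁ (t := i + 1) (by omega) (by omega) (by omega)
  rw [show (B' ∩ R).ncard + (B' ∩ Rᶜ).ncard - (i + 1) = j + 1 by omega] at hK
  exact h0 (countForm_colorList_pos.2 ⟨K, hK⟩)

/-- Equality holds if and only if `R` is distributed in the same way on all lines. -/
theorem equality_iff (hE : M.E = Set.univ) (hr : ∃ J, M.Indep J ∧ J.ncard = i + j + 2) :
    countForm M (colorList R (i + 1) (j + 1)) ∅ ^ 2 =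
      countForm M (colorList R (i + 2) j) ∅ * countForm M (colorList R i (j + 2)) ∅ ↔
    ∀ A A' e e', Completes M R ∅ i j A → Completes M R ∅ i j A' → Extends M A e →
      Extends M A' e' → (line M A e ∩ R).ncard * (line M A' e' ∩ Rᶜ).ncard =
        (line M A' e' ∩ R).ncard * (line M A e ∩ Rᶜ).ncard := by
  constructor
  · intro h A A' e e' hA hA' he he'
    by_cases h0 : 0 < countForm M (colorList R (i + 1) (j + 1)) ∅
    · obtain ⟨a, b, ha, hb, hk⟩ := exists_inKernel hE h h0
      have key : ∀ A e, Completes M R ∅ i j A → Extends M A e →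
          a * (line M A e ∩ R).ncard = b * (line M A e ∩ Rᶜ).ncard := by
        intro A e hA he
        refine (hk.of_completes hE ha hb hA).line_eq hE ?_ he
        obtain ⟨J, hJ, hc⟩ := hr
        have hcA := ncard_of_completes_empty hA
        obtain ⟨B, hB, hAB, -, hBc⟩ := exists_indep_superset hA.indep hJ (by omega)
        exact ⟨B, hB, hAB, by omega⟩
      have h₁ := key A e hA he
      have h₂ := key A' e' hA' he'
      have : (a : ℝ) * ((line M A e ∩ R).ncard * (line M A' e' ∩ Rᶜ).ncard) =
          a * ((line M A' e' ∩ R).ncard * (line M A e ∩ Rᶜ).ncard) := by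
        linear_combination ((line M A' e' ∩ Rᶜ).ncard : ℝ) * h₁ -
          ((line M A e ∩ Rᶜ).ncard : ℝ) * h₂
      exact_mod_cast mul_left_cancel₀ ha.ne' this
    · rw [mul_eq_zero_of_not_pos hr hA hA' h0, mul_eq_zero_of_not_pos hr hA' hA h0]
  · intro h
    have hnn : ∀ i j, 0 ≤ countForm M (colorList R i j) ∅ := fun i j => countForm_colorList_nonneg
    by_cases h0 : 0 < countForm M (colorList R (i + 1) (j + 1)) ∅
    -- Deleting one element of each colour from such a set gives an `A` with lines meeting `R` and
    -- lines meeting the complement. By proportionality, the line of `e` meets both, and its two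
    -- cardinalities supply the coefficients of the kernel vector.
    · obtain ⟨B, hB⟩ := countForm_colorList_pos.1 h0
      obtain ⟨e, heR, -, hBe⟩ := hB.exists_mem
      obtain ⟨f, hfR, hfe, hBf⟩ := (completes_compl.2 hBe).exists_mem
      have hef : e ≠ f := fun h => hfR (h ▸ heR)
      have heB : e ∈ B := hBe.subset (by simp)
      have hfB : f ∈ B := hBf.subset (by simp)
      set A := B \ {e, f} with hA'
      have hAe : insert e A ⊆ B := Set.insert_subset heB Set.sdiff_subset
      have hAf : insert f A ⊆ B := Set.insert_subset hfB Set.sdiff_subset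
      have he : Extends M A e := ⟨by simp [hA'], hB.indep.subset hAe⟩
      have hf : Extends M A f := ⟨by simp [hA'], hB.indep.subset hAf⟩
      have hA : Completes M R ∅ i j A := by
        have h₁ := hB.ncard_inter
        have h₂ := hB.ncard_compl
        rw [Set.sdiff_empty] at h₁ h₂
        refine ⟨hB.indep.subset Set.sdiff_subset, Set.empty_subset _, ?_, ?_⟩
        · have : B ∩ R = insert e (A ∩ R) := by
            ext x
            by_cases hx : x = e
            · subst hx; simp [heB, heR]
            · by_cases hx' : x = f
              · subst hx'; simp [hA', hx, show x ∉ R from hfR]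
              · simp [hA', hx, hx']
          rw [this, Set.ncard_insert_of_notMem (fun h => he.1 h.1)] at h₁
          rw [Set.sdiff_empty]
          omega
        · have : B ∩ Rᶜ = insert f (A ∩ Rᶜ) := by
            ext x
            by_cases hx : x = e
            · subst hx; simp [hA', heR, hef]
            · by_cases hx' : x = f
              · subst hx'; simp [hfB, show x ∉ R from hfR]
              · simp [hA', hx, hx']
          rw [this, Set.ncard_insert_of_notMem (fun h => hf.1 h.1)] at h₂
          rw [Set.sdiff_empty]
          omega
      set p := (line M A e ∩ R).ncard with hp
      set q := (line M A e ∩ Rᶜ).ncard with hq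
      have hp0 : p ≠ 0 := Set.ncard_ne_zero_of_mem (a := e) ⟨mem_line_self he, heR⟩
      have hq0 : q ≠ 0 := by
        have h₁ := h A A e f hA hA he hf
        have h₂ : (line M A f ∩ Rᶜ).ncard ≠ 0 :=
          Set.ncard_ne_zero_of_mem (a := f) ⟨mem_line_self hf, hfR⟩
        intro h₃
        rw [← hq, h₃, mul_zero] at h₁
        exact (mul_ne_zero hp0 h₂) h₁
      have hk : InKernel M R ∅ i j q p := by
        refine inKernel_of_forall fun A' hA' => inKernel_zero_of_forall hE fun e' he' => ?_
        have := h A' A e' e hA' hA he' he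
        rw [mul_comm, mul_comm (p : ℝ), mul_comm (_ : ℝ) (p : ℝ)]
        exact_mod_cast this
      have h₁ := hk.left
      have h₂ := hk.right
      have hp1 : (p : ℝ) ≠ 0 := Nat.cast_ne_zero.2 hp0
      have hq1 : (q : ℝ) ≠ 0 := Nat.cast_ne_zero.2 hq0
      refine mul_left_cancel₀ (mul_ne_zero hp1 hq1) ?_
      linear_combination
        p * countForm M (colorList R (i + 1) (j + 1)) ∅ * h₂ -
          p * countForm M (colorList R i (j + 2)) ∅ * h₁
    -- If the middle term vanishes, the inequality forces the product of the nonnegative outer terms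
    -- to vanish as well.
    · have h₁ := le_antisymm (not_lt.1 h0) (hnn _ _)
      have h₂ := sq_le_sq_countForm (M := M) (R := R) (i := i) (j := j) (I := ∅) hE
      rw [h₁] at h₂ ⊢
      refine le_antisymm ?_ h₂
      rw [zero_pow two_ne_zero]
      exact mul_nonneg (hnn _ _) (hnn _ _)

end MatroidForm

/-! ### Certificates by ranks for the failure of equality -/

namespace MatroidForm

open Matrix

variable {α : Type} [Fintype α] {M : Matroid α} {R I J : Set α} {i j : ℕ}

/-! ### The rank function -/

/-- The rank of a set as a natural number. -/
noncomputable def rk (M : Matroid α) (X : Set α) : ℕ := (M.eRk X).toNat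

theorem cast_rk (X : Set α) : (rk M X : ℕ∞) = M.eRk X := by
  refine ENat.natCast_toNat (ne_top_of_le_ne_top ?_ (M.eRk_le_encard X))
  rw [← X.toFinite.cast_ncard_eq]
  exact ENat.natCast_ne_top _

theorem rk_mono {X Y : Set α} (h : X ⊆ Y) : rk M X ≤ rk M Y := by
  have := M.eRk_mono h
  rw [← cast_rk, ← cast_rk] at this
  exact_mod_cast this

theorem rk_closure (X : Set α) : rk M (M.closure X) = rk M X := by
  rw [rk, M.eRk_closure_eq, rk]

theorem rk_insert_of_notMem (hE : M.E = Set.univ) {X : Set α} {e : α} (h : e ∉ M.closure X) :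
    rk M (insert e X) = rk M X + 1 := by
  have := M.eRk_insert_eq_add_one (e := e) (X := X) ⟨by rw [hE]; trivial, h⟩
  rw [← cast_rk, ← cast_rk] at this
  exact_mod_cast this

theorem rk_insert_eq_iff (hE : M.E = Set.univ) {X : Set α} {e : α} :
    rk M (insert e X) = rk M X ↔ e ∈ M.closure X := by
  refine ⟨fun h => ?_, fun h => ?_⟩
  · by_contra hc
    rw [rk_insert_of_notMem hE hc] at h
    omega
  · rw [← rk_closure, Matroid.closure_insert_eq_of_mem_closure h, rk_closure]

theorem rk_indep (hI : M.Indep I) : rk M I = I.ncard := by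
  rw [rk, hI.eRk_eq_encard, Set.ncard]

theorem natRank_eq_rk : M.natRank = rk M Set.univ := by
  rw [Matroid.natRank, rk, Matroid.eRk_univ_eq]

theorem ncard_le_rk {X : Set α} (hI : M.Indep I) (h : I ⊆ X) : I.ncard ≤ rk M X := by
  rw [← rk_indep hI]
  exact rk_mono h

theorem isBase_iff : M.IsBase I ↔ M.Indep I ∧ I.ncard = M.natRank := by
  constructor
  · intro h
    refine ⟨h.indep, ?_⟩
    rw [Matroid.natRank, ← h.encard_eq_eRank, Set.ncard]
  · rintro ⟨h, hc⟩
    refine h.isBase_of_eRk_ge I.toFinite ?_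
    rw [← Matroid.eRk_univ_eq, ← cast_rk, ← cast_rk, ← natRank_eq_rk, rk_indep h, hc]

theorem exists_indep_of_rk (X : Set α) : ∃ I, M.Indep I ∧ I ⊆ X ∧ I.ncard = rk M X := by
  obtain ⟨I, hI⟩ := M.exists_isBasis' X
  exact ⟨I, hI.indep, hI.subset, by rw [rk, ← hI.encard_eq_eRk, Set.ncard]⟩

theorem closure_eq_of_rk (hE : M.E = Set.univ) {X Y : Set α} (h : X ⊆ Y)
    (hr : rk M X = rk M Y) : M.closure X = M.closure Y := by
  refine (M.closure_subset_closure h).antisymm fun y hy => ?_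
  rw [← rk_insert_eq_iff hE] at hy ⊢
  refine le_antisymm ?_ (rk_mono (Set.subset_insert _ _))
  rw [hr, ← hy]
  exact rk_mono (Set.insert_subset_insert h)

theorem indep_iff_rk (hE : M.E = Set.univ) :
    M.Indep I ↔ ∀ e ∈ I, rk M (I \ {e}) ≠ rk M I := by
  rw [Matroid.indep_iff_forall_notMem_closure_sdiff (by rw [hE]; exact Set.subset_univ _)]
  refine forall₂_congr fun e he => ?_
  rw [not_iff_comm, not_not, ← rk_insert_eq_iff hE, Set.insert_sdiff_singleton,
    Set.insert_eq_of_mem he, eq_comm]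

/-! ### Certificates for lines -/

/-- The conditions, in terms of ranks, that certify that `C` is a line through an independent set
`A` of size `rk M - 2` with `a - 1` elements in `R`. Here the six sets `A`, `F`, `G`, `C`, `E`, `T`
are listed in this order. -/
structure LineCertificate (M : Matroid α) (R : Set α) (a : ℕ) (D : Fin 6 → Set α) : Prop where
  union_union : rk M {i | i ∈ D 0 ∨ i ∈ D 1 ∨ i ∈ D 2} = rk M Set.univ
  union_ne : rk M {i | i ∈ D 0 ∨ i ∈ D 1} ≠ rk M Set.univ
  ne_union : rk M (D 0) ≠ rk M {i | i ∈ D 0 ∨ i ∈ D 1}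
  inter_union : rk M {i | (i ∈ D 0 ∧ i ∈ R) ∨ i ∈ D 5} = a
  inter_ne : rk M {i | i ∈ D 0 ∧ i ∈ R} ≠ a
  indep : ∀ e ∈ D 0, rk M {i | i ∈ D 0 ∧ i ≠ e} ≠ rk M (D 0)
  insert_second : ∀ e ∈ D 1, rk M {i | i ∈ D 0 ∨ i = e} = rk M {i | i ∈ D 0 ∨ i ∈ D 1}
  insert_third : ∀ e ∈ D 2, rk M {i | i ∈ D 0 ∨ i ∈ D 1 ∨ i = e} = rk M Set.univ
  mem_ne : ∀ e ∈ D 3, rk M {i | i ∈ D 0 ∨ i = e} ≠ rk M (D 0)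
  mem_eq : ∀ e ∈ D 3, rk M {i | i ∈ D 0 ∨ i ∈ D 1 ∨ i = e} = rk M {i | i ∈ D 0 ∨ i ∈ D 1}
  notMem_eq : ∀ e ∉ D 3, e ∈ D 4 → rk M {i | i ∈ D 0 ∨ i = e} = rk M (D 0)
  notMem_ne : ∀ e ∉ D 3, e ∉ D 4 →
    rk M {i | i ∈ D 0 ∨ i ∈ D 1 ∨ i = e} ≠ rk M {i | i ∈ D 0 ∨ i ∈ D 1}
  insert_inter : ∀ e ∈ D 5, rk M {i | (i ∈ D 0 ∧ i ∈ R) ∨ i = e} = a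

theorem setOf_mem_or_eq (A : Set α) (e : α) : {i | i ∈ A ∨ i = e} = insert e A := by
  ext; simp [or_comm]

theorem setOf_mem_or_mem_or_eq (A B : Set α) (e : α) :
    {i | i ∈ A ∨ i ∈ B ∨ i = e} = insert e (A ∪ B) := by
  ext; simp; tauto

theorem setOf_mem_and_mem_or_eq (A B : Set α) (e : α) :
    {i | (i ∈ A ∧ i ∈ B) ∨ i = e} = insert e (A ∩ B) := by
  ext; simp [or_comm]

theorem mem_line_iff (hE : M.E = Set.univ) {A : Set α} (hA : M.Indep A) {e f : α}
    (he : Extends M A e) :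
    f ∈ line M A e ↔ f ∉ M.closure A ∧ f ∈ M.closure (insert e A) := by
  rw [line, Set.mem_ofPred_eq, ← extends_iff hE hA]
  refine and_congr_right fun hf => ?_
  rw [eq_comm, he.closure_eq_iff hE hf]

/-- The numbers r = |A| + 2 and a = |A ∩ R| + 1 are enforced without arithmetic: adding any single
element of a set already gives the rank reached with the whole set, and this differs from the rank
before, so the step is exactly 1. The conditions on unions ensure that `F`, `G`, `T` are nonempty.
For elements outside `C`, the set `E` tells which of the two reasons applies: lying in the closure
of `A`, or lying outside the flat A ∪ F spans. -/
theorem LineCertificate.exists_line (hE : M.E = Set.univ) {a : ℕ} {D : Fin 6 → Set α}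
    (h : LineCertificate M R a D) : M.Indep (D 0) ∧ (D 0).ncard + 2 = M.natRank ∧
      (D 0 ∩ R).ncard + 1 = a ∧ ∃ e, Extends M (D 0) e ∧ D 3 = line M (D 0) e := by
  obtain ⟨h₁, h₂, h₃, h₄, h₅, h₆, h₇, h₈, h₉, h₁₀, h₁₁, h₁₂, h₁₃⟩ := h
  generalize hA : D 0 = A at *
  generalize hF : D 1 = F at *
  generalize hG : D 2 = G at *
  generalize hC : D 3 = C at *
  generalize hT : D 5 = T at *
  have e₁ : {i | i ∈ A ∨ i ∈ F} = A ∪ F := rfl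
  have e₂ : {i | i ∈ A ∧ i ∈ R} = A ∩ R := rfl
  simp only [setOf_mem_or_eq, setOf_mem_or_mem_or_eq, setOf_mem_and_mem_or_eq, e₁, e₂] at *
  have hAi : M.Indep A := (indep_iff_rk hE).2 h₆
  have hne : F.Nonempty := by
    rw [Set.nonempty_iff_ne_empty]
    rintro rfl
    simp at h₃
  obtain ⟨e, he⟩ := hne
  have hee : e ∉ M.closure A := by
    rw [← rk_insert_eq_iff hE, h₇ e he]
    exact Ne.symm h₃
  have hext : Extends M A e := (extends_iff hE hAi).2 hee
  have hrF : rk M (A ∪ F) = A.ncard + 1 := by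
    rw [← h₇ e he, rk_insert_of_notMem hE hee, rk_indep hAi]
  have hcl : M.closure (insert e A) = M.closure (A ∪ F) :=
    closure_eq_of_rk hE (Set.insert_subset (Or.inr he) Set.subset_union_left) (h₇ e he)
  refine ⟨hAi, ?_, ?_, e, hext, ?_⟩
  · obtain ⟨g, hg⟩ : G.Nonempty := by
      rw [Set.nonempty_iff_ne_empty]
      rintro rfl
      simp only [Set.mem_empty_iff_false, or_false] at h₁
      exact h₂ h₁
    have h := h₈ g hg
    have hg' : g ∉ M.closure (A ∪ F) := by
      rw [← rk_insert_eq_iff hE, h]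
      exact Ne.symm h₂
    rw [rk_insert_of_notMem hE hg', hrF] at h
    rw [natRank_eq_rk, ← h]
  · obtain ⟨t, ht⟩ : T.Nonempty := by
      rw [Set.nonempty_iff_ne_empty]
      rintro rfl
      simp only [Set.mem_empty_iff_false, or_false] at h₄
      exact h₅ h₄
    have h := h₁₃ t ht
    have ht' : t ∉ M.closure (A ∩ R) := by
      rw [← rk_insert_eq_iff hE, h]
      exact Ne.symm h₅
    rw [rk_insert_of_notMem hE ht', rk_indep (hAi.subset Set.inter_subset_left)] at h
    exact h
  · ext f
    rw [mem_line_iff hE hAi hext, hcl, ← rk_insert_eq_iff hE, ← rk_insert_eq_iff hE]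
    constructor
    · exact fun hf => ⟨h₉ f hf, h₁₀ f hf⟩
    · rintro ⟨hf₁, hf₂⟩
      by_contra hf
      by_cases hfE : f ∈ D 4
      · exact hf₁ (h₁₁ f hf hfE)
      · exact h₁₂ f hf hfE hf₂

theorem exists_lineCertificate (hE : M.E = Set.univ) {A : Set α} (hA : M.Indep A)
    (hr : A.ncard + 2 = M.natRank) {e : α} (he : Extends M A e) :
    ∃ D : Fin 6 → Set α, LineCertificate M R ((A ∩ R).ncard + 1) D ∧ D 3 = line M A e := by
  have hec : (insert e A).ncard = A.ncard + 1 := Set.ncard_insert_of_notMem he.1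
  have hre : rk M (insert e A) = A.ncard + 1 := by rw [rk_indep he.2, hec]
  obtain ⟨g, hg⟩ : ∃ g, g ∉ M.closure (insert e A) := by
    by_contra! h
    have h₁ := rk_closure (M := M) (insert e A)
    rw [show M.closure (insert e A) = Set.univ from Set.eq_univ_of_forall h, ← natRank_eq_rk,
      hre] at h₁
    omega
  have hrg : rk M (insert g (insert e A)) = rk M Set.univ := by
    rw [rk_insert_of_notMem hE hg, hre, ← natRank_eq_rk]
    omega
  have heA : e ∉ M.closure A := (extends_iff hE hA).1 he
  have heR : e ∉ M.closure (A ∩ R) := fun h =>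
    heA (M.closure_subset_closure Set.inter_subset_left h)
  have hRr : rk M (A ∩ R) = (A ∩ R).ncard := rk_indep (hA.subset Set.inter_subset_left)
  have hAe : A ∪ {e} = insert e A := by rw [Set.union_comm]; rfl
  -- The element `e` also serves for `T`: it is outside the closure of `A`, hence outside that of A
  -- ∩ R.
  refine ⟨![A, {e}, {g}, line M A e, M.closure A, {e}], ?_, rfl⟩
  have e₁ : {i | i ∈ A ∨ i = e} = insert e A := setOf_mem_or_eq A e
  have e₂ : {i | i ∈ A ∧ i ∈ R} = A ∩ R := rfl
  have e₃ : ∀ f, {i | i ∈ A ∨ i = e ∨ i = f} = insert f (insert e A) := fun f => by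
    ext; simp; tauto
  have e₄ : rk M (insert e (A ∩ R)) = (A ∩ R).ncard + 1 := by
    rw [rk_insert_of_notMem hE heR, hRr]
  have e₅ : rk M (insert e A) ≠ rk M A := by rw [Ne, rk_insert_eq_iff hE]; exact heA
  constructor <;> simp only [Matrix.cons_val, Set.mem_singleton_iff, forall_eq, e₁, e₂, e₃,
    setOf_mem_or_eq, setOf_mem_and_mem_or_eq, rk_insert_eq_iff hE, Ne]
  · exact hrg
  · rw [hre, ← natRank_eq_rk]; omega
  · exact Ne.symm e₅
  · exact e₄
  · rw [hRr]; omega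
  · exact (indep_iff_rk hE).1 hA
  · exact hrg
  · exact fun f hf => ((mem_line_iff hE hA he).1 hf).1
  · exact fun f hf => ((mem_line_iff hE hA he).1 hf).2
  · exact fun f _ hf => hf
  · exact fun f hf hf' h => hf ((mem_line_iff hE hA he).2 ⟨hf', h⟩)
  · exact e₄

/-! ### The Stanley–Yan equality -/

theorem syB_eq (R : Set α) (hi : i + j = M.natRank) :
    M.syB R i = {J | Completes M R ∅ i j J}.ncard := by
  rw [Matroid.syB]
  congr 1
  ext J
  simp only [Set.mem_ofPred_eq, isBase_iff, Nat.cast_inj]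
  constructor
  · rintro ⟨⟨h₁, h₂⟩, h₃⟩
    refine ⟨h₁, Set.empty_subset _, by rwa [Set.sdiff_empty], ?_⟩
    have := Set.ncard_inter_add_ncard_sdiff_eq_ncard J R J.toFinite
    rw [show J \ R = J ∩ Rᶜ from rfl] at this
    rw [Set.sdiff_empty]
    omega
  · intro h
    have h₁ := h.ncard_inter
    rw [Set.sdiff_empty] at h₁
    exact ⟨⟨h.indep, by rw [ncard_of_completes_empty h, hi]⟩, h₁⟩

/-- i! j! = r! / (r choose i) for i + j = r. -/
theorem countForm_eq_syP (R : Set α) (hi : i + j = M.natRank) :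
    countForm M (colorList R i j) ∅ = M.natRank.factorial * (M.syP R i : ℝ) := by
  rw [countForm_colorList, ← syB_eq R hi, Matroid.syP, ← hi, Int.toNat_natCast]
  have h := Nat.add_choose_mul_factorial_mul_factorial i j
  rw [← Nat.choose_symm_add] at h
  have h₁ : ((i + j).choose i : ℝ) ≠ 0 :=
    Nat.cast_ne_zero.2 (Nat.choose_pos (Nat.le_add_right i j)).ne'
  push_cast
  rw [← h]
  push_cast
  field_simp

theorem syB_pos_iff (R : Set α) (hi : i + j = M.natRank) :
    M.syP R i ≠ 0 ↔ ∃ J, Completes M R ∅ i j J := by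
  rw [Matroid.syP, syB_eq R hi, Int.toNat_natCast, Ne, div_eq_zero_iff, not_or, Nat.cast_eq_zero,
    Set.ncard_eq_zero, ← Ne, ← Set.nonempty_iff_ne_empty, Nat.cast_eq_zero]
  exact and_iff_left (Nat.choose_pos (by omega)).ne'

theorem exists_completes_iff_rk (R : Set α) :
    (∃ J, Completes M R ∅ M.natRank 0 J) ↔ rk M R = rk M Set.univ := by
  constructor
  · rintro ⟨J, h⟩
    refine le_antisymm (rk_mono (Set.subset_univ _)) ?_
    rw [← natRank_eq_rk, ← h.ncard_inter]
    exact ncard_le_rk (h.indep.subset (Set.inter_subset_left.trans Set.sdiff_subset))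
      Set.inter_subset_right
  · intro h
    obtain ⟨J, hJ, hJR, hc⟩ := exists_indep_of_rk (M := M) R
    refine ⟨J, hJ, Set.empty_subset _, ?_, ?_⟩
    · rw [Set.sdiff_empty, Set.inter_eq_left.2 hJR, hc, h, natRank_eq_rk]
    · rw [Set.sdiff_empty, Set.ncard_eq_zero, ← Set.disjoint_iff_inter_eq_empty,
        Set.disjoint_compl_right_iff_subset]
      exact hJR

/-- Since P(-1) = 0, equality at 0 means P(0) = 0, and P(0) ≠ 0 means that some basis avoids `R`. -/
theorem not_syEquality_zero (R : Set α) :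
    ¬ M.SYEquality R 0 ↔ rk M Rᶜ = rk M Set.univ := by
  have h : M.syP R (((0 : ℕ) : ℤ) - 1) = 0 := by
    have : M.syB R (((0 : ℕ) : ℤ) - 1) = 0 := by
      rw [Matroid.syB, Set.ncard_eq_zero, Set.eq_empty_iff_forall_notMem]
      rintro A ⟨-, hA⟩
      omega
    rw [Matroid.syP, this, Nat.cast_zero, zero_div]
  rw [Matroid.SYEquality, h, mul_zero, pow_eq_zero_iff two_ne_zero, ← Ne,
    syB_pos_iff R (j := M.natRank) (zero_add _), ← exists_completes_iff_rk]
  simp only [completes_compl]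

theorem not_syEquality_natRank (R : Set α) :
    ¬ M.SYEquality R M.natRank ↔ rk M R = rk M Set.univ := by
  -- Here the binomial coefficient is 0, and division by zero gives the desired value.
  have h : M.syP R ((M.natRank : ℤ) + 1) = 0 := by
    rw [Matroid.syP, show ((M.natRank : ℤ) + 1).toNat = M.natRank + 1 by omega,
      Nat.choose_succ_self, Nat.cast_zero, div_zero]
  rw [Matroid.SYEquality, h, zero_mul, pow_eq_zero_iff two_ne_zero, ← Ne,
    syB_pos_iff R (j := 0) (add_zero _), ← exists_completes_iff_rk]

theorem syEquality_iff (R : Set α) (hr : i + j + 2 = M.natRank) :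
    M.SYEquality R (i + 1) ↔ countForm M (colorList R (i + 1) (j + 1)) ∅ ^ 2 =
      countForm M (colorList R (i + 2) j) ∅ * countForm M (colorList R i (j + 2)) ∅ := by
  rw [countForm_eq_syP R (by omega), countForm_eq_syP R (by omega), countForm_eq_syP R (by omega),
    Matroid.SYEquality]
  have h : (M.natRank.factorial : ℝ) ≠ 0 := Nat.cast_ne_zero.2 (Nat.factorial_ne_zero _)
  have h₁ : (((i + 1 : ℕ) : ℤ) + 1) = ((i + 2 : ℕ) : ℤ) := by push_cast; ring
  have h₂ : (((i + 1 : ℕ) : ℤ) - 1) = ((i : ℕ) : ℤ) := by push_cast; ring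
  rw [h₁, h₂]
  generalize M.syP R ((i + 1 : ℕ) : ℤ) = p
  generalize M.syP R ((i + 2 : ℕ) : ℤ) = q
  generalize M.syP R ((i : ℕ) : ℤ) = s
  rw [mul_pow, mul_mul_mul_comm, ← pow_two, mul_right_inj' (pow_ne_zero 2 h)]
  exact_mod_cast Iff.rfl

/-- Failure of equality is certified by ranks. -/
theorem not_syEquality_iff (hE : M.E = Set.univ) (R : Set α) {a : ℕ} (ha : a ≤ M.natRank) :
    ¬ M.SYEquality R a ↔
      (rk M ∅ = a ∧ rk M Rᶜ = rk M Set.univ) ∨ (rk M Set.univ = a ∧ rk M R = rk M Set.univ) ∨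
      ∃ D : Fin 2 → Fin 6 → Set α, (∀ c, LineCertificate M R a (D c)) ∧
        (D 1 3 ∩ R).ncard * (D 0 3 ∩ Rᶜ).ncard < (D 0 3 ∩ R).ncard * (D 1 3 ∩ Rᶜ).ncard := by
  have hemp : rk M ∅ = 0 := by rw [rk, Matroid.eRk_empty]; rfl
  -- Line certificates exist only for 0 < a < r, so they cannot interfere with the two extreme
  -- cases.
  have hlt : ∀ D, LineCertificate M R a D → 0 < a ∧ a < M.natRank := by
    intro D hD
    obtain ⟨-, h₁, h₂, -⟩ := hD.exists_line hE
    have := Set.ncard_le_ncard (Set.inter_subset_left (s := D 0) (t := R)) (D 0).toFinite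
    omega
  rw [← natRank_eq_rk, hemp]
  rcases Nat.eq_zero_or_pos a with rfl | ha0
  · rw [not_syEquality_zero, natRank_eq_rk]
    constructor
    · exact fun h => .inl ⟨rfl, h⟩
    · rintro (⟨-, h⟩ | ⟨h, -⟩ | ⟨D, hD, -⟩)
      · exact h
      · refine le_antisymm (rk_mono (Set.subset_univ _)) ?_
        rw [h]
        exact Nat.zero_le _
      · exact absurd (hlt _ (hD 0)).1 (lt_irrefl 0)
  rcases ha.eq_or_lt with rfl | har
  · rw [not_syEquality_natRank, natRank_eq_rk]
    constructor
    · exact fun h => .inr (.inl ⟨rfl, h⟩)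
    · rintro (⟨h, -⟩ | ⟨-, h⟩ | ⟨D, hD, -⟩)
      · rw [natRank_eq_rk] at ha0; omega
      · exact h
      · rw [natRank_eq_rk] at hlt
        exact absurd (hlt _ (hD 0)).2 (lt_irrefl _)
  obtain ⟨i, rfl⟩ : ∃ i, a = i + 1 := ⟨a - 1, by omega⟩
  obtain ⟨j, hj⟩ : ∃ j, i + j + 2 = M.natRank := ⟨M.natRank - i - 2, by omega⟩
  have hr : ∃ J, M.Indep J ∧ J.ncard = i + j + 2 := by
    obtain ⟨J, hJ, -, hc⟩ := exists_indep_of_rk (M := M) Set.univ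
    exact ⟨J, hJ, by rw [hc, ← natRank_eq_rk, hj]⟩
  have hcomp : ∀ A, Completes M R ∅ i j A ↔
      M.Indep A ∧ A.ncard + 2 = M.natRank ∧ (A ∩ R).ncard + 1 = i + 1 := by
    intro A
    constructor
    · intro h
      have h₁ := ncard_of_completes_empty h
      have h₂ := h.ncard_inter
      rw [Set.sdiff_empty] at h₂
      exact ⟨h.indep, by omega, by omega⟩
    · rintro ⟨h₁, h₂, h₃⟩
      refine ⟨h₁, Set.empty_subset _, by rw [Set.sdiff_empty]; omega, ?_⟩
      have := Set.ncard_inter_add_ncard_sdiff_eq_ncard A R A.toFinite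
      rw [show A \ R = A ∩ Rᶜ from rfl] at this
      rw [Set.sdiff_empty]
      omega
  rw [syEquality_iff R hj, equality_iff hE hr]
  constructor
  · intro h
    push Not at h
    right
    right
    have key : ∀ A A' e e', Completes M R ∅ i j A → Completes M R ∅ i j A' → Extends M A e →
        Extends M A' e' → (line M A' e' ∩ R).ncard * (line M A e ∩ Rᶜ).ncard <
          (line M A e ∩ R).ncard * (line M A' e' ∩ Rᶜ).ncard →
        ∃ D : Fin 2 → Fin 6 → Set α, (∀ c, LineCertificate M R (i + 1) (D c)) ∧
        (D 1 3 ∩ R).ncard * (D 0 3 ∩ Rᶜ).ncard < (D 0 3 ∩ R).ncard * (D 1 3 ∩ Rᶜ).ncard := by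
      intro A A' e e' hA hA' he he' hlt
      obtain ⟨h₁, h₂, h₃⟩ := (hcomp A).1 hA
      obtain ⟨h₁', h₂', h₃'⟩ := (hcomp A').1 hA'
      obtain ⟨D, hD, hDl⟩ := exists_lineCertificate (R := R) hE h₁ h₂ he
      obtain ⟨D', hD', hDl'⟩ := exists_lineCertificate (R := R) hE h₁' h₂' he'
      rw [h₃] at hD
      rw [h₃'] at hD'
      refine ⟨![D, D'], fun c => ?_, ?_⟩
      · fin_cases c
        · exact hD
        · exact hD'
      · simpa [hDl, hDl'] using hlt
    obtain ⟨A, A', e, e', hA, hA', he, he', hne⟩ := h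
    -- Exchanging the two lines turns either strict inequality into the one that is certified.
    rcases lt_or_gt_of_ne hne with hlt | hlt
    · exact key A' A e' e hA' hA he' he hlt
    · exact key A A' e e' hA hA' he he' hlt
  · rintro (⟨h, -⟩ | ⟨h, -⟩ | ⟨D, hD, hlt⟩) hall
    · omega
    · omega
    · obtain ⟨h₁, h₂, h₃, e, he, hl⟩ := (hD 0).exists_line hE
      obtain ⟨h₁', h₂', h₃', e', he', hl'⟩ := (hD 1).exists_line hE
      have := hall _ _ e e' ((hcomp _).2 ⟨h₁, h₂, h₃⟩) ((hcomp _).2 ⟨h₁', h₂', h₃'⟩) he he'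
      rw [← hl, ← hl'] at this
      omega

end MatroidForm

/-! ### The rank conditions as tests of the verifier -/

namespace StackProg

open MatroidForm

/-- The meaning of a test when the oracle computes ranks in a matroid. -/
def Test.HoldsFor {m n : ℕ} (T : Test m) (M : Matroid (Fin n)) (a : ℕ) (V : Fin n → Rec m)
    (cur : Option (Fin n)) : Prop :=
  rk M {j | T.lhs (decide (some j = cur)) (V j) = true} =
    T.rhs.elim a (fun g => rk M {j | g (decide (some j = cur)) (V j) = true}) ↔ T.equal = true

namespace Verifier

variable {m n : ℕ} {f : List Bool × List Bool → ℕ} {w : List Bool}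

/-! ### Tests in terms of ranks -/

theorem encodeNat_injective : Function.Injective encodeNat :=
  Function.LeftInverse.injective decode_encodeNat

theorem indicator_none (g : Bool → Rec m → Bool) (V : Fin n → Rec m) :
    indicator g [] none (List.ofFn V) = List.ofFn fun j => g (decide (some j = none)) (V j) := by
  simp [indicator, List.map_ofFn, Function.comp_def]

theorem indicator_some (g : Bool → Rec m → Bool) (V : Fin n → Rec m) (l₁ l₂ : List (Rec m))
    (x : Rec m) (h : List.ofFn V = l₁ ++ x :: l₂) (i : Fin n) (hi : (i : ℕ) = l₁.length) :
    indicator g l₁ (some x) l₂ = List.ofFn fun j => g (decide (some j = some i)) (V j) := by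
  have hn : n = l₁.length + (l₂.length + 1) := by
    have := congrArg List.length h
    simpa using this
  refine List.ext_getElem (by simp [indicator, hn]; omega) fun k h₁ h₂ => ?_
  have hk : k < n := by simpa using h₂
  have hV : V ⟨k, hk⟩ = (l₁ ++ x :: l₂)[k]'(by simp; omega) := by
    simp only [← h, List.getElem_ofFn]
  rw [List.getElem_ofFn, hV]
  simp only [indicator, Option.toList_some, List.map_cons, List.map_nil, List.cons_append,
    List.nil_append, Option.some.injEq, Fin.ext_iff, hi]
  rcases lt_trichotomy k l₁.length with hlt | heq | hgt
  · rw [List.getElem_append_left (by simpa using hlt), List.getElem_append_left hlt]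
    simp [hlt.ne]
  · subst heq
    rw [List.getElem_append_right (by simp), List.getElem_append_right le_rfl]
    simp
  · rw [List.getElem_append_right (by simpa using hgt.le), List.getElem_append_right hgt.le]
    obtain ⟨d, rfl⟩ := Nat.exists_eq_add_of_lt hgt
    simp [show l₁.length + d + 1 - l₁.length = d + 1 by omega,
      show ¬ l₁.length + d + 1 = l₁.length by omega]

variable {M : Matroid (Fin n)} {a : ℕ} {V : Fin n → Rec m}

/-- The verifier compares binary strings. Since `encodeNat` is injective and `a` is given by its
canonical encoding, this amounts to comparing numbers. -/
theorem holds_iff (hf : ∀ B : Fin n → Bool, f (w, List.ofFn B) = rk M {i | B i = true})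
    (T : Test m) (l₁ l₂ : List (Rec m)) (cur : Option (Rec m)) (cur' : Option (Fin n))
    (h : ∀ g : Bool → Rec m → Bool, indicator g l₁ cur l₂ =
      List.ofFn fun j => g (decide (some j = cur')) (V j)) :
    T.Holds f w (encodeNat a) l₁ cur l₂ ↔ T.HoldsFor M a V cur' := by
  rw [Test.Holds, Test.HoldsFor, h, hf, Test.target]
  cases T.rhs with
  | none => rw [encodeNat_injective.eq_iff]; rfl
  | some g =>
    simp only [h, hf, encodeNat_injective.eq_iff]
    rfl

theorem holds_none_iff (hf : ∀ B : Fin n → Bool, f (w, List.ofFn B) = rk M {i | B i = true})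
    (T : Test m) :
    T.Holds f w (encodeNat a) [] none (List.ofFn V) ↔ T.HoldsFor M a V none :=
  holds_iff hf T _ _ _ _ fun g => indicator_none g V

theorem allHold_iff (hf : ∀ B : Fin n → Bool, f (w, List.ofFn B) = rk M {i | B i = true})
    (Ts : Rec m → List (Test m)) :
    AllHold f Ts w (encodeNat a) [] (List.ofFn V) ↔
      ∀ i, ∀ T ∈ Ts (V i), T.HoldsFor M a V (some i) := by
  constructor
  · intro h i T hT
    have hs : List.ofFn V = (List.ofFn V).take i ++ V i :: (List.ofFn V).drop (i + 1) := by
      have := List.getElem_ofFn (f := V) (i := (i : ℕ)) (h := by simp)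
      rw [← show (List.ofFn V)[(i : ℕ)]'(by simp) = V i from this, List.getElem_cons_drop,
        List.take_append_drop]
    refine (holds_iff hf T _ _ _ _ fun g => indicator_some g V _ _ _ hs i ?_).1
      (h _ _ _ hs T hT)
    simp [i.2.le]
  · intro h l₁ x l₂ hs T hT
    have hn : n = l₁.length + (l₂.length + 1) := by
      have := congrArg List.length hs
      simpa using this
    have hV : V ⟨l₁.length, by omega⟩ = x := by
      have := List.getElem_ofFn (f := V) (i := l₁.length) (h := by simp; omega)
      rw [← this]
      simp only [hs]
      simp
    refine (holds_iff hf T _ _ _ _ fun g =>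
      indicator_some g V l₁ l₂ x hs ⟨l₁.length, by omega⟩ rfl).2 (h _ T ?_)
    rwa [hV]

theorem countP_ofFn (p : Rec m → Bool) (V : Fin n → Rec m) :
    (List.ofFn V).countP p = {i | p (V i) = true}.ncard := by
  rw [List.ofFn_eq_map, List.countP_map, List.countP_eq_length_filter,
    ← List.toFinset_card_of_nodup ((List.nodup_finRange n).filter _), Set.ncard_eq_toFinset_card']
  congr 1
  ext i
  simp

/-! ### Tests for certificates of lines -/

/-- The bits of the certificate of one of two lines. -/
def bit (c : Fin 2) (k : Fin 6) (x : Rec (2 * 6)) : Bool := x.2 (finProdFinEquiv (c, k))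

/-- The conditions on a certificate of a line that do not refer to an element. -/
def globalTests (c : Fin 2) : List (Test (2 * 6)) :=
  [⟨fun _ y => bit c 0 y || (bit c 1 y || bit c 2 y), some fun _ _ => true, true⟩,
    ⟨fun _ y => bit c 0 y || bit c 1 y, some fun _ _ => true, false⟩,
    ⟨fun _ y => bit c 0 y, some fun _ y => bit c 0 y || bit c 1 y, false⟩,
    ⟨fun _ y => (bit c 0 y && y.1) || bit c 5 y, none, true⟩,
    ⟨fun _ y => bit c 0 y && y.1, none, false⟩]

/-- The conditions on a certificate of a line that refer to an element. -/
def elementTests (c : Fin 2) (x : Rec (2 * 6)) : List (Test (2 * 6)) :=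
  (if bit c 0 x then [⟨fun e y => bit c 0 y && !e, some fun _ y => bit c 0 y, false⟩] else []) ++
  ((if bit c 1 x then [⟨fun e y => bit c 0 y || e, some fun _ y => bit c 0 y || bit c 1 y, true⟩]
    else []) ++
  ((if bit c 2 x then [⟨fun e y => bit c 0 y || (bit c 1 y || e), some fun _ _ => true, true⟩]
    else []) ++
  ((if bit c 3 x then [⟨fun e y => bit c 0 y || e, some fun _ y => bit c 0 y, false⟩,
      ⟨fun e y => bit c 0 y || (bit c 1 y || e), some fun _ y => bit c 0 y || bit c 1 y, true⟩]
    else if bit c 4 x then [⟨fun e y => bit c 0 y || e, some fun _ y => bit c 0 y, true⟩]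
    else [⟨fun e y => bit c 0 y || (bit c 1 y || e), some fun _ y => bit c 0 y || bit c 1 y,
      false⟩]) ++
  (if bit c 5 x then [⟨fun e y => (bit c 0 y && y.1) || e, none, true⟩] else []))))

theorem lineCertificate_iff (M : Matroid (Fin n)) (a : ℕ) (V : Fin n → Rec (2 * 6)) (c : Fin 2) :
    LineCertificate M {i | (V i).1 = true} a (fun k => {i | bit c k (V i) = true}) ↔
      (∀ T ∈ globalTests c, T.HoldsFor M a V none) ∧
        ∀ i, ∀ T ∈ elementTests c (V i), T.HoldsFor M a V (some i) := by
  have hu : rk M {j | True} = rk M Set.univ := congrArg _ (Set.eq_univ_of_forall fun _ => trivial)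
  constructor
  · rintro ⟨h₁, h₂, h₃, h₄, h₅, h₆, h₇, h₈, h₉, h₁₀, h₁₁, h₁₂, h₁₃⟩
    simp only [Set.mem_ofPred_eq] at *
    refine ⟨?_, fun i T hT => ?_⟩
    · simp [globalTests, Test.HoldsFor, h₁, h₂, h₃, h₄, h₅]
    · simp only [elementTests, List.mem_append] at hT
      rcases hT with hT | hT | hT | hT | hT
      · by_cases hi : bit c 0 (V i) = true
        · simp [hi] at hT
          subst hT
          simpa [Test.HoldsFor] using h₆ i hi
        · simp [hi] at hT
      · by_cases hi : bit c 1 (V i) = true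
        · simp [hi] at hT
          subst hT
          simpa [Test.HoldsFor] using h₇ i hi
        · simp [hi] at hT
      · by_cases hi : bit c 2 (V i) = true
        · simp [hi] at hT
          subst hT
          simpa [Test.HoldsFor, hu] using h₈ i hi
        · simp [hi] at hT
      · by_cases hi : bit c 3 (V i) = true
        · simp [hi] at hT
          rcases hT with rfl | rfl
          · simpa [Test.HoldsFor] using h₉ i hi
          · simpa [Test.HoldsFor] using h₁₀ i hi
        · by_cases hi' : bit c 4 (V i) = true
          · simp [hi, hi'] at hT
            subst hT
            simpa [Test.HoldsFor] using h₁₁ i hi hi'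
          · simp [hi, hi'] at hT
            subst hT
            simpa [Test.HoldsFor] using h₁₂ i hi hi'
      · by_cases hi : bit c 5 (V i) = true
        · simp [hi] at hT
          subst hT
          simpa [Test.HoldsFor] using h₁₃ i hi
        · simp [hi] at hT
  · rintro ⟨h, h'⟩
    simp [globalTests, Test.HoldsFor] at h
    obtain ⟨h₁, h₂, h₃, h₄, h₅⟩ := h
    simp only [elementTests, List.mem_append] at h'
    constructor
    · exact h₁
    · exact h₂
    · exact h₃
    · exact h₄
    · exact h₅
    · intro e he
      rw [Set.mem_ofPred_eq] at he
      have := h' e _ (.inl (by rw [if_pos he]; exact List.mem_singleton_self _))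
      simpa [Test.HoldsFor] using this
    · intro e he
      rw [Set.mem_ofPred_eq] at he
      have := h' e _ (.inr (.inl (by rw [if_pos he]; exact List.mem_singleton_self _)))
      simpa [Test.HoldsFor] using this
    · intro e he
      rw [Set.mem_ofPred_eq] at he
      have := h' e _ (.inr (.inr (.inl (by rw [if_pos he]; exact List.mem_singleton_self _))))
      simpa [Test.HoldsFor, hu] using this
    · intro e he
      rw [Set.mem_ofPred_eq] at he
      have := h' e _ (.inr (.inr (.inr (.inl (by rw [if_pos he]; exact List.mem_cons_self)))))
      simpa [Test.HoldsFor] using this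
    · intro e he
      rw [Set.mem_ofPred_eq] at he
      have := h' e _ (.inr (.inr (.inr (.inl (by
        rw [if_pos he]; exact List.mem_cons_of_mem _ (List.mem_singleton_self _))))))
      simpa [Test.HoldsFor] using this
    · intro e he he'
      rw [Set.mem_ofPred_eq] at he he'
      have := h' e _ (.inr (.inr (.inr (.inl (by
        rw [if_neg he, if_pos he']; exact List.mem_singleton_self _)))))
      simpa [Test.HoldsFor] using this
    · intro e he he'
      rw [Set.mem_ofPred_eq] at he he'
      have := h' e _ (.inr (.inr (.inr (.inl (by
        rw [if_neg he, if_neg he']; exact List.mem_singleton_self _)))))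
      simpa [Test.HoldsFor] using this
    · intro e he
      rw [Set.mem_ofPred_eq] at he
      have := h' e _ (.inr (.inr (.inr (.inr (by
        rw [if_pos he]; exact List.mem_singleton_self _)))))
      simpa [Test.HoldsFor] using this

/-- The records that are counted in order to compare the lines. -/
def lineCounts (x : Rec (2 * 6)) : Fin 4 → Bool :=
  ![bit 0 3 x && x.1, bit 1 3 x && !x.1, bit 1 3 x && x.1, bit 0 3 x && !x.1]

/-- Instances for which two lines certify that equality fails. -/
def lineLanguage (f : List Bool × List Bool → ℕ) : Language (Bool ⊕ (Bool ⊕ Bool)) :=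
  {x | ∃ V : List (Rec (2 * 6)), V.map Prod.fst = vectorOf x ∧
    Accepts f (globalTests 0 ++ globalTests 1) (fun x => elementTests 0 x ++ elementTests 1 x)
      lineCounts 0 (codeOf x) (numberOf x) V}

/-- Instances for which the number is the rank of the set selected by `g`, and the set selected by
`g'` is spanning. -/
def extremeLanguage (f : List Bool × List Bool → ℕ) (g g' : Bool → Bool) :
    Language (Bool ⊕ (Bool ⊕ Bool)) :=
  {x | ∃ V : List (Rec 0), V.map Prod.fst = vectorOf x ∧
    Accepts f [⟨fun _ y => g y.1, none, true⟩, ⟨fun _ y => g' y.1, some fun _ _ => true, true⟩]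
      (fun _ => []) (fun _ _ => false) 1 (codeOf x) (numberOf x) V}

theorem exists_ofFn {β : Type} (V : List β) (h : V.length = n) : ∃ V' : Fin n → β,
    V = List.ofFn V' := by
  subst h
  exact ⟨V.get, (List.ofFn_get V).symm⟩

theorem mem_iff_of_vectorOf {x : List (Bool ⊕ (Bool ⊕ Bool))} {R : Fin n → Bool}
    (hx : vectorOf x = List.ofFn R) (P : List (Rec m) → Prop) :
    (∃ V : List (Rec m), V.map Prod.fst = vectorOf x ∧ P V) ↔
      ∃ V : Fin n → Rec m, (∀ i, (V i).1 = R i) ∧ P (List.ofFn V) := by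
  rw [hx]
  constructor
  · rintro ⟨V, hV, h⟩
    obtain ⟨V, rfl⟩ := exists_ofFn (n := n) V (by
      have := congrArg List.length hV
      simpa using this)
    rw [List.map_ofFn, List.ofFn_inj] at hV
    exact ⟨V, fun i => congrFun hV i, h⟩
  · rintro ⟨V, hV, h⟩
    exact ⟨List.ofFn V, by rw [List.map_ofFn, List.ofFn_inj]; exact funext hV, h⟩

section Membership

variable {x : List (Bool ⊕ (Bool ⊕ Bool))} {R : Fin n → Bool}

/-- The twelve bits of a record tell in which of the six sets of each of the two certificates the
element lies, so lists of records over `R` correspond to pairs of such families. -/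
theorem mem_lineLanguage_iff
    (hf : ∀ B : Fin n → Bool, f (codeOf x, List.ofFn B) = rk M {i | B i = true})
    (hx : vectorOf x = List.ofFn R) (ha : numberOf x = encodeNat a) :
    x ∈ lineLanguage f ↔ ∃ D : Fin 2 → Fin 6 → Set (Fin n),
      (∀ c, LineCertificate M {i | R i = true} a (D c)) ∧
        (D 1 3 ∩ {i | R i = true}).ncard * (D 0 3 ∩ {i | R i = true}ᶜ).ncard <
          (D 0 3 ∩ {i | R i = true}).ncard * (D 1 3 ∩ {i | R i = true}ᶜ).ncard := by
  classical
  have key : ∀ V : Fin n → Rec (2 * 6), (∀ i, (V i).1 = R i) →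
      (Accepts f (globalTests 0 ++ globalTests 1) (fun x => elementTests 0 x ++ elementTests 1 x)
        lineCounts 0 (codeOf x) (numberOf x) (List.ofFn V) ↔
      (∀ c, LineCertificate M {i | R i = true} a fun k => {i | bit c k (V i) = true}) ∧
        ({i | bit 1 3 (V i) = true} ∩ {i | R i = true}).ncard *
            ({i | bit 0 3 (V i) = true} ∩ {i | R i = true}ᶜ).ncard <
          ({i | bit 0 3 (V i) = true} ∩ {i | R i = true}).ncard *
            ({i | bit 1 3 (V i) = true} ∩ {i | R i = true}ᶜ).ncard) := by
    intro V hV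
    have hR : {i | R i = true} = {i | (V i).1 = true} := by simp only [hV]
    have hc : (List.ofFn V).countP (lineCounts · 2) * (List.ofFn V).countP (lineCounts · 3) <
        (List.ofFn V).countP (lineCounts · 0) * (List.ofFn V).countP (lineCounts · 1) + 0 ↔
        ({i | bit 1 3 (V i) = true} ∩ {i | R i = true}).ncard *
            ({i | bit 0 3 (V i) = true} ∩ {i | R i = true}ᶜ).ncard <
          ({i | bit 0 3 (V i) = true} ∩ {i | R i = true}).ncard *
            ({i | bit 1 3 (V i) = true} ∩ {i | R i = true}ᶜ).ncard := by
      simp only [countP_ofFn, lineCounts, Matrix.cons_val, Bool.and_eq_true, Bool.not_eq_true',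
        hV, add_zero]
      have h₁ : ∀ c, {i | bit c 3 (V i) = true ∧ R i = true} =
        {i | bit c 3 (V i) = true} ∩ {i | R i = true} := fun c => rfl
      have h₂ : ∀ c, {i | bit c 3 (V i) = true ∧ R i = false} =
        {i | bit c 3 (V i) = true} ∩ {i | R i = true}ᶜ := fun c => by
          ext i
          simp
      rw [h₁, h₁, h₂, h₂]
    rw [← hc, hR]
    simp only [lineCertificate_iff, Fin.forall_fin_two]
    constructor
    · rintro ⟨h₁, h₂, h₃⟩
      rw [ha] at h₁ h₂
      rw [allHold_iff hf] at h₂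
      simp only [holds_none_iff hf, List.mem_append] at h₁ h₂
      exact ⟨⟨⟨fun T hT => h₁ T (.inl hT), fun i T hT => h₂ i T (.inl hT)⟩,
        fun T hT => h₁ T (.inr hT), fun i T hT => h₂ i T (.inr hT)⟩, h₃⟩
    · rintro ⟨⟨⟨h₁, h₂⟩, h₁', h₂'⟩, h₃⟩
      refine ⟨?_, ?_, h₃⟩
      · rw [ha]
        simp only [holds_none_iff hf, List.mem_append]
        exact fun T hT => hT.elim (h₁ T) (h₁' T)
      · rw [ha, allHold_iff hf]
        simp only [List.mem_append]
        exact fun i T hT => hT.elim (h₂ i T) (h₂' i T)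
  refine (mem_iff_of_vectorOf hx _).trans ⟨?_, ?_⟩
  · rintro ⟨V, hV, h⟩
    exact ⟨_, (key V hV).1 h⟩
  · rintro ⟨D, hD⟩
    let V : Fin n → Rec (2 * 6) := fun i => (R i, fun t =>
      decide (i ∈ D (finProdFinEquiv.symm t).1 (finProdFinEquiv.symm t).2))
    have hV : ∀ c k, {i | bit c k (V i) = true} = D c k := by
      intro c k
      ext i
      simp only [V, bit, Set.mem_ofPred_eq, Equiv.symm_apply_apply, decide_eq_true_eq]
    refine ⟨V, fun i => rfl, (key V fun i => rfl).2 ?_⟩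
    simp only [hV]
    exact hD

/-- No certificate bits are needed here. All counts are zero, and `δ = 1` makes the condition on
counts read 0 < 1. -/
theorem mem_extremeLanguage_iff
    (hf : ∀ B : Fin n → Bool, f (codeOf x, List.ofFn B) = rk M {i | B i = true})
    (hx : vectorOf x = List.ofFn R) (ha : numberOf x = encodeNat a) (g g' : Bool → Bool) :
    x ∈ extremeLanguage f g g' ↔
      rk M {i | g (R i) = true} = a ∧ rk M {i | g' (R i) = true} = rk M Set.univ := by
  have hu : rk M {j | True} = rk M Set.univ := congrArg _ (Set.eq_univ_of_forall fun _ => trivial)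
  refine (mem_iff_of_vectorOf hx _).trans ⟨?_, fun h => ⟨fun i => (R i, Fin.elim0), fun _ => rfl, ?_⟩⟩
  · rintro ⟨V, hV, h, -, -⟩
    rw [ha] at h
    simpa [holds_none_iff hf, Test.HoldsFor, hV, hu] using h
  · refine ⟨?_, fun l₁ y l₂ _ T hT => absurd hT List.not_mem_nil, by simp⟩
    rw [ha]
    simpa [holds_none_iff hf, Test.HoldsFor, hu] using h

end Membership

end Verifier

end StackProg

/-! ### Membership of the decision problem in coNP -/

namespace MatroidPresentation

open StackProg StackProg.Verifier MatroidForm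

variable {𝓟 : MatroidPresentation}

theorem codeOf_encodeInstance (w R : List Bool) (a : ℕ) : codeOf (encodeInstance w R a) = w := by
  simp [codeOf, encodeInstance, encodingProd, encodingList, readSymbol, List.flatMap_map]

theorem vectorOf_encodeInstance (w R : List Bool) (a : ℕ) :
    vectorOf (encodeInstance w R a) = R := by
  have h (l : List Bool) : l.flatMap (fun _ => ([] : List Bool)) = [] := by simp
  simp [vectorOf, encodeInstance, encodingProd, encodingList, readSymbol, List.flatMap_map, h]

theorem numberOf_encodeInstance (w R : List Bool) (a : ℕ) :
    numberOf (encodeInstance w R a) = encodeNat a := by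
  have h (l : List Bool) : l.flatMap (fun _ => ([] : List Bool)) = [] := by simp
  simp [numberOf, encodeInstance, encodingProd, encodingList, encodingNatBool, readSymbol,
    List.flatMap_map, h]

theorem mem_EBULC₀_iff {w : List Bool} (hw : w ∈ 𝓟.codes) (R : Fin (𝓟.size w) → Bool) {a : ℕ}
    (ha : a ≤ (𝓟.matroid w).natRank) : encodeInstance w (List.ofFn R) a ∈ 𝓟.EBULC₀ ↔
      (𝓟.matroid w).SYEquality {i | R i = true} a := by
  constructor
  · rintro ⟨w', hw', R', a', ha', hx, h⟩
    obtain rfl : w = w' := by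
      rw [← codeOf_encodeInstance w (List.ofFn R) a, hx, codeOf_encodeInstance]
    obtain rfl : R = R' := by
      rw [← List.ofFn_inj, ← vectorOf_encodeInstance w (List.ofFn R) a, hx,
        vectorOf_encodeInstance]
    obtain rfl : a = a' := by
      apply encodeNat_injective
      rw [← numberOf_encodeInstance w (List.ofFn R) a, hx, numberOf_encodeInstance]
    exact h
  · exact fun h => ⟨w, hw, R, a, ha, rfl, h⟩

theorem notMem_EBULC₀_iff {f : List Bool × List Bool → ℕ}
    (hf : ∀ w ∈ 𝓟.codes, ∀ A : Fin (𝓟.size w) → Bool,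
      f (w, List.ofFn A) = ((𝓟.matroid w).eRk {i | A i = true}).toNat)
    {x : List (Bool ⊕ (Bool ⊕ Bool))} (hx : x ∈ 𝓟.instances) :
    x ∉ 𝓟.EBULC₀ ↔ x ∈ extremeLanguage f (fun _ => false) not ∨
      x ∈ extremeLanguage f (fun _ => true) id ∨ x ∈ lineLanguage f := by
  obtain ⟨w, hw, R, a, ha, rfl⟩ := hx
  have hf' : ∀ B : Fin (𝓟.size w) → Bool,
      f (codeOf (encodeInstance w (List.ofFn R) a), List.ofFn B) =
        rk (𝓟.matroid w) {i | B i = true} := fun B => by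
    rw [codeOf_encodeInstance, hf w hw, rk]
  have hv := vectorOf_encodeInstance w (List.ofFn R) a
  have hn := numberOf_encodeInstance w (List.ofFn R) a
  rw [mem_EBULC₀_iff hw R ha, not_syEquality_iff (𝓟.ground_eq w hw) _ ha,
    mem_lineLanguage_iff hf' hv hn, mem_extremeLanguage_iff hf' hv hn,
    mem_extremeLanguage_iff hf' hv hn]
  have h₁ : {i : Fin (𝓟.size w) | false = true} = ∅ := by ext; simp
  have h₂ : {i : Fin (𝓟.size w) | true = true} = Set.univ := by ext; simp
  have h₃ : {i | (!R i) = true} = {i | R i = true}ᶜ := by ext; simp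
  rw [h₁, h₂, h₃]
  rfl

/-- The instances of `EBULC_0` form a promise problem in coNP. -/
theorem Succinct.exists_inCoNP (h : 𝓟.Succinct) : ∃ L : Language (Bool ⊕ (Bool ⊕ Bool)),
    L.InCoNP ∧ ∀ x ∈ 𝓟.instances, (x ∈ L ↔ x ∈ 𝓟.EBULC₀) := by
  obtain ⟨f, hf, hf'⟩ := h
  have h₁ (g g' : Bool → Bool) : HasLinearCertificates (extremeLanguage f g g') :=
    hasLinearCertificates_accepts hf _ _ _ _
  have h₂ : HasLinearCertificates (lineLanguage f) := hasLinearCertificates_accepts hf _ _ _ _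
  let W : Language (Bool ⊕ (Bool ⊕ Bool)) :=
    {x | x ∈ extremeLanguage f (fun _ => true) id ∨ x ∈ lineLanguage f}
  have hW : W.InNP := (h₁ (fun _ => true) id).inNP_or h₂.inNP fun x => Iff.rfl
  let U : Language (Bool ⊕ (Bool ⊕ Bool)) :=
    {x | x ∈ extremeLanguage f (fun _ => false) not ∨ x ∈ W}
  have hU : U.InNP := (h₁ (fun _ => false) not).inNP_or hW fun x => Iff.rfl
  -- `U` describes the failure of equality correctly on instances only; its values elsewhere are
  -- irrelevant for the promise problem.
  refine ⟨Uᶜ, by rwa [Language.InCoNP, compl_compl], fun x hx => ?_⟩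
  rw [← not_iff_not, notMem_EBULC₀_iff hf' hx]
  exact not_not

theorem Succinct.inCoNP (h : 𝓟.Succinct) (hI : Language.InCoNP 𝓟.instances) :
    Language.InCoNP 𝓟.EBULC₀ := by
  obtain ⟨f, hf, hf'⟩ := h
  have h₁ (g g' : Bool → Bool) : HasLinearCertificates (extremeLanguage f g g') :=
    hasLinearCertificates_accepts hf _ _ _ _
  have h₂ : HasLinearCertificates (lineLanguage f) := hasLinearCertificates_accepts hf _ _ _ _
  -- The non-instances, which are in NP by `hI`, join as the second language of a union, because
  -- nothing is known about overlong certificates for them.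
  let W₁ : Language (Bool ⊕ (Bool ⊕ Bool)) :=
    {x | x ∈ lineLanguage f ∨ x ∈ (𝓟.instances)ᶜ}
  have hW₁ : W₁.InNP := h₂.inNP_or hI fun x => Iff.rfl
  let W₂ : Language (Bool ⊕ (Bool ⊕ Bool)) :=
    {x | x ∈ extremeLanguage f (fun _ => true) id ∨ x ∈ W₁}
  have hW₂ : W₂.InNP := (h₁ (fun _ => true) id).inNP_or hW₁ fun x => Iff.rfl
  refine (h₁ (fun _ => false) not).inNP_or hW₂ fun x => ?_
  by_cases hx : x ∈ 𝓟.instances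
  · refine (notMem_EBULC₀_iff hf' hx).trans (or_congr_right (or_congr_right (or_iff_left ?_).symm))
    exact not_not.2 hx
  · refine iff_of_true (fun h => hx ?_) (.inr (.inr (.inr hx)))
    obtain ⟨w, hw, R, a, ha, rfl, -⟩ := h
    exact ⟨w, hw, R, a, ha, rfl⟩

end MatroidPresentation

/-- For matroids given by a succinct presentation, `EBULC_0` is in coNP: as a promise problem on
the instances `(M, R, a)`, and as a language whenever the well-formed instances form a language
in coNP (in particular, whenever they can be recognized in polynomial time). -/
theorem corollary1p5 (𝓟 : MatroidPresentation) (h𝓟 : 𝓟.Succinct) :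
    (∃ L : Language (Bool ⊕ (Bool ⊕ Bool)),
      L.InCoNP ∧ ∀ x ∈ 𝓟.instances, (x ∈ L ↔ x ∈ 𝓟.EBULC₀)) ∧
    (Language.InCoNP 𝓟.instances → Language.InCoNP 𝓟.EBULC₀) :=
  ⟨h𝓟.exists_inCoNP, h𝓟.inCoNP⟩
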